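/- Let $d\ge 2$ be an integer, $\lambda>1$, $\tfrac12<\alpha<1$ and $\zeta\in\mathbb R$. Let $\mathcal G^d(N,p)$ be the random $d$-uniform hypergraph on $\{1,\dots,N\}$ in which each $d$-element subset is an edge independently with probability $p=\lambda (d-2)!/N^{d-1}$ ($N$ so large that $p\le 1$). Let $k_N$ be integers with $k_N=o(N)$. Explore $\mathcal G^d(N,p)$ as follows. Initially the first $k_N$ vertices are active and all others unseen. In each step the first active vertex, or, if there is none, the first unseen vertex, is declared explored, and all its other unseen neighbours (vertices sharing an edge with it) become active. Let $\eta_t$ be the number of vertices that become active in step $t$, let $\mathcal F_t=\sigma(\eta_1,\dots,\eta_t)$, and put $$\Delta_t=\eta_t-\mathbb E[\eta_t\mid\mathcal F_{t-1}],\qquad \alpha_t=p\binom{N-t-1}{d-2},\qquad \beta_t=\prod_{i=1}^t(1-\alpha_i),\qquad S_t=\sum_{i=1}^t\frac{1}{\beta_i}\Delta_i .$$ Let $\rho_\lambda\in(0,1)$ be the solution of $1-\rho_\lambda=e^{-\lambda\rho_\lambda}$, define $\overline{\rho_\lambda}$ by $1-\overline{\rho_\lambda}=(1-\rho_\lambda)^{1/(d-1)}$,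 let $\lambda_*=\lambda(1-\overline{\rho_\lambda})^{d-1}$ and $$c=\lambda(1-\overline{\rho_\lambda})^2-\lambda_*(1-\overline{\rho_\lambda})+\overline{\rho_\lambda}(1-\overline{\rho_\lambda}).$$ Let $\gamma(N)$ be non-negative integers with $|\gamma(N)-(\overline{\rho_\lambda}N+\zeta N^\alpha)|\le 1$ for all large $N$. Then $c>0$, and the random variables $Y_N=\beta_{\gamma(N)}S_{\gamma(N)}/N^\alpha$ satisfy a moderate deviation principle with speed $N^{2\alpha-1}$ and rate function $I(x)=x^2/(2c)$: the level sets $\{I\le L\}$, $L\ge 0$, are compact, $$\liminf_{N\to\infty}\frac{1}{N^{2\alpha-1}}\log\mathbb P(Y_N\in G)\ge-\inf_{x\in G}I(x)\quad\text{for every open } G\subseteq\mathbb R,$$ $$\limsup_{N\to\infty}\frac{1}{N^{2\alpha-1}}\log\mathbb P(Y_N\in F)\le-\inf_{x\in F}I(x)\quad\text{for every closed } F\subseteq\mathbb R.$$ -/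

import Mathlib

open MeasureTheory ProbabilityTheory Filter Topology
open scoped ENNReal NNReal

noncomputable section

namespace HypergraphExploration

/-! ### Large (moderate) deviation principles -/

/-- The real random variables `Y n`, each defined on its own probability space `(Ω n, P n)`, satisfy
a large deviation principle with speed `a n` and good rate function `I`: the level sets of `I` are
compact, and the lower bound for open sets and the upper bound for closed sets hold. Probabilities
equal to `0` have logarithm `-∞`. -/
structure SatisfiesLDP {Ω : ℕ → Type*} [∀ n, MeasurableSpace (Ω n)] (P : ∀ n, Measure (Ω n))
    (Y : ∀ n, Ω n → ℝ) (a : ℕ → ℝ) (I : ℝ → ℝ≥0∞) : Prop where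
  isCompact_level : ∀ L : ℝ≥0, IsCompact {x : ℝ | I x ≤ (L : ℝ≥0∞)}
  lower_bound : ∀ G : Set ℝ, IsOpen G →
    -(⨅ x ∈ G, (I x : EReal)) ≤
      liminf (fun n => ((1 / a n : ℝ) : EReal) * ENNReal.log (P n (Y n ⁻¹' G))) atTop
  upper_bound : ∀ F : Set ℝ, IsClosed F →
    limsup (fun n => ((1 / a n : ℝ) : EReal) * ENNReal.log (P n (Y n ⁻¹' F))) atTop ≤
      -(⨅ x ∈ F, (I x : EReal))

/-! ### The random hypergraph -/

/-- The edge probability `p = lam (d-2)! / N^(d-1)`. -/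
def edgeProb (d : ℕ) (lam : ℝ) (N : ℕ) : ℝ :=
  lam * ((d - 2).factorial : ℝ) / (N : ℝ) ^ (d - 1)

/-- The law of the random `d`-uniform hypergraph on the vertex set `Fin N`, given by its set of
edges: each of the `d`-element vertex sets is an edge with probability `p`, independently of the
others. (The projection to `[0,1]` only matters for the finitely many `N` with `p > 1`.) -/
def hypergraphLaw (d : ℕ) (lam : ℝ) (N : ℕ) : Measure (Set (Finset (Fin N))) :=
  setBernoulli {e : Finset (Fin N) | e.card = d}
    (Set.projIcc (0 : ℝ) 1 zero_le_one (edgeProb d lam N))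

/-! ### The exploration process -/

/-- A state of the exploration: the sets of active and of explored vertices. -/
structure State (N : ℕ) where
  active : Finset (Fin N)
  explored : Finset (Fin N)

/-- A vertex that is neither active nor explored is unseen. -/
def State.unseen {N : ℕ} (s : State N) : Finset (Fin N) := (s.active ∪ s.explored)ᶜ

/-- Initially the first `k` vertices are active and all others are unseen. -/
def initialState (N k : ℕ) : State N where
  active := Finset.univ.filter (fun v => (v : ℕ) < k)
  explored := ∅

/-- The vertex explored next: the first active vertex; if there is none, the exploration continues
with the first unseen vertex. There is none only when all vertices are explored. -/
def State.next {N : ℕ} (s : State N) : Option (Fin N) :=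
  if h : s.active.Nonempty then some (s.active.min' h)
  else if h' : s.unseen.Nonempty then some (s.unseen.min' h')
  else none

open Classical in
/-- The unseen vertices (other than `v`) that share an edge with `v`. -/
def State.newlyActive {N : ℕ} (G : Set (Finset (Fin N))) (s : State N) (v : Fin N) :
    Finset (Fin N) :=
  s.unseen.filter (fun u => u ≠ v ∧ ∃ e ∈ G, v ∈ e ∧ u ∈ e)

/-- One step: the next vertex becomes explored and its unseen neighbours become active. -/
def State.step {N : ℕ} (G : Set (Finset (Fin N))) (s : State N) : State N :=
  match s.next with
  | none => s
  | some v =>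
    { active := s.active.erase v ∪ s.newlyActive G v
      explored := insert v s.explored }

/-- The state of the exploration of the hypergraph `G` after `t` steps. -/
def stateAt {N : ℕ} (G : Set (Finset (Fin N))) (k : ℕ) : ℕ → State N
  | 0 => initialState N k
  | t + 1 => (stateAt G k t).step G

/-- `eta G k t` is the number of unseen vertices that become active in step `t ≥ 1`. -/
def eta {N : ℕ} (G : Set (Finset (Fin N))) (k : ℕ) : ℕ → ℕ
  | 0 => 0
  | t + 1 =>
    match (stateAt G k t).next with
    | none => 0
    | some v => ((stateAt G k t).newlyActive G v).card

/-- The σ-algebra `ℱ_t` generated by `η_1, …, η_t` (the number `k` of vertices that are active at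
time `0` is deterministic). -/
@[reducible] def history (N k t : ℕ) : MeasurableSpace (Set (Finset (Fin N))) :=
  ⨆ i ∈ Finset.Icc 1 t, MeasurableSpace.comap (fun G => eta G k i) ⊤

/-- The martingale difference `Δ_t = η_t - E[η_t | ℱ_{t-1}]`, `t ≥ 1`. -/
def increment (d : ℕ) (lam : ℝ) (N k t : ℕ) (G : Set (Finset (Fin N))) : ℝ :=
  (eta G k t : ℝ) -
    ((hypergraphLaw d lam N)[fun G' => (eta G' k t : ℝ) | history N k (t - 1)]) G

/-- `α_t = p * binom(N-t-1, d-2)`. -/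
def alphaCoeff (d : ℕ) (lam : ℝ) (N t : ℕ) : ℝ :=
  edgeProb d lam N * ((N - t - 1).choose (d - 2) : ℝ)

/-- `β_t = ∏_{i=1}^t (1 - α_i)`. -/
def betaCoeff (d : ℕ) (lam : ℝ) (N t : ℕ) : ℝ :=
  ∏ i ∈ Finset.Icc 1 t, (1 - alphaCoeff d lam N i)

/-- The exploration martingale `S_t = ∑_{i=1}^t Δ_i / β_i`. -/
def explorationMartingale (d : ℕ) (lam : ℝ) (N k t : ℕ) (G : Set (Finset (Fin N))) : ℝ :=
  ∑ i ∈ Finset.Icc 1 t, 1 / betaCoeff d lam N i * increment d lam N k i G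

/-! ### The constants -/

/-- `ρ_λ`, the largest solution in `[0,1]` of `1 - ρ = exp (-λ ρ)`; for `λ > 1` it is the unique
solution in `(0,1]`. -/
def rho (lam : ℝ) : ℝ :=
  sSup {x : ℝ | 0 ≤ x ∧ x ≤ 1 ∧ 1 - x = Real.exp (-(lam * x))}

/-- `ρ_{d,λ}`, given by `1 - ρ_{d,λ} = (1 - ρ_λ)^(1/(d-1))`. -/
def rhoBar (d : ℕ) (lam : ℝ) : ℝ :=
  1 - (1 - rho lam) ^ (1 / ((d : ℝ) - 1))

/-- The dual branching parameter `λ_* = λ (1 - ρ_{d,λ})^(d-1)`. -/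
def lamStar (d : ℕ) (lam : ℝ) : ℝ :=
  lam * (1 - rhoBar d lam) ^ (d - 1)

/-- `c = λ (1 - ρ)² - λ_* (1 - ρ) + ρ (1 - ρ)` with `ρ = ρ_{d,λ}`. -/
def varConst (d : ℕ) (lam : ℝ) : ℝ :=
  lam * (1 - rhoBar d lam) ^ 2 - lamStar d lam * (1 - rhoBar d lam)
    + rhoBar d lam * (1 - rhoBar d lam)

end HypergraphExploration

end

open HypergraphExploration

/-! It suffices to control moment generating functions. Write ε = N^(α-1), so that the speed is ε²N
and θN^(2α-1)Y_N = θεβ_γS_γ. If log E exp(θεβ_γS_γ) = ε²N(cθ²/2 + o(1)) for every θ, then the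
quadratic case of the Gärtner-Ellis theorem, `QuadraticLogMgf.satisfiesLDP`, gives the result.

The exploration never reuses an edge: no edge joins an explored vertex to an unseen one, so the
first t states are read off from edges that meet the explored set, while the next step uses only
edges that avoid it (`integral_of_history`). Hence the increments are explicit, Δ_{t+1} = η_{t+1} -
m_t q_{t+1}, where m_t is the number of unseen vertices left once the next vertex is chosen and q is
the chance to be hit. They have uniform exponential moments, so the conditional moment generating
function of sΔ is exp(s² Var/2 + O(|s|³)). Multiplying over the steps, E exp(W - Q) = exp(O(ε³N)),
where W = θεβ_γS_γ and Q is half its predictable quadratic variation (`integral_chain_bounds`).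

It remains to replace Q by the constant ε²N cθ²/2. The conditional variance of a step is m_t α_{t+1}
+ m_t²(α_{t+1} - α_{t+2}) + O(1/N); the second term is the correlation of vertices found through a
common edge. The number U_t of unseen vertices satisfies U_t/β_t = U_0 - (idle steps) + O(1) - S_t.
An idle step, one with no active vertex, forces U_t = N - t. On the event |S_t| ≤ δN this makes the
idle sum small, because Nβ_t ≤ N - t + o(N) up to time γ: the limit curve exp(-Λ(s)) of β, with Λ =
`cumRate`, is convex and meets 1 - s at 0 and at the endpoint `rhoBar`. So m_t ≈ Nβ_t, and both
parts of the weighted variance sum telescope, with limit c per vertex.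

The exceptional event has probability at most exp(-rN) for some r > 0, negligible at speed ε²N =
o(N). Together with the crude bound E exp(2W) ≤ exp(Cε²N) this allows the replacement
(`half_exp_le_integral_exp_le`). -/

noncomputable section

namespace HypergraphExploration

/-! ### Independent edges: product formulas for `setBernoulli`. -/

section SetBernoulli

variable {ι : Type*} [Fintype ι] {u : Set ι} {p : unitInterval}

/-- The product law of the membership indicators underlying `setBernoulli`. -/
def indicatorLaw (u : Set ι) (p : unitInterval) : Measure (ι → Prop) :=
  Measure.infinitePi fun i : ι ↦
      unitInterval.toNNReal p • Measure.dirac (i ∈ u) +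
      unitInterval.toNNReal (unitInterval.symm p) • Measure.dirac False

instance : IsProbabilityMeasure (indicatorLaw u p) := by
  unfold indicatorLaw; infer_instance

lemma integral_setBernoulli (f : Set ι → ℝ) :
    ∫ G, f G ∂(setBernoulli u p) = ∫ q, f {i | q i} ∂(indicatorLaw u p) := by
  rw [setBernoulli_eq_map, integral_map]
  · rfl
  · exact (measurable_of_finite _).aemeasurable
  · exact (measurable_of_finite f).aestronglyMeasurable

omit [Fintype ι] in
lemma iIndepFun_indicatorLaw :
    iIndepFun (fun (i : ι) (q : ι → Prop) => q i) (indicatorLaw u p) :=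
  iIndepFun_infinitePi (X := fun (_ : ι) (q : Prop) => q) (fun _ => measurable_id)

/-- `f` depends only on the membership of the elements of `A`. -/
def DependsOnSet (A : Finset ι) (f : Set ι → ℝ) : Prop :=
  ∀ G G' : Set ι, (∀ i ∈ A, i ∈ G ↔ i ∈ G') → f G = f G'

/-- Membership indicators over disjoint index sets are independent, and each factor can be computed
from its own coordinates after declaring all other elements absent. -/
lemma integral_mul_setBernoulli {A B : Finset ι} (hAB : Disjoint A B) {f g : Set ι → ℝ}
    (hf : DependsOnSet A f) (hg : DependsOnSet B g) :
    ∫ G, f G * g G ∂(setBernoulli u p) =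
      (∫ G, f G ∂(setBernoulli u p)) * ∫ G, g G ∂(setBernoulli u p) := by
  have h := (iIndepFun_indicatorLaw (u := u) (p := p)).indepFun_finset A B hAB
    (fun i => measurable_pi_apply i)
  have h2 := h.comp (φ := fun q => f {i | ∃ h : i ∈ A, q ⟨i, h⟩})
    (ψ := fun q => g {i | ∃ h : i ∈ B, q ⟨i, h⟩}) (measurable_of_finite _) (measurable_of_finite _)
  have h3 := h2.integral_mul_eq_mul_integral (𝕜 := ℝ)
    (measurable_of_finite _).aestronglyMeasurable (measurable_of_finite _).aestronglyMeasurable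
  rw [integral_setBernoulli, integral_setBernoulli, integral_setBernoulli]
  have e1 : ∀ q : ι → Prop, f {i | q i} = f {i | ∃ _ : i ∈ A, q i} := fun q =>
    hf _ _ fun i hi => ⟨fun h => ⟨hi, h⟩, fun h => h.2⟩
  have e2 : ∀ q : ι → Prop, g {i | q i} = g {i | ∃ _ : i ∈ B, q i} := fun q =>
    hg _ _ fun i hi => ⟨fun h => ⟨hi, h⟩, fun h => h.2⟩
  rw [integral_congr_ae (ae_of_all _ e1), integral_congr_ae (ae_of_all _ e2),
    integral_congr_ae (ae_of_all _ fun q => by rw [e1 q, e2 q])]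
  exact h3

lemma integral_mem_setBernoulli {i : ι} (hi : i ∈ u) (a b : ℝ) [∀ G : Set ι, Decidable (i ∈ G)] :
    ∫ G, (if i ∈ G then a else b) ∂(setBernoulli u p) = p * a + (1 - p) * b := by
  classical
  rw [integral_setBernoulli]
  have hm := (measurePreserving_eval_infinitePi (fun i : ι ↦
      unitInterval.toNNReal p • Measure.dirac (i ∈ u) +
      unitInterval.toNNReal (unitInterval.symm p) • Measure.dirac False) i)
  have h := integral_map (μ := indicatorLaw u p) (φ := Function.eval i)
    (f := fun q : Prop => if q then a else b) (measurable_of_finite _).aemeasurable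
    (measurable_of_finite _).aestronglyMeasurable
  unfold indicatorLaw at h ⊢
  rw [hm.map_eq] at h
  simp only [Function.eval] at h
  have e : ∀ q : ι → Prop, (if i ∈ {j | q j} then a else b) = if q i then a else b := by
    intro q; congr
  simp_rw [e]
  rw [← h, integral_add_measure (Integrable.of_finite) (Integrable.of_finite)]
  simp [hi, NNReal.smul_def]

/-- Used with `a = 0` for the probability that no edge of `S` is present, and with `a = exp d` for
an exponential moment of the number of edges present. -/
lemma integral_prod_setBernoulli (S : Finset ι) (hS : ∀ i ∈ S, i ∈ u) (a : ℝ)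
    [∀ (i : ι) (G : Set ι), Decidable (i ∈ G)] :
    ∫ G, ∏ i ∈ S, (if i ∈ G then a else 1) ∂(setBernoulli u p) = (1 - p + p * a) ^ S.card := by
  classical
  induction S using Finset.induction_on with
  | empty => simp
  | insert i S hi ih =>
    simp_rw [Finset.prod_insert hi]
    rw [integral_mul_setBernoulli (A := {i}) (B := S) (by simpa using hi),
      integral_mem_setBernoulli (hS i (by simp)), ih (fun j hj => hS j (by simp [hj])),
      Finset.card_insert_of_notMem hi, pow_succ]
    · ring
    · intro G G' h
      have := h i (by simp)
      simp only [this]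
    · intro G G' h
      refine Finset.prod_congr rfl fun j hj => ?_
      simp only [h j hj]

end SetBernoulli

/-! ### From quadratic logarithmic moment generating functions to the deviation principle. -/

lemma scaled_log_le {Ω : Type*} [MeasurableSpace Ω] (P : Measure Ω) [IsFiniteMeasure P] {S : Set Ω}
    {a b : ℝ} (ha : 0 < a) (h : P.real S ≤ Real.exp (a * b)) :
    ((1 / a : ℝ) : EReal) * ENNReal.log (P S) ≤ (b : EReal) := by
  have h1 : P S ≤ ENNReal.ofReal (Real.exp (a * b)) := by
    rw [← ofReal_measureReal]
    exact ENNReal.ofReal_le_ofReal h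
  have h2 := ENNReal.log_le_log h1
  rw [ENNReal.log_ofReal_of_pos (Real.exp_pos _), Real.log_exp] at h2
  have h3 := mul_le_mul_of_nonneg_left h2 (a := ((1 / a : ℝ) : EReal))
    (EReal.coe_nonneg.2 (by positivity))
  refine h3.trans_eq ?_
  rw [← EReal.coe_mul]
  congr 1
  field_simp

lemma le_scaled_log {Ω : Type*} [MeasurableSpace Ω] (P : Measure Ω) [IsFiniteMeasure P] {S : Set Ω}
    {a b : ℝ} (ha : 0 < a) (h : Real.exp (a * b) ≤ P.real S) :
    (b : EReal) ≤ ((1 / a : ℝ) : EReal) * ENNReal.log (P S) := by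
  have h1 : ENNReal.ofReal (Real.exp (a * b)) ≤ P S := by
    rw [← ofReal_measureReal (μ := P)]
    exact ENNReal.ofReal_le_ofReal h
  have h2 := ENNReal.log_le_log h1
  rw [ENNReal.log_ofReal_of_pos (Real.exp_pos _), Real.log_exp] at h2
  have h3 := mul_le_mul_of_nonneg_left h2 (a := ((1 / a : ℝ) : EReal))
    (EReal.coe_nonneg.2 (by positivity))
  refine Eq.trans_le ?_ h3
  rw [← EReal.coe_mul]
  congr 1
  field_simp

section LDP

variable {Ω : ℕ → Type*} [∀ n, MeasurableSpace (Ω n)] {P : ∀ n, Measure (Ω n)}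
  [∀ n, IsProbabilityMeasure (P n)] {Y : ∀ n, Ω n → ℝ} {a : ℕ → ℝ} {c : ℝ}

/-- The logarithmic moment generating functions, scaled by `a`, converge to `θ ↦ c θ² / 2`. -/
def QuadraticLogMgf (P : ∀ n, Measure (Ω n)) (Y : ∀ n, Ω n → ℝ) (a : ℕ → ℝ) (c : ℝ) : Prop :=
  ∀ θ κ : ℝ, 0 < κ → ∀ᶠ n in atTop,
    Real.exp (a n * (c * θ ^ 2 / 2 - κ)) ≤ mgf (Y n) (P n) (θ * a n) ∧
    mgf (Y n) (P n) (θ * a n) ≤ Real.exp (a n * (c * θ ^ 2 / 2 + κ))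

lemma two_le_exp_eventually (ha : Tendsto a atTop atTop) {κ : ℝ} (hκ : 0 < κ) :
    ∀ᶠ n in atTop, 2 ≤ Real.exp (a n * κ) := by
  filter_upwards [ha.eventually_ge_atTop (1 / κ)] with n hn
  have : 1 ≤ a n * κ := by rwa [div_le_iff₀ hκ] at hn
  linarith [Real.add_one_le_exp (a n * κ)]

/-- Chernoff's bound on both sides with the optimal tilt `± r / c`; the factor 2 of the union bound
is absorbed by one of the two halves of `κ`. -/
lemma QuadraticLogMgf.abs_tail (h : QuadraticLogMgf P Y a c)
    (hint : ∀ n θ, Integrable (fun ω => Real.exp (θ * Y n ω)) (P n))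
    (ha : Tendsto a atTop atTop) (hc : 0 < c) {r κ : ℝ} (hr : 0 ≤ r) (hκ : 0 < κ) :
    ∀ᶠ n in atTop, (P n).real {ω | r ≤ |Y n ω|} ≤
      Real.exp (a n * (-(r ^ 2 / (2 * c)) + κ)) := by
  filter_upwards [h (r / c) (κ / 2) (half_pos hκ), h (-(r / c)) (κ / 2) (half_pos hκ),
    two_le_exp_eventually ha (half_pos hκ), ha.eventually_gt_atTop 0] with n h1 h2 h3 h4
  have t1 := measure_ge_le_exp_mul_mgf (μ := P n) (X := Y n) r (t := r / c * a n)
    (by positivity) (hint _ _)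
  have t2 := measure_le_le_exp_mul_mgf (μ := P n) (X := Y n) (-r) (t := -(r / c) * a n)
    (by have : 0 ≤ r / c * a n := by positivity
        linarith) (hint _ _)
  have hsub : {ω | r ≤ |Y n ω|} ⊆ {ω | r ≤ Y n ω} ∪ {ω | Y n ω ≤ -r} := by
    intro ω hω
    rcases le_abs.1 (show r ≤ |Y n ω| from hω) with h | h
    · exact Or.inl h
    · exact Or.inr (show Y n ω ≤ -r by linarith)
  have hu := (measureReal_mono hsub (measure_ne_top _ _)).trans (measureReal_union_le (μ := P n) _ _)
  have e : Real.exp (a n * (-(r ^ 2 / (2 * c)) + κ)) =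
      Real.exp (a n * (κ / 2)) * (Real.exp (-(r / c * a n) * r) *
        Real.exp (a n * (c * (r / c) ^ 2 / 2 + κ / 2))) := by
    rw [← Real.exp_add, ← Real.exp_add]
    congr 1
    field_simp
    ring
  have b1 : (P n).real {ω | r ≤ Y n ω} ≤ Real.exp (-(r / c * a n) * r) *
        Real.exp (a n * (c * (r / c) ^ 2 / 2 + κ / 2)) :=
    t1.trans (mul_le_mul_of_nonneg_left h1.2 (Real.exp_pos _).le)
  have b2 : (P n).real {ω | Y n ω ≤ -r} ≤ Real.exp (-(r / c * a n) * r) *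
        Real.exp (a n * (c * (r / c) ^ 2 / 2 + κ / 2)) := by
    refine t2.trans ?_
    have e3 : -(-(r / c) * a n) * -r = -(r / c * a n) * r := by ring
    rw [e3]
    refine mul_le_mul_of_nonneg_left ?_ (Real.exp_pos _).le
    have := h2.2
    rwa [neg_sq] at this
  rw [e]
  have hp : 0 < Real.exp (-(r / c * a n) * r) *
        Real.exp (a n * (c * (r / c) ^ 2 / 2 + κ / 2)) := by positivity
  nlinarith

/-- A change of measure without the tilted measure. Tilt by `x / c`; outside the ball the integrand
is dominated by exponentials with tilts `(x ± δ) / c`, whose means are smaller by a factor `exp (-a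
(δ² / (2c) - 2κ))`. So half of the bound `E` for the tilted mass sits inside the ball, where the
integrand is at most `exp (a (x² / c + |x / c| δ))`. -/
lemma QuadraticLogMgf.ball_lower (h : QuadraticLogMgf P Y a c)
    (hY : ∀ n, Measurable (Y n))
    (hint : ∀ n θ, Integrable (fun ω => Real.exp (θ * Y n ω)) (P n))
    (ha : Tendsto a atTop atTop) (hc : 0 < c) (x : ℝ) {δ κ : ℝ} (hδ : 0 < δ) (hκ : 0 < κ)
    (hκδ : κ ≤ δ ^ 2 / (8 * c)) :
    ∀ᶠ n in atTop, Real.exp (a n * (-(x ^ 2 / (2 * c)) - 2 * κ - |x / c| * δ)) ≤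
      (P n).real {ω | |Y n ω - x| < δ} := by
  filter_upwards [h (x / c) κ hκ, h (x / c + δ / c) κ hκ, h (x / c - δ / c) κ hκ,
    two_le_exp_eventually ha hκ,
    two_le_exp_eventually ha (κ := δ ^ 2 / (8 * c)) (by positivity),
    ha.eventually_gt_atTop 0] with n h1 h2 h3 h4 h5 h6
  set E := Real.exp (a n * (c * (x / c) ^ 2 / 2 - κ)) with hE
  set A := {ω | |Y n ω - x| < δ} with hA
  have hAm : MeasurableSet A := measurableSet_lt ((hY n).sub_const x).abs measurable_const
  set θ := x / c * a n with hθ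
  set s := δ / c * a n with hs
  have hs0 : 0 < s := by positivity
  -- pointwise domination
  have key : ∀ ω, Real.exp (θ * Y n ω) ≤
      A.indicator (fun _ => Real.exp (θ * x + |x / c| * a n * δ)) ω +
      Real.exp (-(s * (x + δ))) * Real.exp ((θ + s) * Y n ω) +
      Real.exp (s * (x - δ)) * Real.exp ((θ - s) * Y n ω) := by
    intro ω
    rw [← Real.exp_add, ← Real.exp_add]
    by_cases hω : ω ∈ A
    · rw [Set.indicator_of_mem hω]
      have h7 : Real.exp (θ * Y n ω) ≤ Real.exp (θ * x + |x / c| * a n * δ) := by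
        apply Real.exp_le_exp.2
        have h8 : θ * (Y n ω - x) ≤ |θ * (Y n ω - x)| := le_abs_self _
        rw [abs_mul, hθ, abs_mul, abs_of_pos h6] at h8
        have h9 : |x / c| * a n * |Y n ω - x| ≤ |x / c| * a n * δ :=
          mul_le_mul_of_nonneg_left (le_of_lt hω) (by positivity)
        nlinarith
      linarith [Real.exp_pos (-(s * (x + δ)) + (θ + s) * Y n ω),
        Real.exp_pos (s * (x - δ) + (θ - s) * Y n ω)]
    · rw [Set.indicator_of_notMem hω]
      have hω' : δ ≤ |Y n ω - x| := not_lt.1 hω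
      rcases le_abs.1 hω' with h7 | h7
      · have : Real.exp (θ * Y n ω) ≤ Real.exp (-(s * (x + δ)) + (θ + s) * Y n ω) := by
          apply Real.exp_le_exp.2; nlinarith
        linarith [Real.exp_pos (s * (x - δ) + (θ - s) * Y n ω)]
      · have : Real.exp (θ * Y n ω) ≤ Real.exp (s * (x - δ) + (θ - s) * Y n ω) := by
          apply Real.exp_le_exp.2; nlinarith
        linarith [Real.exp_pos (-(s * (x + δ)) + (θ + s) * Y n ω)]
  have i1 : Integrable (A.indicator (fun _ => Real.exp (θ * x + |x / c| * a n * δ))) (P n) :=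
    (integrable_const _).indicator hAm
  have i2 : Integrable (fun ω => Real.exp (-(s * (x + δ))) * Real.exp ((θ + s) * Y n ω)) (P n) :=
    (hint n (θ + s)).const_mul _
  have i3 : Integrable (fun ω => Real.exp (s * (x - δ)) * Real.exp ((θ - s) * Y n ω)) (P n) :=
    (hint n (θ - s)).const_mul _
  have i12 : Integrable (fun ω => A.indicator (fun _ => Real.exp (θ * x + |x / c| * a n * δ)) ω +
      Real.exp (-(s * (x + δ))) * Real.exp ((θ + s) * Y n ω)) (P n) := i1.add i2
  have I := integral_mono (μ := P n) (hint n θ) (i12.add i3) key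
  simp only [Pi.add_apply] at I
  rw [integral_add i12 i3, integral_add i1 i2, integral_const_mul, integral_const_mul,
    integral_indicator_const _ hAm, smul_eq_mul] at I
  have m1 : E ≤ ∫ ω, Real.exp (θ * Y n ω) ∂(P n) := h1.1
  have m2 : ∫ ω, Real.exp ((θ + s) * Y n ω) ∂(P n) ≤
      Real.exp (a n * (c * (x / c + δ / c) ^ 2 / 2 + κ)) := by
    have := h2.2
    rwa [add_mul] at this
  have m3 : ∫ ω, Real.exp ((θ - s) * Y n ω) ∂(P n) ≤
      Real.exp (a n * (c * (x / c - δ / c) ^ 2 / 2 + κ)) := by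
    have := h3.2
    rwa [sub_mul] at this
  have m2' := mul_le_mul_of_nonneg_left m2 (Real.exp_pos (-(s * (x + δ)))).le
  have m3' := mul_le_mul_of_nonneg_left m3 (Real.exp_pos (s * (x - δ))).le
  have e2 : Real.exp (-(s * (x + δ))) * Real.exp (a n * (c * (x / c + δ / c) ^ 2 / 2 + κ)) =
      E * Real.exp (-(a n * (δ ^ 2 / (2 * c) - 2 * κ))) := by
    rw [hE, ← Real.exp_add, ← Real.exp_add, hs]
    congr 1
    field_simp
    ring
  have e3 : Real.exp (s * (x - δ)) * Real.exp (a n * (c * (x / c - δ / c) ^ 2 / 2 + κ)) =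
      E * Real.exp (-(a n * (δ ^ 2 / (2 * c) - 2 * κ))) := by
    rw [hE, ← Real.exp_add, ← Real.exp_add, hs]
    congr 1
    field_simp
    ring
  rw [e2] at m2'
  rw [e3] at m3'
  -- Since `2κ ≤ 2 · δ² / (8c)`, the exponent is at least twice `a δ² / (8c)`, and each half
  -- contributes a factor of at least 2. The two tails together then cost at most `E / 2`.
  have hq : Real.exp (-(a n * (δ ^ 2 / (2 * c) - 2 * κ))) ≤ 1 / 4 := by
    have h8 : Real.exp (-(a n * (δ ^ 2 / (2 * c) - 2 * κ))) ≤
        Real.exp (-(a n * (δ ^ 2 / (8 * c)) + a n * (δ ^ 2 / (8 * c)))) := by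
      apply Real.exp_le_exp.2
      have : δ ^ 2 / (2 * c) = 4 * (δ ^ 2 / (8 * c)) := by field_simp; ring
      rw [this]
      nlinarith
    refine h8.trans ?_
    rw [Real.exp_neg, Real.exp_add, one_div]
    apply inv_anti₀ (by norm_num)
    nlinarith
  have hEpos : 0 < E := Real.exp_pos _
  have hfin : E / 2 ≤ (P n).real A * Real.exp (θ * x + |x / c| * a n * δ) := by
    nlinarith
  have hfin2 : E * Real.exp (-(θ * x + |x / c| * a n * δ)) / 2 ≤ (P n).real A := by
    rw [Real.exp_neg, ← div_eq_mul_inv, div_right_comm, div_le_iff₀ (Real.exp_pos _)]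
    exact hfin
  refine le_trans ?_ hfin2
  rw [le_div_iff₀ two_pos]
  have e4 : E * Real.exp (-(θ * x + |x / c| * a n * δ)) =
      Real.exp (a n * (-(x ^ 2 / (2 * c)) - 2 * κ - |x / c| * δ)) * Real.exp (a n * κ) := by
    rw [hE, ← Real.exp_add, ← Real.exp_add, hθ]
    congr 1
    field_simp
    ring
  rw [e4]
  exact mul_le_mul_of_nonneg_left h4 (Real.exp_pos _).le

/-- The lower bound is local, around each point of `G`. As the rate is increasing in `|x|`, a closed
set lies outside the open interval given by its point nearest to 0, so the two-sided tail suffices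
and no covering argument or exponential tightness is needed. -/
theorem QuadraticLogMgf.satisfiesLDP (h : QuadraticLogMgf P Y a c)
    (hY : ∀ n, Measurable (Y n))
    (hint : ∀ n θ, Integrable (fun ω => Real.exp (θ * Y n ω)) (P n))
    (ha : Tendsto a atTop atTop) (hc : 0 < c) :
    SatisfiesLDP P Y a (fun x => ENNReal.ofReal (x ^ 2 / (2 * c))) where
  isCompact_level L := by
    have e : {x : ℝ | ENNReal.ofReal (x ^ 2 / (2 * c)) ≤ (L : ℝ≥0∞)} =
        Metric.closedBall 0 (Real.sqrt (L * (2 * c))) := by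
      ext x
      simp only [Set.mem_ofPred_eq, Metric.mem_closedBall, dist_zero_right, Real.norm_eq_abs]
      rw [← ENNReal.ofReal_coe_nnreal, ENNReal.ofReal_le_ofReal_iff (NNReal.coe_nonneg L),
        div_le_iff₀ (by positivity)]
      exact ⟨fun h => Real.abs_le_sqrt h, fun h => by
        rw [← sq_abs]
        calc |x| ^ 2 ≤ (Real.sqrt (L * (2 * c))) ^ 2 := by gcongr
          _ = _ := Real.sq_sqrt (by positivity)⟩
    rw [e]
    exact isCompact_closedBall _ _
  lower_bound G hG := by
    rw [EReal.neg_le]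
    refine le_iInf₂ fun x hx => ?_
    rw [EReal.neg_le]
    obtain ⟨δ₀, hδ₀, hball⟩ := Metric.isOpen_iff.1 hG x hx
    refine EReal.ge_of_forall_gt_iff_ge.1 fun z hz => ?_
    have hz' : z < -(x ^ 2 / (2 * c)) := by
      rw [EReal.coe_ennreal_ofReal, max_eq_left (by positivity)] at hz
      exact_mod_cast hz
    set g := -(x ^ 2 / (2 * c)) - z with hg
    have hg0 : 0 < g := by rw [hg]; linarith
    -- The gap `g` pays for the losses of `ball_lower`: `2κ ≤ g / 2` and `|x / c| δ ≤ g / 4`.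
    set δ := min δ₀ (g / (4 * (|x / c| + 1))) with hδ
    have hδ0 : 0 < δ := lt_min hδ₀ (by positivity)
    set κ := min (δ ^ 2 / (8 * c)) (g / 4) with hκ
    have hκ0 : 0 < κ := lt_min (by positivity) (by positivity)
    have hev := h.ball_lower hY hint ha hc x hδ0 hκ0 (min_le_left _ _)
    refine le_liminf_of_le (by isBoundedDefault) ?_
    filter_upwards [hev, ha.eventually_gt_atTop 0] with n h1 h2
    refine le_scaled_log _ h2 (le_trans ?_ (h1.trans ?_))
    · apply Real.exp_le_exp.2
      refine mul_le_mul_of_nonneg_left ?_ h2.le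
      have k1 : κ ≤ g / 4 := min_le_right _ _
      have k2 : |x / c| * δ ≤ g / 4 := by
        have : δ ≤ g / (4 * (|x / c| + 1)) := min_le_right _ _
        rw [le_div_iff₀ (by positivity)] at this
        nlinarith [abs_nonneg (x / c)]
      linarith
    · refine measureReal_mono (fun ω hω => hball ?_) (measure_ne_top _ _)
      rw [Metric.mem_ball, Real.dist_eq]
      exact lt_of_lt_of_le hω (min_le_left _ _)
  upper_bound F hF := by
    rcases F.eq_empty_or_nonempty with rfl | hne
    · simp only [Set.preimage_empty, measure_empty, ENNReal.log_zero, Set.mem_empty_iff_false,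
        iInf_false, iInf_top]
      refine limsup_le_of_le (by isBoundedDefault) ?_
      filter_upwards [ha.eventually_gt_atTop 0] with n hn
      rw [EReal.coe_mul_bot_of_pos (by positivity)]
      exact bot_le
    · obtain ⟨y, hyF, hy⟩ := hF.exists_infDist_eq_dist hne 0
      have hr : ∀ x ∈ F, |y| ≤ |x| := fun x hx => by
        have := Metric.infDist_le_dist_of_mem (x := (0 : ℝ)) hx
        rw [hy] at this
        simpa using this
      refine le_trans ?_ (EReal.neg_le_neg_iff.2 (iInf₂_le y hyF))
      refine EReal.le_of_forall_lt_iff_le.1 fun z hz => ?_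
      have hz' : -(y ^ 2 / (2 * c)) < z := by
        rw [EReal.coe_ennreal_ofReal, max_eq_left (by positivity)] at hz
        exact_mod_cast hz
      refine limsup_le_of_le (by isBoundedDefault) ?_
      filter_upwards [h.abs_tail hint ha hc (abs_nonneg y) (sub_pos.2 hz'),
        ha.eventually_gt_atTop 0] with n h1 h2
      refine scaled_log_le _ h2 (le_trans (measureReal_mono (fun ω hω => hr _ hω)
        (measure_ne_top _ _)) (h1.trans_eq ?_))
      rw [sq_abs]
      congr 2
      ring

end LDP

/-! ### Combinatorics of the exploration. -/

section Exploration

variable {N : ℕ}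

/-- The unseen vertices that remain once the next vertex has been selected. -/
def State.rest (s : State N) : Finset (Fin N) :=
  match s.next with
  | none => ∅
  | some v => s.unseen.erase v

open Classical in
/-- The number of vertices of `s.rest` joined to the next vertex by an edge of `G` that avoids the
explored vertices. -/
def State.freshCount (s : State N) (G : Set (Finset (Fin N))) : ℕ :=
  match s.next with
  | none => 0
  | some v => (s.rest.filter fun u => ∃ e ∈ G, Disjoint e s.explored ∧ v ∈ e ∧ u ∈ e).card

/-- The number of vertices that become active in a step from the state `s`. -/
def State.discovered (s : State N) (G : Set (Finset (Fin N))) : ℕ :=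
  match s.next with
  | none => 0
  | some v => (s.newlyActive G v).card

lemma eta_succ (G : Set (Finset (Fin N))) (k t : ℕ) :
    eta G k (t + 1) = (stateAt G k t).discovered G := rfl

/-- No edge joins an explored vertex to an unseen one, and active vertices are not explored. -/
structure State.IsConsistent (s : State N) (G : Set (Finset (Fin N))) : Prop where
  disj : Disjoint s.active s.explored
  closed : ∀ e ∈ G, ∀ w ∈ e, w ∈ s.explored → ∀ u ∈ e, u ∉ s.unseen

lemma State.mem_unseen {s : State N} {u : Fin N} :
    u ∈ s.unseen ↔ u ∉ s.active ∧ u ∉ s.explored := by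
  simp [State.unseen]

lemma State.next_mem {s : State N} {v : Fin N} (h : s.next = some v) :
    v ∈ s.active ∨ (s.active = ∅ ∧ v ∈ s.unseen) := by
  unfold State.next at h
  split_ifs at h with h1 h2
  · left
    simp only [Option.some.injEq] at h
    exact h ▸ Finset.min'_mem _ _
  · right
    simp only [Option.some.injEq] at h
    exact ⟨Finset.not_nonempty_iff_eq_empty.1 h1, h ▸ Finset.min'_mem _ _⟩

lemma State.next_eq_none {s : State N} (h : s.next = none) : s.active = ∅ ∧ s.unseen = ∅ := by
  unfold State.next at h
  split_ifs at h with h1 h2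
  exact ⟨Finset.not_nonempty_iff_eq_empty.1 h1, Finset.not_nonempty_iff_eq_empty.1 h2⟩

lemma State.IsConsistent.next_notMem {s : State N} {G : Set (Finset (Fin N))}
    (hs : s.IsConsistent G) {v : Fin N} (h : s.next = some v) : v ∉ s.explored := by
  rcases State.next_mem h with h | h
  · exact Finset.disjoint_left.1 hs.disj h
  · exact (State.mem_unseen.1 h.2).2

lemma State.rest_eq {s : State N} {v : Fin N} (h : s.next = some v) :
    s.rest = s.unseen.erase v := by
  simp [State.rest, h]

lemma State.step_eq {s : State N} {v : Fin N} (G : Set (Finset (Fin N))) (h : s.next = some v) :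
    s.step G = { active := s.active.erase v ∪ s.newlyActive G v
                 explored := insert v s.explored } := by
  simp [State.step, h]

lemma State.step_eq_self {s : State N} (G : Set (Finset (Fin N))) (h : s.next = none) :
    s.step G = s := by
  simp [State.step, h]

open Classical in
lemma State.freshCount_eq {s : State N} {v : Fin N} (h : s.next = some v)
    (G : Set (Finset (Fin N))) :
    s.freshCount G =
      (s.rest.filter fun u => ∃ e ∈ G, Disjoint e s.explored ∧ v ∈ e ∧ u ∈ e).card := by
  unfold State.freshCount
  simp [h]

lemma State.freshCount_eq_zero {s : State N} (h : s.next = none) (G : Set (Finset (Fin N))) :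
    s.freshCount G = 0 := by
  unfold State.freshCount
  simp [h]

lemma State.mem_newlyActive {s : State N} {G : Set (Finset (Fin N))} {v u : Fin N} :
    u ∈ s.newlyActive G v ↔ u ∈ s.unseen ∧ u ≠ v ∧ ∃ e ∈ G, v ∈ e ∧ u ∈ e := by
  simp [State.newlyActive]

lemma State.newlyActive_subset {s : State N} {G : Set (Finset (Fin N))} {v : Fin N}
    (h : s.next = some v) : s.newlyActive G v ⊆ s.rest := by
  intro u hu
  rw [State.mem_newlyActive] at hu
  rw [State.rest_eq h, Finset.mem_erase]
  exact ⟨hu.2.1, hu.1⟩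

lemma State.unseen_step {s : State N} {G : Set (Finset (Fin N))} {v : Fin N}
    (h : s.next = some v) : (s.step G).unseen = s.rest \ s.newlyActive G v := by
  ext u
  rw [State.step_eq G h, State.rest_eq h]
  simp only [State.mem_unseen, Finset.mem_union, Finset.mem_erase, Finset.mem_insert,
    Finset.mem_sdiff]
  tauto

/-- When `v` becomes explored, all its unseen neighbours become active at once, so no edge through
`v` keeps an unseen vertex. -/
lemma State.IsConsistent.step {s : State N} {G : Set (Finset (Fin N))}
    (hs : s.IsConsistent G) : (s.step G).IsConsistent G := by
  cases h : s.next with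
  | none => rwa [State.step_eq_self G h]
  | some v =>
    constructor
    · rw [State.step_eq G h, Finset.disjoint_left]
      intro u hu hu'
      simp only [Finset.mem_union, Finset.mem_erase, State.mem_newlyActive,
        Finset.mem_insert, State.mem_unseen] at hu hu'
      have : u ∈ s.active → u ∉ s.explored := fun h => Finset.disjoint_left.1 hs.disj h
      tauto
    · intro e he w hw hwE u hu
      rw [State.unseen_step h, Finset.mem_sdiff, State.rest_eq h, Finset.mem_erase,
        State.mem_newlyActive]
      rw [State.step_eq G h] at hwE
      rcases Finset.mem_insert.1 hwE with rfl | hwE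
      · rintro ⟨⟨h1, h2⟩, h3⟩
        exact h3 ⟨h2, h1, e, he, hw, hu⟩
      · rintro ⟨⟨_, h2⟩, _⟩
        exact hs.closed e he w hw hwE u hu h2

lemma isConsistent_stateAt (G : Set (Finset (Fin N))) (k t : ℕ) :
    (stateAt G k t).IsConsistent G := by
  induction t with
  | zero =>
    constructor
    · exact Finset.disjoint_empty_right _
    · intro e _ w _ hw
      exact absurd hw (Finset.notMem_empty _)
  | succ t ih => exact ih.step

/-- By consistency an edge containing an unseen vertex has no explored vertex, so restricting to
edges that avoid the explored set loses nothing. This exhibits a step as a function of edges not yet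
inspected. -/
lemma State.IsConsistent.discovered_eq {s : State N} {G : Set (Finset (Fin N))}
    (hs : s.IsConsistent G) : s.discovered G = s.freshCount G := by
  classical
  cases h : s.next with
  | none => rw [State.freshCount_eq_zero h, State.discovered, h]
  | some v =>
    rw [State.freshCount_eq h, State.discovered, h]
    simp only
    congr 1
    ext u
    rw [State.mem_newlyActive, State.rest_eq h, Finset.mem_filter, Finset.mem_erase]
    constructor
    · rintro ⟨h1, h2, e, he, hv, hu⟩
      refine ⟨⟨h2, h1⟩, e, he, ?_, hv, hu⟩
      rw [Finset.disjoint_left]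
      intro w hw hw'
      exact hs.closed e he w hw hw' u hu h1
    · rintro ⟨⟨h2, h1⟩, e, he, _, hv, hu⟩
      exact ⟨h1, h2, e, he, hv, hu⟩

lemma eta_succ_eq_freshCount (G : Set (Finset (Fin N))) (k t : ℕ) :
    eta G k (t + 1) = (stateAt G k t).freshCount G :=
  (isConsistent_stateAt G k t).discovered_eq

lemma State.explored_subset_step (s : State N) (G : Set (Finset (Fin N))) :
    s.explored ⊆ (s.step G).explored := by
  cases h : s.next with
  | none => rw [State.step_eq_self G h]
  | some v => rw [State.step_eq G h]; exact Finset.subset_insert _ _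

lemma State.step_congr {s : State N} {G G' : Set (Finset (Fin N))}
    (h : ∀ e : Finset (Fin N), ¬ Disjoint e (s.step G).explored → (e ∈ G ↔ e ∈ G')) :
    s.step G = s.step G' := by
  cases hn : s.next with
  | none => rw [State.step_eq_self G hn, State.step_eq_self G' hn]
  | some v =>
    rw [State.step_eq G hn] at h
    rw [State.step_eq G hn, State.step_eq G' hn]
    have : s.newlyActive G v = s.newlyActive G' v := by
      ext u
      rw [State.mem_newlyActive, State.mem_newlyActive]
      have h' : ∀ e : Finset (Fin N), v ∈ e → (e ∈ G ↔ e ∈ G') := fun e hv =>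
        h e (Finset.not_disjoint_iff.2 ⟨v, hv, Finset.mem_insert_self _ _⟩)
      refine and_congr_right fun _ => and_congr_right fun _ => exists_congr fun e => ?_
      have := h' e
      tauto
    rw [this]

/-- Every edge inspected up to time `t` contains the vertex explored at that moment, hence meets the
explored set at time `t`. The hypothesis concerns the explored set of `G` alone. -/
lemma stateAt_congr {G G' : Set (Finset (Fin N))} {k t : ℕ}
    (h : ∀ e : Finset (Fin N), ¬ Disjoint e (stateAt G k t).explored → (e ∈ G ↔ e ∈ G')) :
    ∀ s ≤ t, stateAt G k s = stateAt G' k s := by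
  induction t with
  | zero => intro s hs; rw [Nat.le_zero.1 hs]; rfl
  | succ t ih =>
    have ih' := ih fun e he => h e fun hd =>
      he (Finset.disjoint_of_subset_right (State.explored_subset_step _ _) hd)
    intro s hs
    rcases Nat.le_succ_iff.1 hs with hs | rfl
    · exact ih' s hs
    · change (stateAt G k t).step G = (stateAt G' k t).step G'
      rw [← ih' t le_rfl]
      exact State.step_congr h

lemma State.freshCount_congr {s : State N} {G G' : Set (Finset (Fin N))}
    (h : ∀ e : Finset (Fin N), Disjoint e s.explored → (e ∈ G ↔ e ∈ G')) :
    s.freshCount G = s.freshCount G' := by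
  classical
  cases hn : s.next with
  | none => rw [State.freshCount_eq_zero hn, State.freshCount_eq_zero hn]
  | some v =>
    rw [State.freshCount_eq hn, State.freshCount_eq hn]
    congr 1
    ext u
    rw [Finset.mem_filter, Finset.mem_filter]
    refine and_congr_right fun _ => exists_congr fun e => ?_
    have := h e
    tauto

/-! ### Counting vertices -/

lemma card_explored (G : Set (Finset (Fin N))) (k : ℕ) {t : ℕ} (ht : t ≤ N) :
    (stateAt G k t).explored.card = t := by
  induction t with
  | zero => rfl
  | succ t ih =>
    have ih := ih (by omega)
    have hc := isConsistent_stateAt G k t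
    change ((stateAt G k t).step G).explored.card = t + 1
    cases h : (stateAt G k t).next with
    | none =>
      exfalso
      obtain ⟨h1, h2⟩ := State.next_eq_none h
      unfold State.unseen at h2
      rw [h1, Finset.empty_union, Finset.compl_eq_empty_iff] at h2
      rw [h2, Finset.card_univ, Fintype.card_fin] at ih
      omega
    | some v =>
      rw [State.step_eq G h]
      simp only
      rw [Finset.card_insert_of_notMem (hc.next_notMem h), ih]

lemma exists_next (G : Set (Finset (Fin N))) (k : ℕ) {t : ℕ} (ht : t < N) :
    ∃ v, (stateAt G k t).next = some v := by
  cases h : (stateAt G k t).next with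
  | none =>
    exfalso
    obtain ⟨h1, h2⟩ := State.next_eq_none h
    unfold State.unseen at h2
    rw [h1, Finset.empty_union, Finset.compl_eq_empty_iff] at h2
    have ih := card_explored G k ht.le
    rw [h2, Finset.card_univ, Fintype.card_fin] at ih
    omega
  | some v => exact ⟨v, rfl⟩

lemma card_unseen_succ (G : Set (Finset (Fin N))) (k : ℕ) {t : ℕ} (ht : t < N) :
    (stateAt G k (t + 1)).unseen.card + eta G k (t + 1) = (stateAt G k t).rest.card := by
  obtain ⟨v, hv⟩ := exists_next G k ht
  have h1 : eta G k (t + 1) = ((stateAt G k t).newlyActive G v).card := by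
    rw [eta_succ, State.discovered, hv]
  rw [h1]
  change ((stateAt G k t).step G).unseen.card + _ = _
  rw [State.unseen_step hv]
  exact Finset.card_sdiff_add_card_eq_card (State.newlyActive_subset hv)

lemma card_rest_of_active (G : Set (Finset (Fin N))) (k : ℕ) {t : ℕ} (ht : t < N)
    (ha : (stateAt G k t).active.Nonempty) :
    (stateAt G k t).rest.card = (stateAt G k t).unseen.card := by
  obtain ⟨v, hv⟩ := exists_next G k ht
  rw [State.rest_eq hv, Finset.erase_eq_of_notMem]
  rcases State.next_mem hv with h | h
  · exact fun h' => (State.mem_unseen.1 h').1 h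
  · exact absurd h.1 ha.ne_empty

lemma card_rest_of_not_active (G : Set (Finset (Fin N))) (k : ℕ) {t : ℕ} (ht : t < N)
    (ha : ¬ (stateAt G k t).active.Nonempty) :
    (stateAt G k t).rest.card + 1 = (stateAt G k t).unseen.card := by
  obtain ⟨v, hv⟩ := exists_next G k ht
  rw [State.rest_eq hv]
  refine Finset.card_erase_add_one ?_
  rcases State.next_mem hv with h | h
  · exact absurd ⟨v, h⟩ ha
  · exact h.2

lemma card_active_add (G : Set (Finset (Fin N))) (k : ℕ) {t : ℕ} (ht : t ≤ N) :
    (stateAt G k t).active.card + t + (stateAt G k t).unseen.card = N := by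
  have h1 := card_explored G k ht
  have hc := isConsistent_stateAt G k t
  have h2 := Finset.card_add_card_compl ((stateAt G k t).active ∪ (stateAt G k t).explored)
  rw [Finset.card_union_of_disjoint hc.disj, Fintype.card_fin, h1] at h2
  exact h2

/-- Only an inequality, since `k` may exceed `N`. -/
lemma card_unseen_zero (G : Set (Finset (Fin N))) (k : ℕ) :
    N ≤ (stateAt G k 0).unseen.card + k := by
  have h1 := card_active_add G k (Nat.zero_le N)
  have h2 : (stateAt G k 0).active.card ≤ k := by
    change (Finset.univ.filter (fun v : Fin N => (v : ℕ) < k)).card ≤ k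
    calc _ = ((Finset.univ.filter (fun v : Fin N => (v : ℕ) < k)).image Fin.val).card :=
          (Finset.card_image_of_injective _ Fin.val_injective).symm
      _ ≤ (Finset.range k).card := Finset.card_le_card (by
          intro x hx
          simp only [Finset.mem_image, Finset.mem_filter] at hx
          obtain ⟨y, hy, rfl⟩ := hx
          exact Finset.mem_range.2 hy.2)
      _ = k := Finset.card_range k
  omega

end Exploration

/-! ### Independence of a step from the past, and the moments of a step. -/

section OneStep

variable {N : ℕ}

instance : Finite (State N) :=
  Finite.of_injective (fun s : State N => (s.active, s.explored)) <| by
    rintro ⟨a, b⟩ ⟨a', b'⟩ h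
    simp_all

/-- `F` depends only on the first `t` states of the exploration. -/
def DependsOnHistory (k t : ℕ) (F : Set (Finset (Fin N)) → ℝ) : Prop :=
  ∀ G G' : Set (Finset (Fin N)), (∀ s ≤ t, stateAt G k s = stateAt G' k s) → F G = F G'

/-- The Markov property in integrated form. Decompose over the value `h` of the state at time `t`:
on that event `F` is determined by the edges meeting `h.explored`, while `h.freshCount` is
determined by the edges disjoint from it, and these two families are independent. -/
lemma integral_of_history {u : Set (Finset (Fin N))} {p : unitInterval} {k t : ℕ}
    {F : Set (Finset (Fin N)) → ℝ} (hF : DependsOnHistory k t F) (g : State N → ℕ → ℝ) :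
    ∫ G, F G * g (stateAt G k t) (eta G k (t + 1)) ∂(setBernoulli u p) =
      ∫ G, F G * (∫ G', g (stateAt G k t) ((stateAt G k t).freshCount G') ∂(setBernoulli u p))
        ∂(setBernoulli u p) := by
  classical
  have : Fintype (State N) := Fintype.ofFinite _
  have e1 : ∀ G : Set (Finset (Fin N)), F G * g (stateAt G k t) (eta G k (t + 1)) =
      ∑ h : State N, (if stateAt G k t = h then F G else 0) * g h (h.freshCount G) := by
    intro G
    rw [eta_succ_eq_freshCount]
    simp [ite_mul]
  have e2 : ∀ G : Set (Finset (Fin N)),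
      F G * (∫ G', g (stateAt G k t) ((stateAt G k t).freshCount G') ∂(setBernoulli u p)) =
      ∑ h : State N, (if stateAt G k t = h then F G else 0) *
        ∫ G', g h (h.freshCount G') ∂(setBernoulli u p) := by
    intro G
    simp [ite_mul]
  simp_rw [e1, e2]
  rw [integral_finsetSum _ fun _ _ => Integrable.of_finite,
    integral_finsetSum _ fun _ _ => Integrable.of_finite]
  refine Finset.sum_congr rfl fun h _ => ?_
  rw [integral_mul_const]
  refine integral_mul_setBernoulli
    (A := Finset.univ.filter fun e : Finset (Fin N) => ¬ Disjoint e h.explored)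
    (B := Finset.univ.filter fun e : Finset (Fin N) => Disjoint e h.explored)
    (Finset.disjoint_filter_filter_not _ _ _).symm ?_ ?_
  · intro G G' hG
    simp only [Finset.mem_filter, Finset.mem_univ, true_and] at hG
    by_cases h1 : stateAt G k t = h
    · have hs := stateAt_congr (G := G) (G' := G') (k := k) (t := t) (by rw [h1]; exact hG)
      change (if _ then _ else _) = (if _ then _ else _)
      rw [if_pos h1, if_pos (by rw [← hs t le_rfl, h1]), hF G G' hs]
    -- The same argument with the roles exchanged: if `G'` reached `h`, its explored set would be
    -- known and `G` would reach `h` too.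
    · have h2 : stateAt G' k t ≠ h := by
        intro h2
        have hs := stateAt_congr (G := G') (G' := G) (k := k) (t := t)
          (by rw [h2]; exact fun e he => (hG e he).symm)
        exact h1 (by rw [← hs t le_rfl, h2])
      change (if _ then _ else _) = (if _ then _ else _)
      rw [if_neg h1, if_neg h2]
  · intro G G' hG
    simp only [Finset.mem_filter, Finset.mem_univ, true_and] at hG
    simp only [State.freshCount_congr hG]

/-- The `d`-element subsets of `R` that contain `A`. -/
def edgesThrough (d : ℕ) (R A : Finset (Fin N)) : Finset (Finset (Fin N)) :=
  (R.powersetCard d).filter (A ⊆ ·)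

lemma mem_edgesThrough {d : ℕ} {R A e : Finset (Fin N)} :
    e ∈ edgesThrough d R A ↔ e ⊆ R ∧ e.card = d ∧ A ⊆ e := by
  simp [edgesThrough, Finset.mem_powersetCard, and_assoc]

lemma card_edgesThrough {d : ℕ} {R A : Finset (Fin N)} (hA : A ⊆ R) (hd : A.card ≤ d) :
    (edgesThrough d R A).card = (R.card - A.card).choose (d - A.card) := by
  rw [← Finset.card_sdiff_of_subset hA, ← Finset.card_powersetCard]
  refine Finset.card_nbij' (· \ A) (· ∪ A) ?_ ?_ ?_ ?_
  · intro e he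
    rw [Finset.mem_coe, mem_edgesThrough] at he
    rw [Finset.mem_coe, Finset.mem_powersetCard]
    exact ⟨Finset.sdiff_subset_sdiff he.1 le_rfl, by
      rw [Finset.card_sdiff_of_subset he.2.2, he.2.1]⟩
  · intro e he
    rw [Finset.mem_coe, Finset.mem_powersetCard] at he
    rw [Finset.mem_coe, mem_edgesThrough]
    refine ⟨Finset.union_subset (he.1.trans Finset.sdiff_subset) hA, ?_,
      Finset.subset_union_right⟩
    rw [Finset.card_union_of_disjoint (Finset.disjoint_of_subset_left he.1
      Finset.sdiff_disjoint), he.2]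
    omega
  · intro e he
    rw [Finset.mem_coe, mem_edgesThrough] at he
    exact Finset.sdiff_union_of_subset he.2.2
  · intro e he
    rw [Finset.mem_coe, Finset.mem_powersetCard] at he
    exact Finset.union_sdiff_cancel_right
      (Finset.disjoint_of_subset_left he.1 Finset.sdiff_disjoint)

open Classical in
/-- The indicator that `G` contains no edge of `S`. -/
def avoids (S : Finset (Finset (Fin N))) (G : Set (Finset (Fin N))) : ℝ :=
  ∏ e ∈ S, if e ∈ G then 0 else 1

open Classical in
lemma avoids_eq (S : Finset (Finset (Fin N))) (G : Set (Finset (Fin N))) :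
    avoids S G = if ∃ e ∈ S, e ∈ G then 0 else 1 := by
  unfold avoids
  split_ifs with h
  · obtain ⟨e, he, heG⟩ := h
    exact Finset.prod_eq_zero he (by simp [heG])
  · push Not at h
    exact Finset.prod_eq_one fun e he => by simp [h e he]

lemma avoids_mul (S T : Finset (Finset (Fin N))) (G : Set (Finset (Fin N))) :
    avoids S G * avoids T G = avoids (S ∪ T) G := by
  classical
  rw [avoids_eq, avoids_eq, avoids_eq]
  by_cases h1 : ∃ e ∈ S, e ∈ G <;> by_cases h2 : ∃ e ∈ T, e ∈ G <;>
    simp [Finset.mem_union, or_and_right, exists_or, h1, h2]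

variable {d : ℕ} {p : unitInterval}

lemma integral_avoids {S : Finset (Finset (Fin N))} (hS : ∀ e ∈ S, e.card = d) :
    ∫ G, avoids S G ∂(setBernoulli {e : Finset (Fin N) | e.card = d} p) =
      (1 - (p : ℝ)) ^ S.card := by
  classical
  have h := integral_prod_setBernoulli (u := {e : Finset (Fin N) | e.card = d}) (p := p) S
    (fun e he => hS e he) 0
  rw [mul_zero, add_zero] at h
  rw [← h]
  rfl

/-- The edges of the unexplored part through the next vertex `v` and `u`. -/
def State.pairEdges (d : ℕ) (s : State N) (v u : Fin N) : Finset (Finset (Fin N)) :=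
  edgesThrough d s.exploredᶜ {v, u}

lemma State.rest_notMem {s : State N} {v u : Fin N} (h : s.next = some v) (hu : u ∈ s.rest) :
    u ≠ v ∧ u ∉ s.explored := by
  rw [State.rest_eq h, Finset.mem_erase] at hu
  exact ⟨hu.1, (State.mem_unseen.1 hu.2).2⟩

/-- Holds only almost surely: a null set of `G` contains edges of cardinality different from `d`. -/
lemma State.freshCount_ae {s : State N} {v : Fin N} (h : s.next = some v) :
    ∀ᵐ G ∂(setBernoulli {e : Finset (Fin N) | e.card = d} p),
      (s.freshCount G : ℝ) = ∑ u ∈ s.rest, (1 - avoids (s.pairEdges d v u) G) := by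
  classical
  filter_upwards [setBernoulli_ae_subset] with G hG
  rw [State.freshCount_eq h, Finset.card_filter]
  push_cast
  refine Finset.sum_congr rfl fun u _ => ?_
  rw [avoids_eq]
  have : (∃ e ∈ G, Disjoint e s.explored ∧ v ∈ e ∧ u ∈ e) ↔
      ∃ e ∈ s.pairEdges d v u, e ∈ G := by
    refine exists_congr fun e => ?_
    rw [State.pairEdges, mem_edgesThrough, Finset.subset_compl_iff_disjoint_right]
    have h1 : e ∈ G → e.card = d := fun he => hG he
    simp only [Finset.insert_subset_iff, Finset.singleton_subset_iff]
    tauto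
  simp only [this]
  split_ifs <;> simp

section Moments

variable {s : State N} {v : Fin N} {t : ℕ}

lemma State.card_pairEdges (hd : 2 ≤ d) (hv : v ∉ s.explored)
    (ht : s.explored.card = t) {u : Fin N} (huv : u ≠ v) (hu : u ∉ s.explored) :
    (s.pairEdges d v u).card = (N - t - 2).choose (d - 2) := by
  have h2 : ({v, u} : Finset (Fin N)).card = 2 := Finset.card_pair huv.symm
  rw [State.pairEdges, card_edgesThrough ?_ (by omega), h2, Finset.card_compl, ht,
    Fintype.card_fin]
  simp [Finset.insert_subset_iff, hv, hu]

/-- The edges of the second family that are new are those through `v` and `w` avoiding `u`, so one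
vertex fewer is available. This is the source of the positive correlation between the discoveries of
`u` and `w`. -/
lemma State.card_pairEdges_union (hd : 2 ≤ d) (hv : v ∉ s.explored)
    (ht : s.explored.card = t) {u w : Fin N} (huv : u ≠ v) (hu : u ∉ s.explored)
    (hwv : w ≠ v) (hw : w ∉ s.explored) (huw : u ≠ w) :
    (s.pairEdges d v u ∪ s.pairEdges d v w).card =
      (N - t - 2).choose (d - 2) + (N - t - 3).choose (d - 2) := by
  have h2 : ({v, w} : Finset (Fin N)).card = 2 := Finset.card_pair hwv.symm
  have h3 : s.pairEdges d v w \ s.pairEdges d v u =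
      edgesThrough d (s.exploredᶜ.erase u) {v, w} := by
    ext e
    simp only [State.pairEdges, Finset.mem_sdiff, mem_edgesThrough, Finset.insert_subset_iff,
      Finset.singleton_subset_iff, Finset.subset_erase]
    tauto
  rw [Finset.union_comm, ← Finset.sdiff_union_self_eq_union,
    Finset.card_union_of_disjoint Finset.sdiff_disjoint, h3,
    State.card_pairEdges hd hv ht huv hu, card_edgesThrough ?_ (by omega), h2,
    Finset.card_erase_of_mem (by simpa using hu), Finset.card_compl, ht,
    Fintype.card_fin, add_comm]
  · congr 2
  · simp [Finset.insert_subset_iff, hv, hw, huv.symm, huw.symm]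

lemma State.card_of_mem_pairEdges {u : Fin N} : ∀ e ∈ s.pairEdges d v u, e.card = d :=
  fun _ he => (mem_edgesThrough.1 he).2.1

/-- The mean number of discovered vertices. -/
lemma State.integral_freshCount (hd : 2 ≤ d) (h : s.next = some v) (hv : v ∉ s.explored)
    (ht : s.explored.card = t) :
    ∫ G, (s.freshCount G : ℝ) ∂(setBernoulli {e : Finset (Fin N) | e.card = d} p) =
      s.rest.card * (1 - (1 - (p : ℝ)) ^ (N - t - 2).choose (d - 2)) := by
  rw [integral_congr_ae (State.freshCount_ae h),
    integral_finsetSum _ fun _ _ => Integrable.of_finite, ← nsmul_eq_mul]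
  refine Finset.sum_eq_card_nsmul fun u hu => ?_
  obtain ⟨h1, h2⟩ := State.rest_notMem h hu
  rw [integral_sub Integrable.of_finite Integrable.of_finite,
    integral_avoids State.card_of_mem_pairEdges, State.card_pairEdges hd hv ht h1 h2]
  simp

/-- The variance of the number of discovered vertices. -/
lemma State.variance_freshCount (hd : 2 ≤ d) (h : s.next = some v) (hv : v ∉ s.explored)
    (ht : s.explored.card = t) {Q : ℝ} (hQ : Q = (1 - (p : ℝ)) ^ (N - t - 2).choose (d - 2)) :
    ∫ G, ((s.freshCount G : ℝ) - s.rest.card * (1 - Q)) ^ 2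
        ∂(setBernoulli {e : Finset (Fin N) | e.card = d} p) =
      s.rest.card * (Q - Q ^ 2) + s.rest.card * (s.rest.card - 1) *
        (Q * (1 - (p : ℝ)) ^ (N - t - 3).choose (d - 2) - Q ^ 2) := by
  classical
  -- The centred count is minus the sum of the centred indicators of not being hit. The diagonal of
  -- the double sum gives the Bernoulli variances, the rest the covariances.
  have e1 : ∀ᵐ G ∂(setBernoulli {e : Finset (Fin N) | e.card = d} p),
      ((s.freshCount G : ℝ) - s.rest.card * (1 - Q)) ^ 2 = ∑ u ∈ s.rest, ∑ w ∈ s.rest,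
        (avoids (s.pairEdges d v u) G - Q) * (avoids (s.pairEdges d v w) G - Q) := by
    filter_upwards [State.freshCount_ae h] with G hG
    rw [hG, ← Finset.sum_mul_sum, ← sq, ← neg_sq]
    congr 1
    rw [Finset.sum_sub_distrib, Finset.sum_sub_distrib, Finset.sum_const, Finset.sum_const]
    simp only [nsmul_eq_mul]
    ring
  rw [integral_congr_ae e1, integral_finsetSum _ fun _ _ => Integrable.of_finite]
  have e2 : ∀ u ∈ s.rest, ∫ G, (∑ w ∈ s.rest,
        (avoids (s.pairEdges d v u) G - Q) * (avoids (s.pairEdges d v w) G - Q))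
          ∂(setBernoulli {e : Finset (Fin N) | e.card = d} p) =
      (Q - Q ^ 2) + (s.rest.card - 1) *
        (Q * (1 - (p : ℝ)) ^ (N - t - 3).choose (d - 2) - Q ^ 2) := by
    intro u hu
    obtain ⟨h1, h2⟩ := State.rest_notMem h hu
    have hm : ∀ w ∈ s.rest,
        ∫ G, avoids (s.pairEdges d v w) G ∂(setBernoulli {e : Finset (Fin N) | e.card = d} p)
          = Q := by
      intro w hw
      obtain ⟨h3, h4⟩ := State.rest_notMem h hw
      rw [integral_avoids State.card_of_mem_pairEdges, State.card_pairEdges hd hv ht h3 h4, hQ]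
    have hcov : ∀ w ∈ s.rest, ∫ G, (avoids (s.pairEdges d v u) G - Q) *
          (avoids (s.pairEdges d v w) G - Q)
          ∂(setBernoulli {e : Finset (Fin N) | e.card = d} p) =
        (1 - (p : ℝ)) ^ (s.pairEdges d v u ∪ s.pairEdges d v w).card - Q ^ 2 := by
      intro w hw
      have e3 : ∀ G, (avoids (s.pairEdges d v u) G - Q) * (avoids (s.pairEdges d v w) G - Q) =
          avoids (s.pairEdges d v u ∪ s.pairEdges d v w) G - Q * avoids (s.pairEdges d v u) G
            - Q * avoids (s.pairEdges d v w) G + Q ^ 2 := by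
        intro G; rw [← avoids_mul]; ring
      simp_rw [e3]
      rw [integral_add Integrable.of_finite Integrable.of_finite,
        integral_sub Integrable.of_finite Integrable.of_finite,
        integral_sub Integrable.of_finite Integrable.of_finite, integral_const_mul,
        integral_const_mul, hm u hu, hm w hw, integral_avoids (fun e he => ?_)]
      · simp; ring
      · rcases Finset.mem_union.1 he with he | he <;> exact State.card_of_mem_pairEdges e he
    rw [integral_finsetSum _ fun _ _ => Integrable.of_finite, Finset.sum_congr rfl hcov,
      ← Finset.add_sum_erase _ _ hu, Finset.union_self, State.card_pairEdges hd hv ht h1 h2,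
      ← hQ, Finset.sum_eq_card_nsmul (b := Q * (1 - (p : ℝ)) ^ (N - t - 3).choose (d - 2) - Q ^ 2),
      Finset.card_erase_of_mem hu, nsmul_eq_mul, Nat.cast_sub (Finset.card_pos.2 ⟨u, hu⟩)]
    · simp
    · intro w hw
      rw [Finset.mem_erase] at hw
      obtain ⟨h3, h4⟩ := State.rest_notMem h hw.2
      rw [State.card_pairEdges_union hd hv ht h1 h2 h3 h4 hw.1.symm, pow_add, hQ]
  rw [Finset.sum_eq_card_nsmul e2, nsmul_eq_mul]
  ring

/-- A uniform exponential moment of the number of discovered vertices. -/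
lemma State.integral_exp_freshCount_le (hd : 2 ≤ d) (h : s.next = some v) (hv : v ∉ s.explored)
    (ht : s.explored.card = t) :
    ∫ G, Real.exp (s.freshCount G : ℝ) ∂(setBernoulli {e : Finset (Fin N) | e.card = d} p) ≤
      Real.exp (p * (N - t - 1).choose (d - 1) * Real.exp d) := by
  classical
  set S := edgesThrough d s.exploredᶜ {v} with hS
  have hcard : S.card = (N - t - 1).choose (d - 1) := by
    rw [hS, card_edgesThrough (by simpa using hv) (by simp; omega), Finset.card_singleton,
      Finset.card_compl, ht, Fintype.card_fin]
  -- The discovered vertices lie in the union of the present edges through `v`, each of size `d`, so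
  -- the exponential is dominated by a product over independent edges.
  have hle : ∀ᵐ G ∂(setBernoulli {e : Finset (Fin N) | e.card = d} p),
      Real.exp (s.freshCount G : ℝ) ≤ ∏ e ∈ S, if e ∈ G then Real.exp d else 1 := by
    filter_upwards [setBernoulli_ae_subset] with G hG
    have h1 : s.freshCount G ≤ ((S.filter (· ∈ G)).biUnion id).card := by
      rw [State.freshCount_eq h]
      refine Finset.card_le_card fun u hu => ?_
      rw [Finset.mem_filter] at hu
      obtain ⟨_, e, he, hd', hve, hue⟩ := hu
      rw [Finset.mem_biUnion]
      refine ⟨e, ?_, hue⟩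
      rw [Finset.mem_filter, hS, mem_edgesThrough, Finset.subset_compl_iff_disjoint_right]
      exact ⟨⟨hd', hG he, by simpa using hve⟩, he⟩
    have h2 : ((S.filter (· ∈ G)).biUnion id).card ≤ (S.filter (· ∈ G)).card * d :=
      Finset.card_biUnion_le_card_mul _ _ _ fun e he => by
        have := (mem_edgesThrough.1 (Finset.mem_filter.1 he).1).2.1
        exact this.le
    rw [← Finset.prod_filter, Finset.prod_const, ← Real.exp_nat_mul]
    apply Real.exp_le_exp.2
    exact_mod_cast h1.trans h2
  refine (integral_mono_ae Integrable.of_finite Integrable.of_finite hle).trans ?_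
  rw [integral_prod_setBernoulli (u := {e : Finset (Fin N) | e.card = d}) S
    (fun e he => (mem_edgesThrough.1 he).2.1), hcard]
  have hp := p.2.1
  have hp1 := p.2.2
  have h0 : 1 - (p : ℝ) + p * Real.exp d ≤ Real.exp (p * Real.exp d) := by
    linarith [Real.add_one_le_exp ((p : ℝ) * Real.exp d)]
  calc _ ≤ Real.exp (p * Real.exp d) ^ (N - t - 1).choose (d - 1) :=
        pow_le_pow_left₀ (by have := Real.exp_pos (d : ℝ); nlinarith) h0 _
    _ = _ := by rw [← Real.exp_nat_mul]; congr 1; ring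

end Moments

end OneStep

/-! ### The conditional means, and the martingale differences in explicit form. -/

section Compensator

variable {N k d : ℕ} {lam : ℝ}

lemma history_mono {s t : ℕ} (h : s ≤ t) : history N k s ≤ history N k t :=
  iSup₂_le fun i hi => le_iSup₂_of_le i (Finset.Icc_subset_Icc_right h hi) le_rfl

lemma history_le (t : ℕ) : history N k t ≤ (inferInstance : MeasurableSpace (Set (Finset (Fin N)))) :=
  iSup₂_le fun _ _ => Measurable.comap_le (measurable_of_finite _)

lemma measurable_eta {i t : ℕ} (h1 : 1 ≤ i) (h2 : i ≤ t) :
    Measurable[history N k t] (fun G : Set (Finset (Fin N)) => eta G k i) := by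
  rw [measurable_iff_comap_le]
  exact le_iSup₂_of_le (f := fun i _ => MeasurableSpace.comap
    (fun G : Set (Finset (Fin N)) => eta G k i) ⊤) i (Finset.mem_Icc.2 ⟨h1, h2⟩) le_rfl

/-- Absence of active vertices is visible in the number of unseen ones: it means that unseen and
explored vertices exhaust the vertex set. So the count on the left is a function of the unseen
count, and with it measurable for the history of the `η_i`. -/
lemma card_rest_eq (G : Set (Finset (Fin N))) {t : ℕ} (ht : t < N) :
    (stateAt G k t).rest.card = (stateAt G k t).unseen.card -
      (if (stateAt G k t).unseen.card + t = N then 1 else 0) := by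
  have h := card_active_add G k ht.le
  by_cases ha : (stateAt G k t).active.Nonempty
  · have := Finset.card_pos.2 ha
    rw [card_rest_of_active G k ht ha, if_neg (by omega)]
    rfl
  · have h2 := card_rest_of_not_active G k ht ha
    rw [Finset.not_nonempty_iff_eq_empty] at ha
    rw [ha, Finset.card_empty] at h
    rw [if_pos (by omega)]
    omega

lemma measurable_card_unseen {t : ℕ} (ht : t ≤ N) :
    Measurable[history N k t] (fun G : Set (Finset (Fin N)) => (stateAt G k t).unseen.card) := by
  induction t with
  | zero => exact measurable_const
  | succ t ih =>
    have e : (fun G : Set (Finset (Fin N)) => (stateAt G k (t + 1)).unseen.card) =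
        (fun q : ℕ × ℕ => q.1 - (if q.1 + t = N then 1 else 0) - q.2) ∘
        fun G => ((stateAt G k t).unseen.card, eta G k (t + 1)) := by
      funext G
      have h1 := card_unseen_succ G k (t := t) (by omega)
      rw [card_rest_eq G (by omega)] at h1
      simp only [Function.comp]
      omega
    rw [e]
    refine (measurable_of_countable _).comp (Measurable.prodMk ?_ ?_)
    · exact (ih (by omega)).mono (history_mono (Nat.le_succ t)) le_rfl
    · exact measurable_eta (by omega) le_rfl

lemma measurable_card_rest {t : ℕ} (ht : t < N) :
    Measurable[history N k t] (fun G : Set (Finset (Fin N)) => (stateAt G k t).rest.card) := by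
  have e : (fun G : Set (Finset (Fin N)) => (stateAt G k t).rest.card) =
      (fun q : ℕ => q - (if q + t = N then 1 else 0)) ∘
        fun G => (stateAt G k t).unseen.card := by
    funext G
    exact card_rest_eq G ht
  rw [e]
  exact (measurable_of_countable _).comp (measurable_card_unseen ht.le)

lemma eta_congr {G G' : Set (Finset (Fin N))} {t i : ℕ} (ht : t ≤ N)
    (h : ∀ s ≤ t, stateAt G k s = stateAt G' k s) (hi : i ≤ t) : eta G k i = eta G' k i := by
  cases i with
  | zero => rfl
  | succ i =>
    have h1 := card_unseen_succ G k (t := i) (by omega)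
    have h2 := card_unseen_succ G' k (t := i) (by omega)
    rw [h _ hi, h i (by omega)] at h1
    omega

/-- The `η_i` are functions of the states, so the filtration of the statement is coarser than the
one for which independence is available. Events of the history may therefore be used as test
functions in `integral_of_history`. -/
lemma history_le_comap {t : ℕ} (ht : t ≤ N) : history N k t ≤ MeasurableSpace.comap
    (fun (G : Set (Finset (Fin N))) (s : Fin (t + 1)) => stateAt G k s) ⊤ := by
  refine iSup₂_le fun i hi => ?_
  rintro S ⟨A, -, rfl⟩
  refine ⟨(fun (G : Set (Finset (Fin N))) (s : Fin (t + 1)) => stateAt G k s) ''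
    ((fun G => eta G k i) ⁻¹' A), trivial, ?_⟩
  ext G
  constructor
  · rintro ⟨G', hG', h⟩
    have : eta G' k i = eta G k i := eta_congr ht
      (fun s hs => congrFun h ⟨s, by omega⟩) (Finset.mem_Icc.1 hi).2
    change eta G k i ∈ A
    rw [← this]
    exact hG'
  · exact fun hG => ⟨G, hG, rfl⟩

lemma dependsOnHistory_indicator {t : ℕ} (ht : t ≤ N) {B : Set (Set (Finset (Fin N)))}
    (hB : MeasurableSet[history N k t] B) :
    DependsOnHistory k t (B.indicator fun _ => (1 : ℝ)) := by
  classical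
  obtain ⟨A, -, rfl⟩ := history_le_comap ht B hB
  intro G G' h
  have : (fun (s : Fin (t + 1)) => stateAt G k s) = fun (s : Fin (t + 1)) => stateAt G' k s :=
    funext fun s => h s (by omega)
  simp only [Set.indicator, Set.mem_preimage, this]

/-- The conditional probability that a given vertex is discovered in step `t`. -/
def hitProb (d : ℕ) (lam : ℝ) (N t : ℕ) : ℝ :=
  1 - (1 - edgeProb d lam N) ^ (N - t - 1).choose (d - 2)

/-- The explicit form of the martingale difference in step `t + 1`. -/
def centred (d : ℕ) (lam : ℝ) (N k t : ℕ) (G : Set (Finset (Fin N))) : ℝ :=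
  (eta G k (t + 1) : ℝ) - (stateAt G k t).rest.card * hitProb d lam N (t + 1)

lemma coe_projIcc_edgeProb (h0 : 0 ≤ edgeProb d lam N) (h1 : edgeProb d lam N ≤ 1) :
    ((Set.projIcc (0 : ℝ) 1 zero_le_one (edgeProb d lam N) : unitInterval) : ℝ) =
      edgeProb d lam N := by
  rw [Set.projIcc_of_mem _ ⟨h0, h1⟩]

instance : IsProbabilityMeasure (hypergraphLaw d lam N) := by
  unfold hypergraphLaw; infer_instance

lemma integral_freshCount_stateAt (hd : 2 ≤ d) (h0 : 0 ≤ edgeProb d lam N)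
    (h1 : edgeProb d lam N ≤ 1) {t : ℕ} (ht : t < N) (G : Set (Finset (Fin N))) :
    ∫ G', ((stateAt G k t).freshCount G' : ℝ) ∂(hypergraphLaw d lam N) =
      (stateAt G k t).rest.card * hitProb d lam N (t + 1) := by
  obtain ⟨v, hv⟩ := exists_next G k ht
  have := State.integral_freshCount (p := Set.projIcc (0 : ℝ) 1 zero_le_one (edgeProb d lam N))
    hd hv ((isConsistent_stateAt G k t).next_notMem hv) (card_explored G k ht.le)
  rw [coe_projIcc_edgeProb h0 h1] at this
  -- With `t` vertices explored, step `t + 1` leaves `N - t - 2` vertices besides `v` and `u`, which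
  -- matches the index `t + 1` of `hitProb`.
  rw [hypergraphLaw, this, hitProb, show N - (t + 1) - 1 = N - t - 2 by omega]

/-- The martingale differences in explicit form. -/
lemma increment_ae_eq (hd : 2 ≤ d) (h0 : 0 ≤ edgeProb d lam N)
    (h1 : edgeProb d lam N ≤ 1) {t : ℕ} (ht : t < N) :
    increment d lam N k (t + 1) =ᵐ[hypergraphLaw d lam N] centred d lam N k t := by
  have key : (fun G => ((stateAt G k t).rest.card : ℝ) * hitProb d lam N (t + 1))
      =ᵐ[hypergraphLaw d lam N] (hypergraphLaw d lam N)[fun G' => (eta G' k (t + 1) : ℝ) |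
        history N k t] := by
    refine ae_eq_condExp_of_forall_setIntegral_eq (history_le t) Integrable.of_finite
      (fun _ _ _ => Integrable.of_finite.integrableOn) ?_ ?_
    · intro B hB _
      have hB' : MeasurableSet B := history_le t B hB
      have e := integral_of_history (p := Set.projIcc (0 : ℝ) 1 zero_le_one (edgeProb d lam N))
        (u := {e : Finset (Fin N) | e.card = d})
        (dependsOnHistory_indicator ht.le hB) (fun _ n => (n : ℝ))
      change ∫ G, _ ∂(hypergraphLaw d lam N) = ∫ G, B.indicator (fun _ => (1 : ℝ)) G *
        (∫ G', ((stateAt G k t).freshCount G' : ℝ) ∂(hypergraphLaw d lam N))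
        ∂(hypergraphLaw d lam N) at e
      simp_rw [integral_freshCount_stateAt hd h0 h1 ht] at e
      rw [← integral_indicator hB', ← integral_indicator hB']
      have i1 : ∀ f : Set (Finset (Fin N)) → ℝ, B.indicator f =
          fun G => B.indicator (fun _ => (1 : ℝ)) G * f G := by
        intro f; funext G
        by_cases hG : G ∈ B <;> simp [hG]
      rw [i1, i1 (fun G => (eta G k (t + 1) : ℝ))]
      exact e.symm
    · refine StronglyMeasurable.aestronglyMeasurable (Measurable.stronglyMeasurable ?_)
      exact ((measurable_of_countable (fun n : ℕ => (n : ℝ) * hitProb d lam N (t + 1))).comp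
        (measurable_card_rest ht))
  filter_upwards [key] with G hG
  rw [increment, centred, hG]
  rfl

end Compensator

/-! ### Moment generating functions of small multiples of centred variables. -/

section ExponentialMoments

lemma abs_exp_sub_quadratic_le (x : ℝ) :
    |Real.exp x - 1 - x - x ^ 2 / 2| ≤ |x| ^ 3 * Real.exp |x| := by
  have h := Complex.norm_exp_sub_sum_le_norm_mul_exp (x : ℂ) 3
  have e : Complex.exp x - ∑ m ∈ Finset.range 3, (x : ℂ) ^ m / (m.factorial : ℂ) =
      ((Real.exp x - 1 - x - x ^ 2 / 2 : ℝ) : ℂ) := by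
    push_cast
    simp [Finset.sum_range_succ, Nat.factorial]
    ring
  rw [e, Complex.norm_real, Complex.norm_real] at h
  exact h

/-- A converse to `1 + y ≤ exp y` with quadratic loss, for lower bounds on moment generating
functions and on the products `β_t`. -/
lemma exp_sub_four_mul_sq_le {y : ℝ} (hy : |y| ≤ 1 / 4) : Real.exp (y - 4 * y ^ 2) ≤ 1 + y := by
  have h1 := abs_le.1 hy
  have h3 : |y - 4 * y ^ 2| ≤ 1 := by
    rw [abs_le]; constructor <;> nlinarith
  have h2 := (abs_le.1 (Real.abs_exp_sub_one_sub_id_le h3)).2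
  have h4 : (1 - 4 * y) ^ 2 ≤ 4 := by nlinarith
  nlinarith [mul_nonneg (sq_nonneg y) (sub_nonneg.2 h4)]

variable {Ω : Type*} [MeasurableSpace Ω] [Finite Ω] [MeasurableSingletonClass Ω]
  {μ : Measure Ω} [IsProbabilityMeasure μ] {X : Ω → ℝ} {K s : ℝ}

lemma one_le_of_integral_exp_abs_le (hK : ∫ ω, Real.exp |X ω| ∂μ ≤ K) : 1 ≤ K := by
  refine le_trans ?_ hK
  have : ∫ _, (1 : ℝ) ∂μ ≤ ∫ ω, Real.exp |X ω| ∂μ :=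
    integral_mono Integrable.of_finite Integrable.of_finite
      fun ω => Real.one_le_exp (abs_nonneg _)
  simpa using this

lemma integral_sq_le_of_integral_exp_abs_le (hK : ∫ ω, Real.exp |X ω| ∂μ ≤ K) :
    ∫ ω, X ω ^ 2 ∂μ ≤ 2 * K := by
  have : ∫ ω, X ω ^ 2 ∂μ ≤ ∫ ω, 2 * Real.exp |X ω| ∂μ := by
    refine integral_mono Integrable.of_finite Integrable.of_finite fun ω => ?_
    have := Real.pow_div_factorial_le_exp (|X ω|) (abs_nonneg _) 2
    simp only [Nat.factorial, sq_abs] at this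
    push_cast at this
    simp only
    linarith
  rw [integral_const_mul] at this
  linarith

/-- Second-order expansion of the moment generating function of a centred variable. -/
lemma abs_mgf_sub_quadratic_le (h0 : ∫ ω, X ω ∂μ = 0) (hK : ∫ ω, Real.exp |X ω| ∂μ ≤ K)
    (hs : |s| ≤ 1 / 2) :
    |∫ ω, Real.exp (s * X ω) ∂μ - (1 + s ^ 2 / 2 * ∫ ω, X ω ^ 2 ∂μ)| ≤ 48 * K * |s| ^ 3 := by
  have e : ∫ ω, Real.exp (s * X ω) ∂μ - (1 + s ^ 2 / 2 * ∫ ω, X ω ^ 2 ∂μ) =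
      ∫ ω, (Real.exp (s * X ω) - 1 - s * X ω - (s * X ω) ^ 2 / 2) ∂μ := by
    have e1 : ∀ ω, Real.exp (s * X ω) - 1 - s * X ω - (s * X ω) ^ 2 / 2 =
        Real.exp (s * X ω) - 1 - s * X ω - s ^ 2 / 2 * X ω ^ 2 := fun ω => by ring
    simp_rw [e1]
    rw [integral_sub Integrable.of_finite Integrable.of_finite,
      integral_sub Integrable.of_finite Integrable.of_finite,
      integral_sub Integrable.of_finite Integrable.of_finite, integral_const_mul,
      integral_const_mul, h0]
    simp
    ring
  rw [e]
  refine (abs_integral_le_integral_abs).trans ?_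
  have hb : ∫ ω, |Real.exp (s * X ω) - 1 - s * X ω - (s * X ω) ^ 2 / 2| ∂μ ≤
      ∫ ω, 48 * |s| ^ 3 * Real.exp |X ω| ∂μ := by
    refine integral_mono Integrable.of_finite Integrable.of_finite fun ω => ?_
    refine (abs_exp_sub_quadratic_le _).trans ?_
    -- One half of `exp |X|` pays for the cube (48 = 2³ · 3!), the other for `exp |sX|`, as `|s| ≤ 1
    -- / 2`.
    have h1 := Real.pow_div_factorial_le_exp (|X ω| / 2) (by positivity) 3
    have h2 : |s * X ω| ≤ |X ω| / 2 := by
      rw [abs_mul]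
      nlinarith [abs_nonneg (X ω)]
    have h3 : |s * X ω| ^ 3 = |s| ^ 3 * |X ω| ^ 3 := by rw [abs_mul, mul_pow]
    have h4 : |X ω| ^ 3 ≤ 48 * Real.exp (|X ω| / 2) := by
      have : ((Nat.factorial 3 : ℕ) : ℝ) = 6 := by norm_num [Nat.factorial]
      rw [this, div_le_iff₀ (by norm_num)] at h1
      nlinarith
    have h5 : Real.exp |X ω| = Real.exp (|X ω| / 2) * Real.exp (|X ω| / 2) := by
      rw [← Real.exp_add]; congr 1; ring
    rw [h3, h5]
    calc |s| ^ 3 * |X ω| ^ 3 * Real.exp |s * X ω|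
        ≤ |s| ^ 3 * (48 * Real.exp (|X ω| / 2)) * Real.exp (|X ω| / 2) := by gcongr
      _ = _ := by ring
  refine hb.trans ?_
  rw [integral_const_mul]
  have : 0 ≤ 48 * |s| ^ 3 := by positivity
  nlinarith

/-- Rewrites the second-order expansion in exponential form, so that bounds multiply along the
exploration. Under the smallness condition the loss `4y²` in the lower bound is at most `4 K |s|³ /
25`, which fits between the constants 48 and 100. -/
lemma mgf_bounds (h0 : ∫ ω, X ω ∂μ = 0) (hK : ∫ ω, Real.exp |X ω| ∂μ ≤ K)
    (hs : 100 * K * |s| ≤ 1) :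
    Real.exp (s ^ 2 / 2 * ∫ ω, X ω ^ 2 ∂μ - 100 * K * |s| ^ 3) ≤ ∫ ω, Real.exp (s * X ω) ∂μ ∧
    ∫ ω, Real.exp (s * X ω) ∂μ ≤
      Real.exp (s ^ 2 / 2 * ∫ ω, X ω ^ 2 ∂μ + 100 * K * |s| ^ 3) := by
  have hK1 := one_le_of_integral_exp_abs_le hK
  have hV := integral_sq_le_of_integral_exp_abs_le hK
  have hV0 : 0 ≤ ∫ ω, X ω ^ 2 ∂μ := integral_nonneg fun ω => sq_nonneg _
  set V := ∫ ω, X ω ^ 2 ∂μ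
  have hs0 := abs_nonneg s
  have hs1 : |s| ≤ 1 / 100 := by nlinarith
  have h := abs_le.1 (abs_mgf_sub_quadratic_le h0 hK (s := s) (by linarith))
  have hc : 0 ≤ K * |s| ^ 3 := by positivity
  have hsq : s ^ 2 = |s| ^ 2 := (sq_abs s).symm
  constructor
  · set y := s ^ 2 / 2 * V - 48 * K * |s| ^ 3 with hy
    have hb : |y| ≤ 2 * K * |s| ^ 2 := by
      have a1 : 0 ≤ |s| ^ 2 * V := by positivity
      have a2 : |s| ^ 2 * V ≤ |s| ^ 2 * (2 * K) := by gcongr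
      have a3 : K * |s| ^ 3 ≤ K * |s| ^ 2 * (1 / 100) := by
        rw [pow_succ, ← mul_assoc]; gcongr
      have a4 : 0 ≤ K * |s| ^ 2 := by positivity
      rw [hy, hsq, abs_le]
      constructor <;> nlinarith
    have hKs : K * |s| ^ 2 ≤ |s| / 100 := by nlinarith
    have hy2 : y ^ 2 ≤ K * |s| ^ 3 / 25 := by
      have : y ^ 2 ≤ (2 * K * |s| ^ 2) ^ 2 := by
        rw [← sq_abs y]; gcongr
      have h5 : (2 * K * |s| ^ 2) ^ 2 = 4 * (K * |s| ^ 3) * (K * |s|) := by ring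
      nlinarith
    have h6 := exp_sub_four_mul_sq_le (y := y) (by linarith)
    calc Real.exp (s ^ 2 / 2 * V - 100 * K * |s| ^ 3) ≤ Real.exp (y - 4 * y ^ 2) := by
          apply Real.exp_le_exp.2; rw [hy] at hy2 ⊢; linarith
      _ ≤ 1 + y := h6
      _ ≤ _ := by rw [hy]; linarith [h.1]
  · have := Real.add_one_le_exp (s ^ 2 / 2 * V + 100 * K * |s| ^ 3)
    linarith [h.2]

end ExponentialMoments

/-! ### Compensated exponentials along the exploration. -/

section Chain

variable {N k d : ℕ} {lam : ℝ}

lemma choose_mul_factorial_le (n m : ℕ) : (n.choose m : ℝ) * m.factorial ≤ (n : ℝ) ^ m := by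
  have := Nat.choose_le_pow_div (α := ℝ) m n
  rwa [le_div_iff₀ (by positivity)] at this

lemma edgeProb_nonneg (hlam : 0 ≤ lam) : 0 ≤ edgeProb d lam N := by
  unfold edgeProb; positivity

lemma edgeProb_mul_choose_le (hd : 2 ≤ d) (hlam : 0 ≤ lam) (hN : 0 < N) {M : ℕ} (hM : M ≤ N) :
    edgeProb d lam N * (M.choose (d - 1) : ℝ) ≤ lam := by
  have h1 := choose_mul_factorial_le M (d - 1)
  have h2 : ((d - 2).factorial : ℝ) ≤ (d - 1).factorial := by
    exact_mod_cast Nat.factorial_le (by omega)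
  have h3 : (M : ℝ) ^ (d - 1) ≤ (N : ℝ) ^ (d - 1) := by gcongr
  have hN' : (0 : ℝ) < (N : ℝ) ^ (d - 1) := by positivity
  rw [edgeProb, div_mul_eq_mul_div, div_le_iff₀ hN', mul_assoc]
  refine mul_le_mul_of_nonneg_left ?_ hlam
  calc ((d - 2).factorial : ℝ) * M.choose (d - 1)
      ≤ (d - 1).factorial * M.choose (d - 1) := by gcongr
    _ ≤ _ := by linarith

lemma edgeProb_mul_choose_le' (hd : 2 ≤ d) (hlam : 0 ≤ lam) (hN : 0 < N) {M : ℕ} (hM : M ≤ N) :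
    edgeProb d lam N * (M.choose (d - 2) : ℝ) ≤ lam / N := by
  have h1 := choose_mul_factorial_le M (d - 2)
  have h3 : (M : ℝ) ^ (d - 2) ≤ (N : ℝ) ^ (d - 2) := by gcongr
  have hN1 : (0 : ℝ) < N := by exact_mod_cast hN
  have hN' : (0 : ℝ) < (N : ℝ) ^ (d - 1) := by positivity
  rw [edgeProb, div_mul_eq_mul_div, div_le_div_iff₀ hN' hN1]
  have e : (N : ℝ) ^ (d - 1) = (N : ℝ) ^ (d - 2) * N := by
    rw [← pow_succ]; congr 1; omega
  rw [e, ← mul_assoc]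
  refine mul_le_mul_of_nonneg_right ?_ hN1.le
  rw [mul_assoc]
  refine mul_le_mul_of_nonneg_left ?_ hlam
  linarith

lemma alphaCoeff_nonneg (hlam : 0 ≤ lam) (t : ℕ) : 0 ≤ alphaCoeff d lam N t :=
  mul_nonneg (edgeProb_nonneg hlam) (Nat.cast_nonneg _)

lemma alphaCoeff_le (hd : 2 ≤ d) (hlam : 0 ≤ lam) (hN : 0 < N) (t : ℕ) :
    alphaCoeff d lam N t ≤ lam / N :=
  edgeProb_mul_choose_le' hd hlam hN (by omega)

lemma hitProb_nonneg (hlam : 0 ≤ lam) (h1 : edgeProb d lam N ≤ 1) (t : ℕ) :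
    0 ≤ hitProb d lam N t :=
  sub_nonneg.2 (pow_le_one₀ (sub_nonneg.2 h1) (by linarith [edgeProb_nonneg (N := N) (d := d) hlam]))

lemma hitProb_le_alphaCoeff (h1 : edgeProb d lam N ≤ 1) (t : ℕ) :
    hitProb d lam N t ≤ alphaCoeff d lam N t := by
  have := one_add_mul_le_pow (a := -edgeProb d lam N) (by linarith)
    ((N - t - 1).choose (d - 2))
  rw [hitProb, alphaCoeff]
  rw [← sub_eq_add_neg] at this
  linarith

lemma card_rest_le (s : State N) : s.rest.card ≤ N :=
  (Finset.card_le_univ _).trans_eq (Fintype.card_fin N)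

/-- The uniform exponential moment bound of the centred increments. -/
def momentBound (d : ℕ) (lam : ℝ) : ℝ := Real.exp (lam * Real.exp d) * Real.exp lam

/-- The conditional variance of step `t + 1` from the state `s`. -/
def stepVariance (d : ℕ) (lam : ℝ) (N t : ℕ) (s : State N) : ℝ :=
  ∫ G, ((s.freshCount G : ℝ) - s.rest.card * hitProb d lam N (t + 1)) ^ 2 ∂(hypergraphLaw d lam N)

lemma stepVariance_nonneg (t : ℕ) (s : State N) : 0 ≤ stepVariance d lam N t s :=
  integral_nonneg fun _ => sq_nonneg _

lemma mean_le (hd : 2 ≤ d) (hlam : 0 ≤ lam) (h1 : edgeProb d lam N ≤ 1) (hN : 0 < N) (s : State N)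
    (t : ℕ) : s.rest.card * hitProb d lam N t ≤ lam := by
  have hN1 : (0 : ℝ) < N := by exact_mod_cast hN
  have h2 : (s.rest.card : ℝ) ≤ N := by exact_mod_cast card_rest_le s
  have h3 := (hitProb_le_alphaCoeff h1 t).trans (alphaCoeff_le hd hlam hN t)
  calc s.rest.card * hitProb d lam N t ≤ N * (lam / N) :=
        mul_le_mul h2 h3 (hitProb_nonneg hlam h1 t) hN1.le
    _ = lam := by field_simp

/-- The count is nonnegative and its mean lies in `[0, lam]`, so the modulus is at most the count
plus `lam`. -/
lemma integral_exp_abs_centred_le (hd : 2 ≤ d) (hlam : 0 ≤ lam)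
    (h1 : edgeProb d lam N ≤ 1) {t : ℕ} (ht : t < N) (G : Set (Finset (Fin N))) :
    ∫ G', Real.exp |((stateAt G k t).freshCount G' : ℝ) -
      (stateAt G k t).rest.card * hitProb d lam N (t + 1)| ∂(hypergraphLaw d lam N) ≤
        momentBound d lam := by
  have h0 := edgeProb_nonneg (d := d) (N := N) hlam
  obtain ⟨v, hv⟩ := exists_next G k ht
  have h2 := State.integral_exp_freshCount_le
    (p := Set.projIcc (0 : ℝ) 1 zero_le_one (edgeProb d lam N))
    hd hv ((isConsistent_stateAt G k t).next_notMem hv) (card_explored G k ht.le)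
  rw [coe_projIcc_edgeProb h0 h1] at h2
  change ∫ G', _ ∂(hypergraphLaw d lam N) ≤ _ at h2
  set s := stateAt G k t
  have hm := mean_le hd hlam h1 (by omega) s (t + 1)
  have hm0 : 0 ≤ s.rest.card * hitProb d lam N (t + 1) :=
    mul_nonneg (Nat.cast_nonneg _) (hitProb_nonneg hlam h1 _)
  have h3 : ∫ G', Real.exp |(s.freshCount G' : ℝ) - s.rest.card * hitProb d lam N (t + 1)|
      ∂(hypergraphLaw d lam N) ≤
      ∫ G', Real.exp (s.freshCount G' : ℝ) * Real.exp lam ∂(hypergraphLaw d lam N) := by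
    refine integral_mono Integrable.of_finite Integrable.of_finite fun G' => ?_
    simp only
    rw [← Real.exp_add]
    apply Real.exp_le_exp.2
    have : (0 : ℝ) ≤ s.freshCount G' := Nat.cast_nonneg _
    rw [abs_le]
    constructor <;> linarith
  rw [integral_mul_const] at h3
  refine h3.trans (mul_le_mul_of_nonneg_right (h2.trans ?_) (Real.exp_pos _).le)
  apply Real.exp_le_exp.2
  exact mul_le_mul_of_nonneg_right (edgeProb_mul_choose_le hd hlam (by omega) (by omega))
    (Real.exp_pos _).le

lemma stepVariance_le (hd : 2 ≤ d) (hlam : 0 ≤ lam)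
    (h1 : edgeProb d lam N ≤ 1) {t : ℕ} (ht : t < N) (G : Set (Finset (Fin N))) :
    stepVariance d lam N t (stateAt G k t) ≤ 2 * momentBound d lam :=
  integral_sq_le_of_integral_exp_abs_le (integral_exp_abs_centred_le hd hlam h1 ht G)

/-- The linear statistic `∑ s_i Δ_{i+1}`. -/
def linStat (d : ℕ) (lam : ℝ) (N k : ℕ) (s : ℕ → ℝ) (t : ℕ) (G : Set (Finset (Fin N))) : ℝ :=
  ∑ i ∈ Finset.range t, s i * centred d lam N k i G

/-- Half of the predictable quadratic variation of `linStat`. -/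
def quadStat (d : ℕ) (lam : ℝ) (N k : ℕ) (s : ℕ → ℝ) (t : ℕ) (G : Set (Finset (Fin N))) : ℝ :=
  ∑ i ∈ Finset.range t, s i ^ 2 / 2 * stepVariance d lam N i (stateAt G k i)

lemma dependsOnHistory_chain (s : ℕ → ℝ) {t : ℕ} (ht : t ≤ N) : DependsOnHistory k t
    fun G => Real.exp (linStat d lam N k s t G - quadStat d lam N k s t G) := by
  intro G G' h
  have e1 : linStat d lam N k s t G = linStat d lam N k s t G' := by
    refine Finset.sum_congr rfl fun i hi => ?_
    have hi := Finset.mem_range.1 hi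
    rw [centred, centred, eta_congr ht h (Nat.succ_le_of_lt hi), h i hi.le]
  have e2 : quadStat d lam N k s t G = quadStat d lam N k s t G' := by
    refine Finset.sum_congr rfl fun i hi => ?_
    rw [h i (Finset.mem_range.1 hi).le]
  simp only [e1, e2]

/-- Compensated exponentials of the exploration martingale have mean close to `1`. -/
lemma integral_chain_bounds (hd : 2 ≤ d) (hlam : 0 ≤ lam) (h1 : edgeProb d lam N ≤ 1)
    {s : ℕ → ℝ} {t : ℕ} (ht : t ≤ N) (hs : ∀ i < t, 100 * momentBound d lam * |s i| ≤ 1) :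
    Real.exp (-(∑ i ∈ Finset.range t, 100 * momentBound d lam * |s i| ^ 3)) ≤
      ∫ G, Real.exp (linStat d lam N k s t G - quadStat d lam N k s t G) ∂(hypergraphLaw d lam N) ∧
    ∫ G, Real.exp (linStat d lam N k s t G - quadStat d lam N k s t G) ∂(hypergraphLaw d lam N) ≤
      Real.exp (∑ i ∈ Finset.range t, 100 * momentBound d lam * |s i| ^ 3) := by
  have h0 := edgeProb_nonneg (d := d) (N := N) hlam
  induction t with
  | zero => simp [linStat, quadStat]
  | succ t ih =>
    obtain ⟨ihl, ihu⟩ := ih (by omega) fun i hi => hs i (by omega)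
    have ht' : t < N := ht
    set E : Set (Finset (Fin N)) → ℝ := fun G =>
      Real.exp (linStat d lam N k s t G - quadStat d lam N k s t G) with hE
    -- The factor contributed by step `t + 1`, a function of the current state and of the new `η`
    -- only.
    set g : State N → ℕ → ℝ := fun σ n =>
      Real.exp (s t * ((n : ℝ) - σ.rest.card * hitProb d lam N (t + 1))) *
        Real.exp (-(s t ^ 2 / 2 * stepVariance d lam N t σ)) with hg
    have e1 : ∀ G, Real.exp (linStat d lam N k s (t + 1) G - quadStat d lam N k s (t + 1) G) =
        E G * g (stateAt G k t) (eta G k (t + 1)) := by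
      intro G
      simp only [hE, hg]
      rw [← Real.exp_add, ← Real.exp_add, linStat, quadStat, Finset.sum_range_succ,
        Finset.sum_range_succ, linStat, quadStat, centred]
      congr 1
      ring
    have e2 := integral_of_history (u := {e : Finset (Fin N) | e.card = d})
      (p := Set.projIcc (0 : ℝ) 1 zero_le_one (edgeProb d lam N))
      (dependsOnHistory_chain (d := d) (lam := lam) (k := k) s ht'.le) g
    change ∫ G, E G * g (stateAt G k t) (eta G k (t + 1)) ∂(hypergraphLaw d lam N) =
      ∫ G, E G * (∫ G', g (stateAt G k t) ((stateAt G k t).freshCount G')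
        ∂(hypergraphLaw d lam N)) ∂(hypergraphLaw d lam N) at e2
    simp_rw [e1]
    rw [e2]
    set ε := 100 * momentBound d lam * |s t| ^ 3 with hε
    -- The compensator cancels the quadratic term of `mgf_bounds`. What remains is deterministic, so
    -- it can be taken out of the outer integral.
    have hin : ∀ G, Real.exp (-ε) ≤ ∫ G', g (stateAt G k t) ((stateAt G k t).freshCount G')
          ∂(hypergraphLaw d lam N) ∧ ∫ G', g (stateAt G k t) ((stateAt G k t).freshCount G')
          ∂(hypergraphLaw d lam N) ≤ Real.exp ε := by
      intro G
      have hK := integral_exp_abs_centred_le (k := k) hd hlam h1 ht' G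
      have hmean : ∫ G', (((stateAt G k t).freshCount G' : ℝ) -
          (stateAt G k t).rest.card * hitProb d lam N (t + 1)) ∂(hypergraphLaw d lam N) = 0 := by
        rw [integral_sub Integrable.of_finite Integrable.of_finite,
          integral_freshCount_stateAt hd h0 h1 ht']
        simp
      obtain ⟨b1, b2⟩ := mgf_bounds hmean hK (hs t (Nat.lt_succ_self t))
      simp only [hg]
      rw [integral_mul_const]
      have hp := (Real.exp_pos (-(s t ^ 2 / 2 * stepVariance d lam N t (stateAt G k t)))).le
      have b1' := mul_le_mul_of_nonneg_right b1 hp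
      have b2' := mul_le_mul_of_nonneg_right b2 hp
      rw [← Real.exp_add] at b1' b2'
      constructor
      · refine le_trans (Real.exp_le_exp.2 (le_of_eq ?_)) b1'
        rw [stepVariance]; ring
      · refine b2'.trans (Real.exp_le_exp.2 (le_of_eq ?_))
        rw [stepVariance]; ring
    have hl : ∫ G, E G * Real.exp (-ε) ∂(hypergraphLaw d lam N) ≤
        ∫ G, E G * (∫ G', g (stateAt G k t) ((stateAt G k t).freshCount G')
          ∂(hypergraphLaw d lam N)) ∂(hypergraphLaw d lam N) :=
      integral_mono Integrable.of_finite Integrable.of_finite fun G =>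
        mul_le_mul_of_nonneg_left (hin G).1 (Real.exp_pos _).le
    have hu : ∫ G, E G * (∫ G', g (stateAt G k t) ((stateAt G k t).freshCount G')
          ∂(hypergraphLaw d lam N)) ∂(hypergraphLaw d lam N) ≤
        ∫ G, E G * Real.exp ε ∂(hypergraphLaw d lam N) :=
      integral_mono Integrable.of_finite Integrable.of_finite fun G =>
        mul_le_mul_of_nonneg_left (hin G).2 (Real.exp_pos _).le
    rw [integral_mul_const] at hl hu
    rw [Finset.sum_range_succ, neg_add, Real.exp_add, Real.exp_add]
    exact ⟨(mul_le_mul_of_nonneg_right ihl (Real.exp_pos _).le).trans hl,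
      hu.trans (mul_le_mul_of_nonneg_right ihu (Real.exp_pos _).le)⟩

end Chain

/-! ### Removing the compensator, and exponential tails. -/

section Tails

/-- Off `B` the compensator `Q` may be replaced by `A` at the cost of `κ`. On `B` only `Q ≥ 0` is
known, so the mass of `exp W` there must be negligible: above the level `L + y` it is bounded
through the mean of `exp (2W)`, below it through the measure of `B`. -/
lemma half_exp_le_integral_exp_le {Ω : Type*} [MeasurableSpace Ω] [Finite Ω]
    [MeasurableSingletonClass Ω] {μ : Measure Ω} [IsProbabilityMeasure μ] {W Q : Ω → ℝ}
    {B : Set Ω} {A κ e L y : ℝ} (hQ : ∀ ω, 0 ≤ Q ω) (hA : 0 ≤ A) (hκ : 0 ≤ κ) (he : 0 ≤ e)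
    (hgood : ∀ ω ∉ B, |Q ω - A| ≤ κ)
    (hl : Real.exp (-e) ≤ ∫ ω, Real.exp (W ω - Q ω) ∂μ)
    (hu : ∫ ω, Real.exp (W ω - Q ω) ∂μ ≤ Real.exp e)
    (hL : ∫ ω, Real.exp (2 * W ω) ∂μ ≤ Real.exp L)
    (hB : μ.real B ≤ Real.exp (-(L + 2 * y))) (hy : e + 2 ≤ y) :
    Real.exp (A - κ - e) / 2 ≤ ∫ ω, Real.exp (W ω) ∂μ ∧
      ∫ ω, Real.exp (W ω) ∂μ ≤ 3 * Real.exp (A + κ + e) := by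
  have hBm : MeasurableSet B := B.toFinite.measurableSet
  -- the contribution of the exceptional set
  have hbad : ∫ ω, B.indicator (fun ω => Real.exp (W ω)) ω ∂μ ≤ 2 * Real.exp (-y) := by
    have h1 : ∀ ω, B.indicator (fun ω => Real.exp (W ω)) ω ≤
        Real.exp (-(L + y)) * Real.exp (2 * W ω) +
          Real.exp (L + y) * B.indicator (fun _ => (1 : ℝ)) ω := by
      intro ω
      by_cases hω : ω ∈ B
      · rw [Set.indicator_of_mem hω, Set.indicator_of_mem hω, mul_one, ← Real.exp_add]
        rcases le_total (W ω) (L + y) with h | h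
        · exact (Real.exp_le_exp.2 h).trans (le_add_of_nonneg_left (Real.exp_pos _).le)
        · exact (Real.exp_le_exp.2 (by linarith)).trans (le_add_of_nonneg_right (Real.exp_pos _).le)
      · rw [Set.indicator_of_notMem hω, Set.indicator_of_notMem hω, mul_zero, add_zero]
        positivity
    refine (integral_mono Integrable.of_finite Integrable.of_finite h1).trans ?_
    rw [integral_add Integrable.of_finite Integrable.of_finite, integral_const_mul,
      integral_const_mul, integral_indicator_const _ hBm, smul_eq_mul, mul_one]
    have h2 : Real.exp (-(L + y)) * ∫ ω, Real.exp (2 * W ω) ∂μ ≤ Real.exp (-y) := by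
      refine (mul_le_mul_of_nonneg_left hL (Real.exp_pos _).le).trans_eq ?_
      rw [← Real.exp_add]; congr 1; ring
    have h3 : Real.exp (L + y) * μ.real B ≤ Real.exp (-y) := by
      refine (mul_le_mul_of_nonneg_left hB (Real.exp_pos _).le).trans_eq ?_
      rw [← Real.exp_add]; congr 1; ring
    linarith
  -- The gap `y - e ≥ 2` gives `exp (y - e) ≥ exp 2 ≥ 4`, so the exceptional set takes at most half
  -- of the lower bound.
  have hsmall : 2 * Real.exp (-y) ≤ Real.exp (-e) / 2 := by
    have h1 : Real.exp (-e) = Real.exp (-y) * Real.exp (y - e) := by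
      rw [← Real.exp_add]; congr 1; ring
    have h2 : 4 ≤ Real.exp (y - e) := by
      have h4 : Real.exp 2 ≤ Real.exp (y - e) := Real.exp_le_exp.2 (by linarith)
      have h5 : Real.exp 2 = Real.exp 1 * Real.exp 1 := by rw [← Real.exp_add]; norm_num
      nlinarith [Real.add_one_le_exp (1 : ℝ)]
    rw [h1]
    nlinarith [Real.exp_pos (-y)]
  constructor
  · have h1 : ∀ ω, Real.exp (W ω - Q ω) ≤ Real.exp (-(A - κ)) * Real.exp (W ω) +
        B.indicator (fun ω => Real.exp (W ω)) ω := by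
      intro ω
      by_cases hω : ω ∈ B
      · rw [Set.indicator_of_mem hω]
        have : Real.exp (W ω - Q ω) ≤ Real.exp (W ω) := Real.exp_le_exp.2 (by linarith [hQ ω])
        have := mul_pos (Real.exp_pos (-(A - κ))) (Real.exp_pos (W ω))
        linarith
      · rw [Set.indicator_of_notMem hω, add_zero, ← Real.exp_add]
        exact Real.exp_le_exp.2 (by linarith [(abs_le.1 (hgood ω hω)).1])
    have h2 := integral_mono (μ := μ) Integrable.of_finite Integrable.of_finite h1
    rw [integral_add Integrable.of_finite Integrable.of_finite, integral_const_mul] at h2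
    have h3 : Real.exp (-e) / 2 ≤ Real.exp (-(A - κ)) * ∫ ω, Real.exp (W ω) ∂μ := by linarith
    have h4 := mul_le_mul_of_nonneg_left h3 (Real.exp_pos (A - κ)).le
    rw [← mul_assoc, ← Real.exp_add, ← mul_div_assoc, ← Real.exp_add] at h4
    simpa [sub_eq_add_neg] using h4
  · have h1 : ∀ ω, Real.exp (W ω) ≤ Real.exp (A + κ) * Real.exp (W ω - Q ω) +
        B.indicator (fun ω => Real.exp (W ω)) ω := by
      intro ω
      by_cases hω : ω ∈ B
      · rw [Set.indicator_of_mem hω]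
        exact le_add_of_nonneg_left (by positivity)
      · rw [Set.indicator_of_notMem hω, add_zero, ← Real.exp_add]
        exact Real.exp_le_exp.2 (by linarith [(abs_le.1 (hgood ω hω)).2])
    have h2 := integral_mono (μ := μ) Integrable.of_finite Integrable.of_finite h1
    rw [integral_add Integrable.of_finite Integrable.of_finite, integral_const_mul] at h2
    have h3 := mul_le_mul_of_nonneg_left hu (Real.exp_pos (A + κ)).le
    rw [← Real.exp_add] at h3
    have h4 : Real.exp (-e) ≤ Real.exp (A + κ + e) := Real.exp_le_exp.2 (by linarith)
    have h5 := Real.exp_pos (-e)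
    linarith

variable {N k d : ℕ} {lam : ℝ}

lemma one_le_momentBound (hlam : 0 ≤ lam) : 1 ≤ momentBound d lam :=
  one_le_mul_of_one_le_of_one_le (Real.one_le_exp (mul_nonneg hlam (Real.exp_pos _).le))
    (Real.one_le_exp hlam)

lemma quadStat_nonneg (s : ℕ → ℝ) (t : ℕ) (G : Set (Finset (Fin N))) :
    0 ≤ quadStat d lam N k s t G :=
  Finset.sum_nonneg fun _ _ => mul_nonneg (by positivity) (stepVariance_nonneg _ _)

lemma quadStat_le (hd : 2 ≤ d) (hlam : 0 ≤ lam) (h1 : edgeProb d lam N ≤ 1) (s : ℕ → ℝ) {t : ℕ}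
    (ht : t ≤ N) (G : Set (Finset (Fin N))) :
    quadStat d lam N k s t G ≤ ∑ i ∈ Finset.range t, momentBound d lam * s i ^ 2 := by
  refine Finset.sum_le_sum fun i hi => ?_
  have := stepVariance_le (k := k) hd hlam h1 (lt_of_lt_of_le (Finset.mem_range.1 hi) ht) G
  nlinarith [sq_nonneg (s i)]

/-- A crude sub-Gaussian bound: `Q` never exceeds `K σ² N`, and the cubic error is no larger because
`100 K σ ≤ 1`. It serves for the tails of the martingale and for the second exponential moment. -/
lemma integral_exp_linStat_le (hd : 2 ≤ d) (hlam : 0 ≤ lam) (h1 : edgeProb d lam N ≤ 1)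
    {s : ℕ → ℝ} {t : ℕ} (ht : t ≤ N) {σ : ℝ} (hσ : 100 * momentBound d lam * σ ≤ 1)
    (hs : ∀ i < t, |s i| ≤ σ) :
    ∫ G, Real.exp (linStat d lam N k s t G) ∂(hypergraphLaw d lam N) ≤
      Real.exp (2 * momentBound d lam * σ ^ 2 * N) := by
  have hK := one_le_momentBound (d := d) hlam
  set K := momentBound d lam with hKdef
  have hs' : ∀ i < t, 100 * K * |s i| ≤ 1 := fun i hi =>
    (mul_le_mul_of_nonneg_left (hs i hi) (by linarith)).trans hσ
  have hb : ∀ G : Set (Finset (Fin N)), quadStat d lam N k s t G ≤ K * σ ^ 2 * N := by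
    intro G
    refine (quadStat_le hd hlam h1 s ht G).trans ?_
    have : ∑ i ∈ Finset.range t, K * s i ^ 2 ≤ ∑ i ∈ Finset.range t, K * σ ^ 2 := by
      refine Finset.sum_le_sum fun i hi => ?_
      rw [← sq_abs (s i)]
      have := hs i (Finset.mem_range.1 hi)
      gcongr
    rw [Finset.sum_const, Finset.card_range, nsmul_eq_mul] at this
    have ht' : (t : ℝ) ≤ N := by exact_mod_cast ht
    have h0 : 0 ≤ K * σ ^ 2 := by positivity
    nlinarith
  have hc : ∑ i ∈ Finset.range t, 100 * K * |s i| ^ 3 ≤ K * σ ^ 2 * N := by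
    have : ∑ i ∈ Finset.range t, 100 * K * |s i| ^ 3 ≤ ∑ i ∈ Finset.range t, K * σ ^ 2 := by
      refine Finset.sum_le_sum fun i hi => ?_
      have hi := Finset.mem_range.1 hi
      have h2 : |s i| ^ 2 ≤ σ ^ 2 := by
        have := hs i hi
        gcongr
      have h3 := hs' i hi
      have h4 : 100 * K * |s i| ^ 3 = (100 * K * |s i|) * |s i| ^ 2 := by ring
      rw [h4]
      have h5 := mul_le_mul_of_nonneg_right h3 (sq_nonneg |s i|)
      nlinarith [sq_nonneg σ]
    rw [Finset.sum_const, Finset.card_range, nsmul_eq_mul] at this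
    have ht' : (t : ℝ) ≤ N := by exact_mod_cast ht
    have h0 : 0 ≤ K * σ ^ 2 := by positivity
    nlinarith
  have hch := (integral_chain_bounds (k := k) hd hlam h1 ht hs').2
  have hmono : ∫ G, Real.exp (linStat d lam N k s t G) ∂(hypergraphLaw d lam N) ≤
      ∫ G, Real.exp (K * σ ^ 2 * N) * Real.exp (linStat d lam N k s t G - quadStat d lam N k s t G)
        ∂(hypergraphLaw d lam N) := by
    refine integral_mono Integrable.of_finite Integrable.of_finite fun G => ?_
    simp only
    rw [← Real.exp_add]
    exact Real.exp_le_exp.2 (by linarith [hb G])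
  rw [integral_const_mul] at hmono
  refine hmono.trans ((mul_le_mul_of_nonneg_left hch (Real.exp_pos _).le).trans ?_)
  rw [← Real.exp_add]
  exact Real.exp_le_exp.2 (by linarith)

lemma linStat_const_mul (c : ℝ) (s : ℕ → ℝ) (t : ℕ) (G : Set (Finset (Fin N))) :
    linStat d lam N k (fun i => c * s i) t G = c * linStat d lam N k s t G := by
  rw [linStat, linStat, Finset.mul_sum]
  exact Finset.sum_congr rfl fun i _ => by ring

lemma measureReal_linStat_ge_le (hd : 2 ≤ d) (hlam : 0 ≤ lam) (h1 : edgeProb d lam N ≤ 1)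
    {s : ℕ → ℝ} {t : ℕ} (ht : t ≤ N) {B τ : ℝ} (hτ : 0 ≤ τ)
    (hσ : 100 * momentBound d lam * (τ * B) ≤ 1)
    (hs : ∀ i < t, |s i| ≤ B) (x : ℝ) :
    (hypergraphLaw d lam N).real {G | x ≤ |linStat d lam N k s t G|} ≤
      2 * Real.exp (-(τ * x) + 2 * momentBound d lam * (τ * B) ^ 2 * N) := by
  have hK := one_le_momentBound (d := d) hlam
  have hexp : ∀ c : ℝ, |c| = τ → ∫ G, Real.exp (c * linStat d lam N k s t G)
      ∂(hypergraphLaw d lam N) ≤ Real.exp (2 * momentBound d lam * (τ * B) ^ 2 * N) := by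
    intro c hc
    have := integral_exp_linStat_le (k := k) (s := fun i => c * s i) hd hlam h1 ht hσ
      (fun i hi => by rw [abs_mul, hc]; exact mul_le_mul_of_nonneg_left (hs i hi) hτ)
    simpa only [linStat_const_mul] using this
  have t1 := measure_ge_le_exp_mul_mgf (μ := hypergraphLaw d lam N)
    (X := fun G => linStat d lam N k s t G) x hτ Integrable.of_finite
  have t2 := measure_le_le_exp_mul_mgf (μ := hypergraphLaw d lam N)
    (X := fun G => linStat d lam N k s t G) (-x) (neg_nonpos.2 hτ) Integrable.of_finite
  have hsub : {G | x ≤ |linStat d lam N k s t G|} ⊆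
      {G | x ≤ linStat d lam N k s t G} ∪ {G | linStat d lam N k s t G ≤ -x} := by
    intro ω hω
    rcases le_abs.1 (show x ≤ |linStat d lam N k s t ω| from hω) with h | h
    · exact Or.inl h
    · exact Or.inr (show linStat d lam N k s t ω ≤ -x by linarith)
  have hu := (measureReal_mono hsub (measure_ne_top (hypergraphLaw d lam N) _)).trans
    (measureReal_union_le _ _)
  have b1 := t1.trans (mul_le_mul_of_nonneg_left (hexp τ (abs_of_nonneg hτ)) (Real.exp_pos _).le)
  have b2 := t2.trans (mul_le_mul_of_nonneg_left (hexp (-τ) (by rw [abs_neg, abs_of_nonneg hτ]))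
    (Real.exp_pos _).le)
  rw [← Real.exp_add] at b1 b2
  have e1 : -τ * x = -(τ * x) := by ring
  have e2 : - -τ * -x = -(τ * x) := by ring
  rw [e1] at b1
  rw [e2] at b2
  linarith

end Tails

/-! ### The coefficients α and β, and the conditional variances. -/

section Beta

variable {N d : ℕ} {lam : ℝ}

lemma betaCoeff_zero : betaCoeff d lam N 0 = 1 := by simp [betaCoeff]

lemma betaCoeff_succ (t : ℕ) :
    betaCoeff d lam N (t + 1) = betaCoeff d lam N t * (1 - alphaCoeff d lam N (t + 1)) := by
  rw [betaCoeff, betaCoeff, Finset.prod_Icc_succ_top (by omega)]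

/-- The partial sums of the coefficients `α_i`. -/
def alphaSum (d : ℕ) (lam : ℝ) (N t : ℕ) : ℝ :=
  ∑ i ∈ Finset.range t, alphaCoeff d lam N (i + 1)

lemma alphaSum_succ (t : ℕ) :
    alphaSum d lam N (t + 1) = alphaSum d lam N t + alphaCoeff d lam N (t + 1) :=
  Finset.sum_range_succ _ _

lemma alphaCoeff_le_quarter (hd : 2 ≤ d) (hlam : 0 ≤ lam) (hN : 0 < N) (hN4 : 4 * lam ≤ N) (t : ℕ) :
    alphaCoeff d lam N t ≤ 1 / 4 := by
  refine (alphaCoeff_le hd hlam hN t).trans ?_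
  have : (0 : ℝ) < N := by exact_mod_cast hN
  rw [div_le_iff₀ this]
  linarith

lemma betaCoeff_pos (hd : 2 ≤ d) (hlam : 0 ≤ lam) (hN : 0 < N) (hN4 : 4 * lam ≤ N) (t : ℕ) :
    0 < betaCoeff d lam N t :=
  Finset.prod_pos fun i _ => by linarith [alphaCoeff_le_quarter hd hlam hN hN4 i]

lemma betaCoeff_le_exp (hd : 2 ≤ d) (hlam : 0 ≤ lam) (hN : 0 < N) (hN4 : 4 * lam ≤ N) (t : ℕ) :
    betaCoeff d lam N t ≤ Real.exp (-alphaSum d lam N t) := by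
  induction t with
  | zero => simp [betaCoeff_zero, alphaSum]
  | succ t ih =>
    rw [betaCoeff_succ, alphaSum_succ, neg_add, Real.exp_add]
    refine mul_le_mul ih ?_ ?_ (Real.exp_pos _).le
    · linarith [Real.add_one_le_exp (-alphaCoeff d lam N (t + 1))]
    · linarith [alphaCoeff_le_quarter hd hlam hN hN4 (t + 1)]

lemma exp_le_betaCoeff (hd : 2 ≤ d) (hlam : 0 ≤ lam) (hN : 0 < N) (hN4 : 4 * lam ≤ N) (t : ℕ) :
    Real.exp (-alphaSum d lam N t - 4 * t * (lam / N) ^ 2) ≤ betaCoeff d lam N t := by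
  induction t with
  | zero => simp [betaCoeff_zero, alphaSum]
  | succ t ih =>
    have h0 := alphaCoeff_nonneg (d := d) (N := N) hlam (t + 1)
    have h1 := alphaCoeff_le_quarter hd hlam hN hN4 (t + 1)
    have h2 := alphaCoeff_le hd hlam hN (t + 1)
    have h3 := exp_sub_four_mul_sq_le (y := -alphaCoeff d lam N (t + 1))
      (by rw [abs_neg, abs_of_nonneg h0]; exact h1)
    have h4 : alphaCoeff d lam N (t + 1) ^ 2 ≤ (lam / N) ^ 2 := by gcongr
    have e : -alphaSum d lam N (t + 1) - 4 * ((t + 1 : ℕ) : ℝ) * (lam / N) ^ 2 =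
        (-alphaSum d lam N t - 4 * t * (lam / N) ^ 2) +
          (-alphaCoeff d lam N (t + 1) - 4 * (lam / N) ^ 2) := by
      rw [alphaSum_succ]; push_cast; ring
    rw [betaCoeff_succ, e, Real.exp_add]
    refine mul_le_mul ih ?_ (Real.exp_pos _).le (betaCoeff_pos hd hlam hN hN4 t).le
    refine (Real.exp_le_exp.2 ?_).trans (h3.trans_eq (by ring))
    linarith

lemma alphaSum_nonneg (hlam : 0 ≤ lam) (t : ℕ) : 0 ≤ alphaSum d lam N t :=
  Finset.sum_nonneg fun _ _ => alphaCoeff_nonneg hlam _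

lemma alphaSum_le (hd : 2 ≤ d) (hlam : 0 ≤ lam) (hN : 0 < N) {t : ℕ} (ht : t ≤ N) :
    alphaSum d lam N t ≤ lam := by
  have h1 : alphaSum d lam N t ≤ ∑ i ∈ Finset.range t, lam / N :=
    Finset.sum_le_sum fun i _ => alphaCoeff_le hd hlam hN (i + 1)
  rw [Finset.sum_const, Finset.card_range, nsmul_eq_mul] at h1
  have hN' : (0 : ℝ) < N := by exact_mod_cast hN
  have ht' : (t : ℝ) ≤ N := by exact_mod_cast ht
  refine h1.trans ?_
  calc (t : ℝ) * (lam / N) ≤ N * (lam / N) := by gcongr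
    _ = lam := by field_simp

lemma betaCoeff_le_one (hd : 2 ≤ d) (hlam : 0 ≤ lam) (hN : 0 < N) (hN4 : 4 * lam ≤ N) (t : ℕ) :
    betaCoeff d lam N t ≤ 1 :=
  (betaCoeff_le_exp hd hlam hN hN4 t).trans
    (Real.exp_le_one_iff.2 (neg_nonpos.2 (alphaSum_nonneg hlam t)))

/-- A uniform bound for the inverses of the coefficients `β_t`. -/
def betaInvBound (lam : ℝ) : ℝ := Real.exp (2 * lam)

lemma one_le_betaInvBound (hlam : 0 ≤ lam) : 1 ≤ betaInvBound lam :=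
  Real.one_le_exp (by linarith)

/-- One `lam` in the exponent bounds the sum of the `α_i`, the other the quadratic correction
`4t(lam/N)² ≤ 4 lam²/N`, by `4 lam ≤ N`. -/
lemma inv_betaCoeff_le (hd : 2 ≤ d) (hlam : 0 ≤ lam) (hN : 0 < N) (hN4 : 4 * lam ≤ N) {t : ℕ}
    (ht : t ≤ N) : 1 / betaCoeff d lam N t ≤ betaInvBound lam := by
  have h1 := exp_le_betaCoeff hd hlam hN hN4 t
  have h2 := alphaSum_le hd hlam hN ht
  have hN' : (0 : ℝ) < N := by exact_mod_cast hN
  have ht' : (t : ℝ) ≤ N := by exact_mod_cast ht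
  have h3 : 4 * t * (lam / N) ^ 2 ≤ lam := by
    have : 4 * (t : ℝ) * (lam / N) ^ 2 ≤ 4 * N * (lam / N) ^ 2 := by gcongr
    have e : 4 * (N : ℝ) * (lam / N) ^ 2 = (4 * lam) * lam / N := by field_simp
    rw [e] at this
    refine this.trans ?_
    rw [div_le_iff₀ hN']
    nlinarith
  rw [one_div, betaInvBound, ← inv_inv (Real.exp (2 * lam)), ← Real.exp_neg]
  exact inv_anti₀ (Real.exp_pos _) ((Real.exp_le_exp.2 (by linarith)).trans h1)

lemma sum_alpha_div_beta (hd : 2 ≤ d) (hlam : 0 ≤ lam) (hN : 0 < N) (hN4 : 4 * lam ≤ N) (T : ℕ) :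
    ∑ t ∈ Finset.range T, alphaCoeff d lam N (t + 1) / betaCoeff d lam N (t + 1) =
      1 / betaCoeff d lam N T - 1 := by
  have h : ∀ t, alphaCoeff d lam N (t + 1) / betaCoeff d lam N (t + 1) =
      1 / betaCoeff d lam N (t + 1) - 1 / betaCoeff d lam N t := by
    intro t
    have h1 := betaCoeff_pos hd hlam hN hN4 t
    have h2 := betaCoeff_pos hd hlam hN hN4 (t + 1)
    rw [betaCoeff_succ] at h2 ⊢
    have h3 : 1 - alphaCoeff d lam N (t + 1) ≠ 0 := by
      intro h; rw [h, mul_zero] at h2; exact h2.false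
    field_simp
    ring
  simp_rw [h]
  rw [Finset.sum_range_sub (fun t => 1 / betaCoeff d lam N t), betaCoeff_zero, div_one]

lemma one_sub_pow_bounds {p : ℝ} (h0 : 0 ≤ p) (h1 : p ≤ 1) (n : ℕ) (hn : p * n ≤ 1) :
    p * n - (p * n) ^ 2 ≤ 1 - (1 - p) ^ n ∧ 1 - (1 - p) ^ n ≤ p * n := by
  constructor
  · have h2 : (1 - p) ^ n ≤ Real.exp (-(p * n)) := by
      calc (1 - p) ^ n ≤ Real.exp (-p) ^ n :=
            pow_le_pow_left₀ (by linarith) (by linarith [Real.add_one_le_exp (-p)]) n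
        _ = _ := by rw [← Real.exp_nat_mul]; congr 1; ring
    have hnn : 0 ≤ p * n := by positivity
    have h3 := (abs_le.1 (Real.abs_exp_sub_one_sub_id_le (x := -(p * n))
      (by rw [abs_neg, abs_of_nonneg hnn]; exact hn))).2
    nlinarith
  · have := one_add_mul_le_pow (a := -p) (by linarith) n
    rw [← sub_eq_add_neg] at this
    linarith

/-- By Pascal's rule the difference is `p` times a binomial coefficient with lower index `d - 3`,
hence of order `N⁻²`; for `d = 2` it vanishes. -/
lemma alphaCoeff_sub_succ_bounds (hd : 2 ≤ d) (hlam : 0 ≤ lam) (hN : 0 < N) (t : ℕ) :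
    0 ≤ alphaCoeff d lam N t - alphaCoeff d lam N (t + 1) ∧
      alphaCoeff d lam N t - alphaCoeff d lam N (t + 1) ≤ lam * d / N ^ 2 := by
  have hp := edgeProb_nonneg (d := d) (N := N) hlam
  have hN' : (0 : ℝ) < N := by exact_mod_cast hN
  rw [alphaCoeff, alphaCoeff, ← mul_sub]
  constructor
  · refine mul_nonneg hp (sub_nonneg.2 ?_)
    exact_mod_cast Nat.choose_le_choose _ (by omega)
  · set M := N - t - 1 with hM
    have hM1 : N - (t + 1) - 1 = M - 1 := by omega
    rw [hM1]
    rcases Nat.eq_zero_or_pos M with h | h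
    · rw [h]; simp; positivity
    rcases Nat.lt_or_ge 2 d with h3 | h3
    · obtain ⟨d', rfl⟩ : ∃ d', d = d' + 3 := ⟨d - 3, by omega⟩
      obtain ⟨M', hM'⟩ : ∃ M', M = M' + 1 := ⟨M - 1, by omega⟩
      rw [hM', show d' + 3 - 2 = d' + 1 by omega, Nat.choose_succ_succ, Nat.add_sub_cancel]
      push_cast
      rw [add_sub_cancel_right]
      have h4 := choose_mul_factorial_le M' d'
      have h5 : (M' : ℝ) ^ d' ≤ (N : ℝ) ^ d' := by
        gcongr; omega
      have e1 : d' + 3 - 2 = d' + 1 := by omega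
      have e2 : d' + 3 - 1 = d' + 2 := by omega
      rw [edgeProb, e1, e2, Nat.factorial_succ, div_mul_eq_mul_div,
        div_le_div_iff₀ (by positivity) (by positivity)]
      push_cast
      have h6 : (M'.choose d' : ℝ) * d'.factorial ≤ (N : ℝ) ^ d' := h4.trans h5
      calc lam * ((d' + 1) * d'.factorial) * (M'.choose d' : ℝ) * (N : ℝ) ^ 2
          = lam * (d' + 1) * (N : ℝ) ^ 2 * ((M'.choose d' : ℝ) * d'.factorial) := by ring
        _ ≤ lam * (d' + 3) * (N : ℝ) ^ 2 * (N : ℝ) ^ d' := by gcongr; norm_num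
        _ = _ := by ring
    · have : d = 2 := by omega
      subst this
      simp
      positivity

lemma hitProb_bounds (hd : 2 ≤ d) (hlam : 0 ≤ lam) (h1 : edgeProb d lam N ≤ 1)
    (hN : 0 < N) (hN4 : 4 * lam ≤ N) (t : ℕ) :
    alphaCoeff d lam N t - alphaCoeff d lam N t ^ 2 ≤ hitProb d lam N t ∧
      hitProb d lam N t ≤ alphaCoeff d lam N t :=
  one_sub_pow_bounds (edgeProb_nonneg hlam) h1 _ (by
    have := alphaCoeff_le_quarter hd hlam hN hN4 t
    rw [alphaCoeff] at this
    linarith)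

lemma stepVariance_eq (hd : 2 ≤ d) (hlam : 0 ≤ lam) (h1 : edgeProb d lam N ≤ 1) {k t : ℕ}
    (ht : t < N) (G : Set (Finset (Fin N))) :
    stepVariance d lam N t (stateAt G k t) =
      (stateAt G k t).rest.card * (hitProb d lam N (t + 1) * (1 - hitProb d lam N (t + 1))) +
      (stateAt G k t).rest.card * ((stateAt G k t).rest.card - 1) *
        ((1 - hitProb d lam N (t + 1)) *
          (hitProb d lam N (t + 1) - hitProb d lam N (t + 2))) := by
  have h0 := edgeProb_nonneg (d := d) (N := N) hlam
  obtain ⟨v, hv⟩ := exists_next G k ht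
  have := State.variance_freshCount (p := Set.projIcc (0 : ℝ) 1 zero_le_one (edgeProb d lam N))
    hd hv ((isConsistent_stateAt G k t).next_notMem hv) (card_explored G k ht.le)
    (Q := 1 - hitProb d lam N (t + 1)) (by
      rw [coe_projIcc_edgeProb h0 h1, hitProb, show N - (t + 1) - 1 = N - t - 2 by omega]; ring)
  rw [coe_projIcc_edgeProb h0 h1] at this
  have e : (1 - edgeProb d lam N) ^ (N - t - 3).choose (d - 2) = 1 - hitProb d lam N (t + 2) := by
    rw [hitProb, show N - (t + 2) - 1 = N - t - 3 by omega]; ring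
  rw [e] at this
  rw [stepVariance, hypergraphLaw]
  have e2 : 1 - (1 - hitProb d lam N (t + 1)) = hitProb d lam N (t + 1) := by ring
  rw [e2] at this
  rw [this]
  ring

/-- The constant in the approximation of the conditional variances. -/
def varianceError (d : ℕ) (lam : ℝ) : ℝ :=
  2 * lam ^ 2 + lam * d + 2 * lam * (lam * d) + (lam * d) ^ 2

/-- The covariance is multiplied by about `N²` pairs, so it is needed up to `O(N⁻³)`. Comparing each
`q` with its `α` would only give `O(N⁻²)`. Instead `q - q' = (1 - q')(1 - (1 - p)^(K1 - K2))`, where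
`p (K1 - K2)` is exactly the difference `r` of the α's and is itself of order `N⁻²`; the relative
error is then `O(1/N)`. -/
lemma covariance_factor_bounds (hd : 2 ≤ d) (hlam : 0 ≤ lam) (h1 : edgeProb d lam N ≤ 1)
    (hN : 0 < N) (hN4 : 4 * lam ≤ N) (hNd : lam * d ≤ N) (t : ℕ) :
    |(1 - hitProb d lam N (t + 1)) * (hitProb d lam N (t + 1) - hitProb d lam N (t + 2)) -
        (alphaCoeff d lam N (t + 1) - alphaCoeff d lam N (t + 2))| ≤
      (2 * lam * (lam * d) + (lam * d) ^ 2) / N ^ 3 ∧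
    0 ≤ (1 - hitProb d lam N (t + 1)) * (hitProb d lam N (t + 1) - hitProb d lam N (t + 2)) ∧
    (1 - hitProb d lam N (t + 1)) * (hitProb d lam N (t + 1) - hitProb d lam N (t + 2)) ≤
      lam * d / N ^ 2 := by
  have h0 := edgeProb_nonneg (d := d) (N := N) hlam
  have hN' : (0 : ℝ) < N := by exact_mod_cast hN
  have hN1 : (1 : ℝ) ≤ N := by exact_mod_cast hN
  obtain ⟨r0, r1⟩ := alphaCoeff_sub_succ_bounds (N := N) hd hlam hN (t + 1)
  set r := alphaCoeff d lam N (t + 1) - alphaCoeff d lam N (t + 1 + 1) with hr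
  have hq1 := hitProb_bounds hd hlam h1 hN hN4 (t + 1)
  have hq2 := hitProb_bounds hd hlam h1 hN hN4 (t + 2)
  have ha1 := alphaCoeff_le hd hlam hN (t + 1)
  have ha2 := alphaCoeff_le hd hlam hN (t + 2)
  have hb1 := hitProb_nonneg hlam h1 (d := d) (t + 1)
  have hb2 := hitProb_nonneg hlam h1 (d := d) (t + 2)
  have hc1 := alphaCoeff_le_quarter hd hlam hN hN4 (t + 1)
  have hc2 := alphaCoeff_le_quarter hd hlam hN hN4 (t + 2)
  set q := hitProb d lam N (t + 1)
  set q' := hitProb d lam N (t + 2)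
  set K1 := (N - (t + 1) - 1).choose (d - 2) with hK1
  set K2 := (N - (t + 2) - 1).choose (d - 2) with hK2
  have hK : K2 ≤ K1 := Nat.choose_le_choose _ (by omega)
  set p := edgeProb d lam N
  have er : r = p * ((K1 - K2 : ℕ) : ℝ) := by
    rw [Nat.cast_sub hK, hr, alphaCoeff, alphaCoeff]; ring
  have hrN : r ≤ lam * d / N ^ 2 := r1
  have hr1 : r ≤ 1 := by
    refine hrN.trans ?_
    rw [div_le_one (by positivity)]
    nlinarith
  have hg := one_sub_pow_bounds h0 h1 (K1 - K2) (by rw [← er]; exact hr1)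
  rw [← er] at hg
  set g := 1 - (1 - p) ^ (K1 - K2) with hgdef
  have hdiff : q - q' = (1 - q') * g := by
    have e1 : (1 - p) ^ K1 = (1 - p) ^ K2 * (1 - p) ^ (K1 - K2) := by
      rw [← pow_add]; congr 1; omega
    change (1 - (1 - p) ^ K1) - (1 - (1 - p) ^ K2) =
      (1 - (1 - (1 - p) ^ K2)) * (1 - (1 - p) ^ (K1 - K2))
    rw [e1]; ring
  have hg0 : 0 ≤ g := by
    have : (1 - p) ^ (K1 - K2) ≤ 1 := pow_le_one₀ (by linarith) (by linarith)
    linarith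
  have hq0 : 0 ≤ 1 - q := by linarith [hq1.2]
  have hq0' : 0 ≤ 1 - q' := by linarith [hq2.2]
  have hP1 : (1 - q) * (1 - q') ≤ 1 := by nlinarith
  have hP2 : 1 - 2 * (lam / N) ≤ (1 - q) * (1 - q') := by nlinarith [hq1.2, hq2.2]
  have hP0 : 0 ≤ (1 - q) * (1 - q') := mul_nonneg hq0 hq0'
  rw [hdiff]
  set P := (1 - q) * (1 - q')
  have eP : (1 - q) * ((1 - q') * g) = P * g := by ring
  rw [eP]
  have hPg : P * g ≤ r := (mul_le_of_le_one_left hg0 hP1).trans hg.2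
  refine ⟨?_, mul_nonneg hP0 hg0, hPg.trans hrN⟩
  rw [abs_of_nonpos (by linarith)]
  have h6 : (1 - P) * g ≤ 2 * (lam / N) * r := by
    refine mul_le_mul (by linarith) hg.2 hg0 (by positivity)
  have h7 : 2 * (lam / N) * r ≤ 2 * (lam / N) * (lam * d / N ^ 2) := by gcongr
  have h8 : r ^ 2 ≤ (lam * d / N ^ 2) ^ 2 := by gcongr
  have h9 : (lam * d / (N : ℝ) ^ 2) ^ 2 ≤ (lam * d) ^ 2 / N ^ 3 := by
    rw [div_pow]
    apply div_le_div_of_nonneg_left (by positivity) (by positivity)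
    rw [← pow_mul]
    exact pow_le_pow_right₀ hN1 (by norm_num)
  have e10 : 2 * (lam / N) * (lam * d / (N : ℝ) ^ 2) = 2 * lam * (lam * d) / N ^ 3 := by
    field_simp
  rw [add_div]
  nlinarith [hg.1]

lemma abs_stepVariance_sub_le (hd : 2 ≤ d) (hlam : 0 ≤ lam) (h1 : edgeProb d lam N ≤ 1)
    (hN4 : 4 * lam ≤ N) (hNd : lam * d ≤ N) {k t : ℕ} (ht : t < N) (G : Set (Finset (Fin N))) :
    |stepVariance d lam N t (stateAt G k t) -
      ((stateAt G k t).rest.card * alphaCoeff d lam N (t + 1) +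
        ((stateAt G k t).rest.card : ℝ) ^ 2 *
          (alphaCoeff d lam N (t + 1) - alphaCoeff d lam N (t + 2)))| ≤
      varianceError d lam / N := by
  have hN : 0 < N := by omega
  have hN' : (0 : ℝ) < N := by exact_mod_cast hN
  have hm : ((stateAt G k t).rest.card : ℝ) ≤ N := by exact_mod_cast card_rest_le _
  have hm0 : (0 : ℝ) ≤ (stateAt G k t).rest.card := Nat.cast_nonneg _
  obtain ⟨c1, c2, c3⟩ := covariance_factor_bounds hd hlam h1 hN hN4 hNd t
  have hq1 := hitProb_bounds hd hlam h1 hN hN4 (t + 1)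
  have ha0 := alphaCoeff_nonneg (d := d) (N := N) hlam (t + 1)
  have ha1 := alphaCoeff_le hd hlam hN (t + 1)
  have hb1 := hitProb_nonneg hlam h1 (d := d) (t + 1)
  rw [stepVariance_eq hd hlam h1 ht]
  set m := ((stateAt G k t).rest.card : ℝ)
  set q := hitProb d lam N (t + 1)
  set a := alphaCoeff d lam N (t + 1)
  set c := (1 - q) * (q - hitProb d lam N (t + 2))
  set r := a - alphaCoeff d lam N (t + 2)
  have e : m * (q * (1 - q)) + m * (m - 1) * c - (m * a + m ^ 2 * r) =
      m * (q * (1 - q) - a) + (m ^ 2 * (c - r) - m * c) := by ring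
  rw [e]
  have b1 : |m * (q * (1 - q) - a)| ≤ N * (2 * (lam / N) ^ 2) := by
    rw [abs_mul, abs_of_nonneg hm0]
    refine mul_le_mul hm ?_ (abs_nonneg _) hN'.le
    have h2 : a ^ 2 ≤ (lam / N) ^ 2 := by gcongr
    have h3 : q ^ 2 ≤ a ^ 2 := by have := hq1.2; gcongr
    rw [abs_le]
    constructor <;> nlinarith [hq1.1, hq1.2]
  have b2 : |m ^ 2 * (c - r)| ≤ N ^ 2 * ((2 * lam * (lam * d) + (lam * d) ^ 2) / N ^ 3) := by
    rw [abs_mul, abs_of_nonneg (sq_nonneg m)]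
    exact mul_le_mul (by gcongr) c1 (abs_nonneg _) (by positivity)
  have b3 : |m * c| ≤ N * (lam * d / N ^ 2) := by
    rw [abs_of_nonneg (mul_nonneg hm0 c2)]
    exact mul_le_mul hm c3 c2 hN'.le
  have e2 : varianceError d lam / N = N * (2 * (lam / N) ^ 2) +
      (N ^ 2 * ((2 * lam * (lam * d) + (lam * d) ^ 2) / N ^ 3) + N * (lam * d / N ^ 2)) := by
    rw [varianceError]
    field_simp
    ring
  rw [e2]
  exact (abs_add_le _ _).trans (add_le_add b1 ((abs_sub _ _).trans (add_le_add b2 b3)))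

end Beta

/-! ### The trajectory of the unseen vertices and the quadratic variation. -/

section Trajectory

variable {N k d : ℕ} {lam : ℝ}

/-- The exploration martingale in explicit form. -/
def explMart (d : ℕ) (lam : ℝ) (N k t : ℕ) (G : Set (Finset (Fin N))) : ℝ :=
  linStat d lam N k (fun i => 1 / betaCoeff d lam N (i + 1)) t G

/-- The weighted number of steps at which no vertex is active. -/
def idleSum (d : ℕ) (lam : ℝ) (N k t : ℕ) (G : Set (Finset (Fin N))) : ℝ :=
  ∑ i ∈ Finset.range t,
    (((stateAt G k i).unseen.card : ℝ) - (stateAt G k i).rest.card) / betaCoeff d lam N i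

/-- The total error from replacing `hitProb` by `alphaCoeff`. -/
def driftError (d : ℕ) (lam : ℝ) (N k t : ℕ) (G : Set (Finset (Fin N))) : ℝ :=
  ∑ i ∈ Finset.range t, (stateAt G k i).rest.card *
    (alphaCoeff d lam N (i + 1) - hitProb d lam N (i + 1)) / betaCoeff d lam N (i + 1)

/-- Decomposition of the number of unseen vertices. -/
lemma unseen_div_beta_eq (hd : 2 ≤ d) (hlam : 0 ≤ lam) (hN : 0 < N) (hN4 : 4 * lam ≤ N)
    (G : Set (Finset (Fin N))) {t : ℕ} (ht : t ≤ N) :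
    ((stateAt G k t).unseen.card : ℝ) / betaCoeff d lam N t =
      (stateAt G k 0).unseen.card - idleSum d lam N k t G + driftError d lam N k t G -
        explMart d lam N k t G := by
  induction t with
  | zero => simp [idleSum, driftError, explMart, linStat, betaCoeff_zero]
  | succ t ih =>
    have ih := ih (by omega)
    have h1 : ((stateAt G k (t + 1)).unseen.card : ℝ) + eta G k (t + 1) =
        (stateAt G k t).rest.card := by
      exact_mod_cast card_unseen_succ G k (t := t) (by omega)
    have hb := betaCoeff_pos hd hlam hN hN4 t
    have ha := alphaCoeff_le_quarter hd hlam hN hN4 (t + 1)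
    rw [idleSum, driftError, explMart, linStat, Finset.sum_range_succ, Finset.sum_range_succ,
      Finset.sum_range_succ]
    rw [idleSum, driftError, explMart, linStat] at ih
    -- Dividing by `β_{t+1} = β_t (1 - α_{t+1})` absorbs the mean loss of a proportion `α_{t+1}`.
    -- Left over are the vertex lost in an idle step, the error `α - q`, and the martingale
    -- increment.
    have h2 : ((stateAt G k (t + 1)).unseen.card : ℝ) / betaCoeff d lam N (t + 1) =
        ((stateAt G k t).unseen.card : ℝ) / betaCoeff d lam N t -
        (((stateAt G k t).unseen.card : ℝ) - (stateAt G k t).rest.card) / betaCoeff d lam N t +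
        (stateAt G k t).rest.card * (alphaCoeff d lam N (t + 1) - hitProb d lam N (t + 1)) /
          betaCoeff d lam N (t + 1) -
        1 / betaCoeff d lam N (t + 1) * centred d lam N k t G := by
      have h3 : ((stateAt G k (t + 1)).unseen.card : ℝ) =
        (stateAt G k t).rest.card - eta G k (t + 1) := by linarith
      rw [h3, centred, betaCoeff_succ]
      have h4 : 1 - alphaCoeff d lam N (t + 1) ≠ 0 := by linarith
      have h5 := hb.ne'
      field_simp
      ring
    rw [h2, ih]
    ring

/-- Here `0 ≤ α - q ≤ (lam / N)²`, summed over at most `N` steps with at most `N` vertices each. -/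
lemma driftError_bounds (hd : 2 ≤ d) (hlam : 0 ≤ lam) (h1 : edgeProb d lam N ≤ 1)
    (hN : 0 < N) (hN4 : 4 * lam ≤ N) (G : Set (Finset (Fin N))) {t : ℕ} (ht : t ≤ N) :
    0 ≤ driftError d lam N k t G ∧ driftError d lam N k t G ≤ lam ^ 2 * betaInvBound lam := by
  have hN' : (0 : ℝ) < N := by exact_mod_cast hN
  constructor
  · refine Finset.sum_nonneg fun i _ => div_nonneg (mul_nonneg (Nat.cast_nonneg _) ?_)
      (betaCoeff_pos hd hlam hN hN4 _).le
    exact sub_nonneg.2 (hitProb_le_alphaCoeff h1 _)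
  · have hterm : ∀ i ∈ Finset.range t, (stateAt G k i).rest.card *
        (alphaCoeff d lam N (i + 1) - hitProb d lam N (i + 1)) / betaCoeff d lam N (i + 1) ≤
        N * (lam / N) ^ 2 * betaInvBound lam := by
      intro i hi
      have hi := Finset.mem_range.1 hi
      rw [div_eq_mul_one_div]
      have hm : ((stateAt G k i).rest.card : ℝ) ≤ N := by exact_mod_cast card_rest_le _
      have ha0 := alphaCoeff_nonneg (d := d) (N := N) hlam (i + 1)
      have ha1 := alphaCoeff_le hd hlam hN (i + 1)
      have h2 : alphaCoeff d lam N (i + 1) ^ 2 ≤ (lam / N) ^ 2 := by gcongr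
      have h3 := hitProb_bounds hd hlam h1 hN hN4 (i + 1)
      have hb := betaCoeff_pos hd hlam hN hN4 (i + 1)
      refine mul_le_mul (mul_le_mul hm (by linarith) (by linarith) hN'.le)
        (inv_betaCoeff_le hd hlam hN hN4 (by omega)) (by positivity) (by positivity)
    refine (Finset.sum_le_sum hterm).trans ?_
    rw [Finset.sum_const, Finset.card_range, nsmul_eq_mul]
    have ht' : (t : ℝ) ≤ N := by exact_mod_cast ht
    have hB := one_le_betaInvBound hlam
    calc (t : ℝ) * (N * (lam / N) ^ 2 * betaInvBound lam)
        ≤ N * (N * (lam / N) ^ 2 * betaInvBound lam) := by gcongr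
      _ = _ := by field_simp

/-- Deviation allowed for the number of unseen vertices on the good event. -/
def unseenError (lam : ℝ) (N k : ℕ) (δ ω : ℝ) : ℝ :=
  k + 2 * (lam ^ 2 * betaInvBound lam) + 2 * δ * N + betaInvBound lam * ω * N +
    2 * betaInvBound lam

lemma card_unseen_sub_rest (G : Set (Finset (Fin N))) {t : ℕ} (ht : t < N) :
    ((stateAt G k t).unseen.card : ℝ) = (stateAt G k t).rest.card ∨
      ((stateAt G k t).unseen.card : ℝ) = (stateAt G k t).rest.card + 1 ∧
        ((stateAt G k t).unseen.card : ℝ) = N - t := by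
  by_cases ha : (stateAt G k t).active.Nonempty
  · left
    rw [card_rest_of_active G k ht ha]
  · right
    have h1 := card_rest_of_not_active G k ht ha
    have h2 := card_active_add G k ht.le
    rw [Finset.not_nonempty_iff_eq_empty.1 ha, Finset.card_empty, zero_add] at h2
    constructor
    · exact_mod_cast h1.symm
    · rw [eq_sub_iff_add_eq, add_comm]
      exact_mod_cast h2

/-- A reflection argument. The idle sum grows only at idle steps, and there the unseen count equals
`N - t`, so the decomposition can be solved for the idle sum accumulated so far. By `hβ` the
quotient `(N - t) / β_t` is at least `N` minus a small multiple of `N`, so this sum is small; one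
more idle step adds at most `betaInvBound lam`. -/
lemma idleSum_bounds (hd : 2 ≤ d) (hlam : 0 ≤ lam) (h1 : edgeProb d lam N ≤ 1)
    (hN : 0 < N) (hN4 : 4 * lam ≤ N) (G : Set (Finset (Fin N))) {T : ℕ} (hT : T ≤ N) {δ ω : ℝ}
    (hδ : 0 ≤ δ) (hω : 0 ≤ ω)
    (hS : ∀ t ≤ T, |explMart d lam N k t G| ≤ δ * N)
    (hβ : ∀ t ≤ T, N * betaCoeff d lam N t ≤ N - t + ω * N) {t : ℕ} (ht : t ≤ T) :
    0 ≤ idleSum d lam N k t G ∧ idleSum d lam N k t G ≤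
      lam ^ 2 * betaInvBound lam + δ * N + betaInvBound lam * ω * N + betaInvBound lam := by
  have hN' : (0 : ℝ) < N := by exact_mod_cast hN
  have hB := one_le_betaInvBound hlam
  induction t with
  | zero =>
    rw [idleSum, Finset.range_zero, Finset.sum_empty]
    exact ⟨le_rfl, by positivity⟩
  | succ t ih =>
    have ih := ih (by omega)
    have hb := betaCoeff_pos hd hlam hN hN4 t
    have hbi := inv_betaCoeff_le hd hlam hN hN4 (t := t) (by omega)
    have hsucc : idleSum d lam N k (t + 1) G = idleSum d lam N k t G +
        (((stateAt G k t).unseen.card : ℝ) - (stateAt G k t).rest.card) / betaCoeff d lam N t :=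
      Finset.sum_range_succ _ _
    rcases card_unseen_sub_rest G (k := k) (t := t) (by omega) with h | ⟨h, h'⟩
    · rw [hsucc, h, sub_self, zero_div, add_zero]
      exact ih
    · rw [hsucc, h, add_sub_cancel_left]
      refine ⟨add_nonneg ih.1 (by positivity), ?_⟩
      have hdec := unseen_div_beta_eq (k := k) hd hlam hN hN4 G (t := t) (by omega)
      rw [h'] at hdec
      have hdr := (driftError_bounds (k := k) hd hlam h1 hN hN4 G (t := t) (by omega)).2
      have hSt := (abs_le.1 (hS t (by omega))).1
      have hu0 : ((stateAt G k 0).unseen.card : ℝ) ≤ N := by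
        exact_mod_cast (Finset.card_le_univ _).trans_eq (Fintype.card_fin N)
      have hβt := hβ t (by omega)
      have h5 : (N : ℝ) - betaInvBound lam * ω * N ≤ ((N : ℝ) - t) / betaCoeff d lam N t := by
        rw [le_div_iff₀ hb]
        have h6 : 1 ≤ betaInvBound lam * betaCoeff d lam N t := by
          rwa [div_le_iff₀ hb] at hbi
        have h7 : ω * N * 1 ≤ ω * N * (betaInvBound lam * betaCoeff d lam N t) := by gcongr
        nlinarith
      linarith

/-- Every term of the decomposition apart from the initial count is now small, and multiplying back
by `β_t ≤ 1` does no harm. One `betaInvBound lam` is kept in reserve for the vertex by which rest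
and unseen may differ. -/
lemma abs_rest_sub_le (hd : 2 ≤ d) (hlam : 0 ≤ lam) (h1 : edgeProb d lam N ≤ 1)
    (hN : 0 < N) (hN4 : 4 * lam ≤ N) (G : Set (Finset (Fin N))) {T : ℕ} (hT : T ≤ N) {δ ω : ℝ}
    (hδ : 0 ≤ δ) (hω : 0 ≤ ω)
    (hS : ∀ t ≤ T, |explMart d lam N k t G| ≤ δ * N)
    (hβ : ∀ t ≤ T, N * betaCoeff d lam N t ≤ N - t + ω * N) {t : ℕ} (ht : t < T) :
    |((stateAt G k t).rest.card : ℝ) - N * betaCoeff d lam N t| ≤ unseenError lam N k δ ω := by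
  have hN' : (0 : ℝ) < N := by exact_mod_cast hN
  have hB := one_le_betaInvBound hlam
  have hb := betaCoeff_pos hd hlam hN hN4 t
  have hb1 := betaCoeff_le_one hd hlam hN hN4 t
  have hdec := unseen_div_beta_eq (k := k) hd hlam hN hN4 G (t := t) (by omega)
  have hdr := driftError_bounds (k := k) hd hlam h1 hN hN4 G (t := t) (by omega)
  have hidle := idleSum_bounds hd hlam h1 hN hN4 G hT hδ hω hS hβ ht.le
  have hSt := abs_le.1 (hS t ht.le)
  have hu0 : ((stateAt G k 0).unseen.card : ℝ) ≤ N := by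
    exact_mod_cast (Finset.card_le_univ _).trans_eq (Fintype.card_fin N)
  have hu1 : (N : ℝ) ≤ (stateAt G k 0).unseen.card + k := by
    exact_mod_cast card_unseen_zero G k
  have hk : (0 : ℝ) ≤ k := Nat.cast_nonneg _
  set u := ((stateAt G k t).unseen.card : ℝ) with hu
  have habs : |u / betaCoeff d lam N t - N| ≤
      unseenError lam N k δ ω - betaInvBound lam := by
    have hp1 : 0 ≤ betaInvBound lam * ω * N := by positivity
    have hp2 : 0 ≤ lam ^ 2 * betaInvBound lam := by positivity
    have hp3 : 0 ≤ δ * N := by positivity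
    rw [hdec, unseenError, abs_le]
    constructor <;> linarith
  have hu2 : |u - N * betaCoeff d lam N t| ≤ unseenError lam N k δ ω - betaInvBound lam := by
    have e : u - N * betaCoeff d lam N t = betaCoeff d lam N t * (u / betaCoeff d lam N t - N) := by
      field_simp
    rw [e, abs_mul, abs_of_pos hb]
    exact (mul_le_of_le_one_left (abs_nonneg _) hb1).trans habs
  rw [abs_le] at hu2 ⊢
  rcases card_unseen_sub_rest G (k := k) (t := t) (by omega) with h | ⟨h, _⟩
  · rw [← h, ← hu]
    constructor <;> linarith
  · rw [← hu] at h
    constructor <;> linarith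

/-- The finite-`N` version of the limiting variance. -/
def discreteVariance (d : ℕ) (lam : ℝ) (N T : ℕ) : ℝ :=
  betaCoeff d lam N T * (1 - betaCoeff d lam N T) + betaCoeff d lam N T ^ 2 *
    (N * alphaCoeff d lam N 1 - N * alphaCoeff d lam N (T + 1))

/-- The weighted sum of the conditional variances. -/
def varianceSum (d : ℕ) (lam : ℝ) (N k T : ℕ) (G : Set (Finset (Fin N))) : ℝ :=
  ∑ t ∈ Finset.range T, (betaCoeff d lam N T / betaCoeff d lam N (t + 1)) ^ 2 *
    stepVariance d lam N t (stateAt G k t)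

/-- After inserting `m = N β_{t+1}` the weights leave `α_{t+1} / β_{t+1} = 1/β_{t+1} - 1/β_t` and
`α_{t+1} - α_{t+2}`; both telescope. -/
lemma sum_leading_variance (hd : 2 ≤ d) (hlam : 0 ≤ lam) (hN : 0 < N) (hN4 : 4 * lam ≤ N) (T : ℕ) :
    ∑ t ∈ Finset.range T, (betaCoeff d lam N T / betaCoeff d lam N (t + 1)) ^ 2 *
      (N * betaCoeff d lam N (t + 1) * alphaCoeff d lam N (t + 1) +
        (N * betaCoeff d lam N (t + 1)) ^ 2 *
          (alphaCoeff d lam N (t + 1) - alphaCoeff d lam N (t + 2))) =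
      N * discreteVariance d lam N T := by
  have e : ∀ t ∈ Finset.range T, (betaCoeff d lam N T / betaCoeff d lam N (t + 1)) ^ 2 *
      (N * betaCoeff d lam N (t + 1) * alphaCoeff d lam N (t + 1) +
        (N * betaCoeff d lam N (t + 1)) ^ 2 *
          (alphaCoeff d lam N (t + 1) - alphaCoeff d lam N (t + 2))) =
      betaCoeff d lam N T ^ 2 * N *
        (alphaCoeff d lam N (t + 1) / betaCoeff d lam N (t + 1)) +
      betaCoeff d lam N T ^ 2 * N ^ 2 *
        (alphaCoeff d lam N (t + 1) - alphaCoeff d lam N (t + 1 + 1)) := by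
    intro t _
    have := (betaCoeff_pos hd hlam hN hN4 (t + 1)).ne'
    field_simp
  rw [Finset.sum_congr rfl e, Finset.sum_add_distrib, ← Finset.mul_sum, ← Finset.mul_sum,
    sum_alpha_div_beta hd hlam hN hN4,
    Finset.sum_range_sub' (fun t => alphaCoeff d lam N (t + 1)), discreteVariance]
  have := (betaCoeff_pos hd hlam hN hN4 T).ne'
  field_simp

lemma betaCoeff_antitone (hd : 2 ≤ d) (hlam : 0 ≤ lam) (hN : 0 < N) (hN4 : 4 * lam ≤ N) :
    Antitone (betaCoeff d lam N) :=
  antitone_nat_of_succ_le fun t => by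
    rw [betaCoeff_succ]
    exact mul_le_of_le_one_right (betaCoeff_pos hd hlam hN hN4 t).le
      (by linarith [alphaCoeff_nonneg (d := d) (N := N) hlam (t + 1)])

/-- On the good event the predictable quadratic variation is close to its limit. -/
lemma abs_varianceSum_sub_le (hd : 2 ≤ d) (hlam : 0 ≤ lam) (h1 : edgeProb d lam N ≤ 1)
    (hN : 0 < N) (hN4 : 4 * lam ≤ N) (hNd : lam * d ≤ N) (G : Set (Finset (Fin N))) {T : ℕ}
    (hT : T ≤ N) {δ ω : ℝ} (hδ : 0 ≤ δ) (hω : 0 ≤ ω)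
    (hS : ∀ t ≤ T, |explMart d lam N k t G| ≤ δ * N)
    (hβ : ∀ t ≤ T, N * betaCoeff d lam N t ≤ N - t + ω * N) :
    |varianceSum d lam N k T G - N * discreteVariance d lam N T| ≤
      varianceError d lam + (unseenError lam N k δ ω + lam) * (lam + 2 * (lam * d)) := by
  have hN' : (0 : ℝ) < N := by exact_mod_cast hN
  have hE0 : 0 ≤ unseenError lam N k δ ω := by
    have hB := one_le_betaInvBound hlam
    unfold unseenError; positivity
  have hterm : ∀ t ∈ Finset.range T,
      |(betaCoeff d lam N T / betaCoeff d lam N (t + 1)) ^ 2 *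
        stepVariance d lam N t (stateAt G k t) -
      (betaCoeff d lam N T / betaCoeff d lam N (t + 1)) ^ 2 *
      (N * betaCoeff d lam N (t + 1) * alphaCoeff d lam N (t + 1) +
        (N * betaCoeff d lam N (t + 1)) ^ 2 *
          (alphaCoeff d lam N (t + 1) - alphaCoeff d lam N (t + 2)))| ≤
      (varianceError d lam + (unseenError lam N k δ ω + lam) * (lam + 2 * (lam * d))) / N := by
    intro t ht
    have ht := Finset.mem_range.1 ht
    have hb := betaCoeff_pos hd hlam hN hN4 t
    have hb' := betaCoeff_pos hd hlam hN hN4 (t + 1)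
    have hbT := betaCoeff_pos hd hlam hN hN4 T
    have hb1 := betaCoeff_le_one hd hlam hN hN4 t
    have hb1' := betaCoeff_le_one hd hlam hN hN4 (t + 1)
    have hanti := betaCoeff_antitone hd hlam hN hN4 (show t + 1 ≤ T from ht)
    have hratio : (betaCoeff d lam N T / betaCoeff d lam N (t + 1)) ^ 2 ≤ 1 :=
      pow_le_one₀ (by positivity) ((div_le_one hb').2 hanti)
    have hV := abs_stepVariance_sub_le hd hlam h1 hN4 hNd (k := k) (t := t) (by omega) G
    have hm := abs_rest_sub_le hd hlam h1 hN hN4 G hT hδ hω hS hβ ht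
    have hmN : ((stateAt G k t).rest.card : ℝ) ≤ N := by exact_mod_cast card_rest_le _
    have hm0 : (0 : ℝ) ≤ (stateAt G k t).rest.card := Nat.cast_nonneg _
    have ha0 := alphaCoeff_nonneg (d := d) (N := N) hlam (t + 1)
    have ha1 := alphaCoeff_le hd hlam hN (t + 1)
    obtain ⟨r0, r1⟩ := alphaCoeff_sub_succ_bounds (N := N) hd hlam hN (t + 1)
    have hbs : betaCoeff d lam N t - betaCoeff d lam N (t + 1) ≤ lam / N := by
      rw [betaCoeff_succ]
      nlinarith
    have hbs0 : 0 ≤ betaCoeff d lam N t - betaCoeff d lam N (t + 1) := by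
      rw [betaCoeff_succ]
      nlinarith
    set m := ((stateAt G k t).rest.card : ℝ)
    set a := alphaCoeff d lam N (t + 1)
    set r := a - alphaCoeff d lam N (t + 2) with hr
    change 0 ≤ r at r0
    change r ≤ _ at r1
    set b := betaCoeff d lam N (t + 1)
    have hNl : N * (lam / N) = lam := by field_simp
    -- The trajectory is close to `N β_t`, whereas the telescoping needs `β_{t+1}`; the shift costs
    -- at most `N · lam / N = lam`.
    have hmb : |m - N * b| ≤ unseenError lam N k δ ω + lam := by
      have h2 : N * (betaCoeff d lam N t - b) ≤ lam := by
        calc N * (betaCoeff d lam N t - b) ≤ N * (lam / N) := by gcongr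
          _ = lam := hNl
      have h3 : 0 ≤ N * (betaCoeff d lam N t - b) := by positivity
      rw [abs_le] at hm ⊢
      constructor <;> linarith
    have hdiff : |m * a + m ^ 2 * r - (N * b * a + (N * b) ^ 2 * r)| ≤
        (unseenError lam N k δ ω + lam) * ((lam + 2 * (lam * d)) / N) := by
      have e : m * a + m ^ 2 * r - (N * b * a + (N * b) ^ 2 * r) =
          (m - N * b) * (a + (m + N * b) * r) := by ring
      have hNb : N * b ≤ N := mul_le_of_le_one_right hN'.le hb1'
      have hNb0 : 0 ≤ N * b := by positivity
      have h2 : (m + N * b) * r ≤ (2 * N) * (lam * d / N ^ 2) :=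
        mul_le_mul (by linarith) r1 r0 (by positivity)
      have e2 : (2 * N) * (lam * d / (N : ℝ) ^ 2) = 2 * (lam * d) / N := by field_simp
      rw [e, abs_mul]
      refine mul_le_mul hmb ?_ (abs_nonneg _) (by positivity)
      rw [abs_of_nonneg (by positivity), add_div]
      linarith
    rw [← mul_sub, abs_mul, abs_of_nonneg (sq_nonneg _)]
    refine (mul_le_of_le_one_left (abs_nonneg _) hratio).trans ?_
    have e3 : stepVariance d lam N t (stateAt G k t) - (N * b * a + (N * b) ^ 2 * r) =
        (stepVariance d lam N t (stateAt G k t) - (m * a + m ^ 2 * r)) +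
        (m * a + m ^ 2 * r - (N * b * a + (N * b) ^ 2 * r)) := by ring
    rw [e3, add_div, mul_div_assoc]
    exact (abs_add_le _ _).trans (add_le_add hV hdiff)
  rw [← sum_leading_variance hd hlam hN hN4, varianceSum, ← Finset.sum_sub_distrib]
  refine (Finset.abs_sum_le_sum_abs _ _).trans ((Finset.sum_le_sum hterm).trans ?_)
  rw [Finset.sum_const, Finset.card_range, nsmul_eq_mul]
  have hT' : (T : ℝ) ≤ N := by exact_mod_cast hT
  have hC : 0 ≤ varianceError d lam +
      (unseenError lam N k δ ω + lam) * (lam + 2 * (lam * d)) := by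
    unfold varianceError; positivity
  rw [← mul_div_assoc, div_le_iff₀ hN']
  nlinarith

end Trajectory

/-! ### Limit curve of β and the survival probability. -/

section Asymptotics

variable {N d : ℕ} {lam : ℝ}

lemma pow_sub_pow_le_mul {a b : ℝ} (hb : 0 ≤ b) (hab : b ≤ a) (ha : a ≤ 1) (m : ℕ) :
    a ^ m - b ^ m ≤ m * (a - b) := by
  induction m with
  | zero => simp
  | succ m ih =>
    have h1 : a ^ m ≤ 1 := pow_le_one₀ (hb.trans hab) ha
    have h2 : b ^ m ≤ a ^ m := pow_le_pow_left₀ hb hab m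
    have e : a ^ (m + 1) - b ^ (m + 1) = a ^ m * (a - b) + b * (a ^ m - b ^ m) := by ring
    rw [e]
    push_cast
    nlinarith

/-- The falling factorial lies between `(n + 1 - m)^m` and `n^m`. -/
lemma abs_choose_sub_pow_le (hN : 0 < N) {n : ℕ} (hn : n ≤ N) (m : ℕ) :
    |(n.choose m : ℝ) * m.factorial / (N : ℝ) ^ m - ((n : ℝ) / N) ^ m| ≤ (m : ℝ) ^ 2 / N := by
  have hN' : (0 : ℝ) < N := by exact_mod_cast hN
  have h1 := choose_mul_factorial_le n m
  have h2 : ((n + 1 - m : ℕ) : ℝ) ^ m ≤ n.choose m * m.factorial := by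
    have := Nat.pow_sub_le_descFactorial n m
    rw [Nat.descFactorial_eq_factorial_mul_choose, mul_comm] at this
    exact_mod_cast this
  rcases Nat.eq_zero_or_pos m with rfl | hm
  · simp
  have h3 : (n : ℝ) - (n + 1 - m : ℕ) ≤ m := by
    have : n ≤ (n + 1 - m) + m := by omega
    have : (n : ℝ) ≤ (n + 1 - m : ℕ) + m := by exact_mod_cast this
    linarith
  have h4 : ((n + 1 - m : ℕ) : ℝ) ≤ n := by
    exact_mod_cast (by omega : n + 1 - m ≤ n)
  have hnN : (n : ℝ) ≤ N := by exact_mod_cast hn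
  have h5 := pow_sub_pow_le_mul (a := (n : ℝ) / N) (b := ((n + 1 - m : ℕ) : ℝ) / N)
    (by positivity) (by gcongr) ((div_le_one hN').2 hnN) m
  have h6 : (m : ℝ) * ((n : ℝ) / N - ((n + 1 - m : ℕ) : ℝ) / N) ≤ (m : ℝ) ^ 2 / N := by
    rw [← sub_div, ← mul_div_assoc, sq]
    gcongr
  have h7 : (((n + 1 - m : ℕ) : ℝ) / N) ^ m ≤ (n.choose m : ℝ) * m.factorial / (N : ℝ) ^ m := by
    rw [div_pow]; gcongr
  have h8 : (n.choose m : ℝ) * m.factorial / (N : ℝ) ^ m ≤ ((n : ℝ) / N) ^ m := by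
    rw [div_pow]; gcongr
  rw [abs_of_nonpos (by linarith)]
  linarith

lemma abs_choose_sub_pow_le' (hN : 0 < N) {t : ℕ} (ht : t < N) (m : ℕ) :
    |((N - t - 1).choose m : ℝ) * m.factorial / (N : ℝ) ^ m - (1 - (t : ℝ) / N) ^ m| ≤
      ((m : ℝ) ^ 2 + m) / N := by
  have hN' : (0 : ℝ) < N := by exact_mod_cast hN
  have h1 := abs_choose_sub_pow_le hN (n := N - t - 1) (by omega) m
  have hc : ((N - t - 1 : ℕ) : ℝ) = N - t - 1 := by
    rw [Nat.sub_sub, Nat.cast_sub (by omega)]; push_cast; ring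
  have ht' : (t : ℝ) + 1 ≤ N := by exact_mod_cast ht
  have e : (1 - (t : ℝ) / N) = (N - t) / N := by field_simp
  have ht0 : (0 : ℝ) ≤ t := Nat.cast_nonneg t
  rw [hc] at h1
  have hle : ((N : ℝ) - t - 1) / N ≤ (N - t) / N := by
    apply div_le_div_of_nonneg_right _ hN'.le
    linarith
  have hnn : 0 ≤ ((N : ℝ) - t - 1) / N := div_nonneg (by linarith) hN'.le
  have h2 := pow_sub_pow_le_mul (a := ((N : ℝ) - t) / N) (b := ((N : ℝ) - t - 1) / N)
    hnn hle ((div_le_one hN').2 (by linarith)) m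
  have h3 : (m : ℝ) * (((N : ℝ) - t) / N - ((N : ℝ) - t - 1) / N) = m / N := by
    field_simp; ring
  have h4 := pow_le_pow_left₀ hnn hle m
  rw [h3] at h2
  rw [e, add_div]
  rw [abs_le] at h1 ⊢
  have : 0 ≤ (m : ℝ) / N := by positivity
  constructor <;> linarith

/-- The limit of `∑_{i ≤ sN} α_i`. -/
def cumRate (d : ℕ) (lam s : ℝ) : ℝ := lam / ((d : ℝ) - 1) * (1 - (1 - s) ^ (d - 1))

lemma edgeProb_mul_choose_eq (hd : 2 ≤ d) (hN : 0 < N) (n : ℕ) :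
    edgeProb d lam N * (n.choose (d - 1) : ℝ) =
      lam / ((d : ℝ) - 1) * ((n.choose (d - 1) : ℝ) * (d - 1).factorial / (N : ℝ) ^ (d - 1)) := by
  obtain ⟨e, rfl⟩ : ∃ e, d = e + 2 := ⟨d - 2, by omega⟩
  have hN' : (N : ℝ) ≠ 0 := by positivity
  have h2 : ((e : ℝ) + 1) ≠ 0 := by positivity
  rw [edgeProb, show e + 2 - 2 = e by omega, show e + 2 - 1 = e + 1 by omega, Nat.factorial_succ]
  push_cast
  have h3 : (e : ℝ) + 2 - 1 = e + 1 := by ring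
  rw [h3]
  field_simp

/-- The hockey-stick identity: Pascal's rule makes the sum telescope. -/
lemma alphaSum_eq (hd : 2 ≤ d) {t : ℕ} (ht : t < N) :
    alphaSum d lam N t = edgeProb d lam N * ((N - 1).choose (d - 1) : ℝ) -
      edgeProb d lam N * ((N - t - 1).choose (d - 1) : ℝ) := by
  induction t with
  | zero => simp [alphaSum]
  | succ t ih =>
    rw [alphaSum_succ, ih (by omega), alphaCoeff]
    have h : (N - t - 1).choose (d - 1) =
        (N - (t + 1) - 1).choose (d - 2) + (N - (t + 1) - 1).choose (d - 1) := by
      have e1 : N - t - 1 = (N - (t + 1) - 1) + 1 := by omega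
      have e2 : d - 1 = (d - 2) + 1 := by omega
      rw [e1, e2, Nat.choose_succ_succ]
    rw [h]
    push_cast
    ring

lemma abs_alphaSum_sub_cumRate_le (hd : 2 ≤ d) (hlam : 0 ≤ lam) {t : ℕ} (ht : t < N) :
    |alphaSum d lam N t - cumRate d lam ((t : ℝ) / N)| ≤ 2 * lam * d / N := by
  have hN : 0 < N := by omega
  have hN' : (0 : ℝ) < N := by exact_mod_cast hN
  have h1 := abs_choose_sub_pow_le' hN hN (d - 1)
  have h2 := abs_choose_sub_pow_le' hN ht (d - 1)
  rw [alphaSum_eq hd ht, edgeProb_mul_choose_eq hd hN, edgeProb_mul_choose_eq hd hN, cumRate]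
  have hd1 : ((d - 1 : ℕ) : ℝ) = (d : ℝ) - 1 := by rw [Nat.cast_sub (by omega)]; simp
  have hd2 : (2 : ℝ) ≤ d := by exact_mod_cast hd
  rw [hd1] at h1 h2
  simp only [Nat.cast_zero, zero_div, sub_zero, one_pow, Nat.sub_zero] at h1
  set A := ((N - 1).choose (d - 1) : ℝ) * (d - 1).factorial / (N : ℝ) ^ (d - 1)
  set B := ((N - t - 1).choose (d - 1) : ℝ) * (d - 1).factorial / (N : ℝ) ^ (d - 1)
  have e : lam / ((d : ℝ) - 1) * A - lam / ((d : ℝ) - 1) * B -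
      lam / ((d : ℝ) - 1) * (1 - (1 - (t : ℝ) / N) ^ (d - 1)) =
      lam / ((d : ℝ) - 1) * ((A - 1) - (B - (1 - (t : ℝ) / N) ^ (d - 1))) := by ring
  have hc : 0 ≤ lam / ((d : ℝ) - 1) := div_nonneg hlam (by linarith)
  rw [e, abs_mul, abs_of_nonneg hc]
  have h3 : |(A - 1) - (B - (1 - (t : ℝ) / N) ^ (d - 1))| ≤
      2 * ((((d : ℝ) - 1) ^ 2 + (d - 1)) / N) := by
    refine (abs_sub _ _).trans ?_
    linarith
  refine (mul_le_mul_of_nonneg_left h3 hc).trans_eq ?_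
  have : (d : ℝ) - 1 ≠ 0 := by linarith
  field_simp
  ring

lemma abs_mul_alphaCoeff_sub_le (hd : 2 ≤ d) (hlam : 0 ≤ lam) {t : ℕ} (ht : t < N) :
    |N * alphaCoeff d lam N t - lam * (1 - (t : ℝ) / N) ^ (d - 2)| ≤
      lam * (((d - 2 : ℕ) : ℝ) ^ 2 + ((d - 2 : ℕ) : ℝ)) / N := by
  have hN : 0 < N := by omega
  have hN' : (0 : ℝ) < N := by exact_mod_cast hN
  have h2 := abs_choose_sub_pow_le' hN ht (d - 2)
  have e : N * alphaCoeff d lam N t - lam * (1 - (t : ℝ) / N) ^ (d - 2) =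
      lam * (((N - t - 1).choose (d - 2) : ℝ) * (d - 2).factorial / (N : ℝ) ^ (d - 2) -
        (1 - (t : ℝ) / N) ^ (d - 2)) := by
    rw [alphaCoeff, edgeProb]
    have e1 : (N : ℝ) ^ (d - 1) = (N : ℝ) ^ (d - 2) * N := by
      rw [← pow_succ]; congr 1; omega
    rw [e1]
    field_simp
  rw [e, abs_mul, abs_of_nonneg hlam]
  exact (mul_le_mul_of_nonneg_left h2 hlam).trans_eq (by ring)

/-! ### The survival probability -/

lemma exists_rho_pos (hlam : 1 < lam) :
    ∃ x, 0 < x ∧ x ≤ 1 ∧ 1 - x = Real.exp (-(lam * x)) := by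
  -- From `exp (-y) ≤ 1 / (1 + y)`, positive `x` with `x ≤ 1 - 1 / lam` satisfy `exp (-lam x) ≤ 1 -
  -- x`; half that value serves as the left end for the intermediate value theorem.
  set x₀ := (1 - 1 / lam) / 2 with hx₀
  have hl : 1 / lam < 1 := by rw [div_lt_one (by linarith)]; exact hlam
  have hl0 : 0 < 1 / lam := by positivity
  have h0 : 0 < x₀ := by rw [hx₀]; linarith
  have h1 : x₀ < 1 := by rw [hx₀]; linarith
  set f : ℝ → ℝ := fun x => 1 - x - Real.exp (-(lam * x)) with hf
  have hfc : Continuous f := by fun_prop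
  have hfx : 0 ≤ f x₀ := by
    have h2 := Real.add_one_le_exp (lam * x₀)
    have h3 : Real.exp (-(lam * x₀)) ≤ 1 / (lam * x₀ + 1) := by
      rw [Real.exp_neg, ← one_div]
      exact one_div_le_one_div_of_le (by positivity) h2
    have h4 : 1 / (lam * x₀ + 1) ≤ 1 - x₀ := by
      rw [div_le_iff₀ (by positivity)]
      have h5 : lam * x₀ = (lam - 1) / 2 := by rw [hx₀]; field_simp
      have h6 : lam * (lam * x₀) = lam * (lam - 1) / 2 := by rw [h5]; ring
      nlinarith
    simp only [hf]
    linarith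
  have hf1 : f 1 ≤ 0 := by
    simp only [hf]
    linarith [Real.exp_pos (-(lam * 1))]
  obtain ⟨x, hx, hx'⟩ := intermediate_value_Icc' h1.le hfc.continuousOn ⟨hf1, hfx⟩
  refine ⟨x, lt_of_lt_of_le h0 hx.1, hx.2, ?_⟩
  simp only [hf] at hx'
  linarith

lemma rho_spec (hlam : 1 < lam) :
    0 < rho lam ∧ rho lam < 1 ∧ 1 - rho lam = Real.exp (-(lam * rho lam)) := by
  set S := {x : ℝ | 0 ≤ x ∧ x ≤ 1 ∧ 1 - x = Real.exp (-(lam * x))} with hS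
  have hc : IsCompact S := by
    have : S = Set.Icc 0 1 ∩ {x | 1 - x = Real.exp (-(lam * x))} := by
      ext x; simp [hS, and_assoc]
    rw [this]
    exact isCompact_Icc.inter_right (isClosed_eq (by fun_prop) (by fun_prop))
  obtain ⟨x, hx0, hx1, hx⟩ := exists_rho_pos hlam
  have hne : S.Nonempty := ⟨x, hx0.le, hx1, hx⟩
  have hm : rho lam ∈ S := hc.sSup_mem hne
  have hle : x ≤ rho lam := le_csSup hc.bddAbove ⟨hx0.le, hx1, hx⟩
  refine ⟨hx0.trans_le hle, ?_, hm.2.2⟩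
  have := Real.exp_pos (-(lam * rho lam))
  linarith [hm.2.2]

/-- The exponent is `-lam ρ / (d - 1)`, the logarithm of `(1 - ρ)^(1/(d-1))`. Thus `rhoBar` is a
time at which the limit curve of β meets the line `1 - s`. -/
lemma rhoBar_spec (hd : 2 ≤ d) (hlam : 1 < lam) :
    0 < rhoBar d lam ∧ rhoBar d lam < 1 ∧
      Real.exp (-cumRate d lam (rhoBar d lam)) = 1 - rhoBar d lam := by
  obtain ⟨h0, h1, h2⟩ := rho_spec hlam
  have hd2 : (2 : ℝ) ≤ d := by exact_mod_cast hd
  have hd1 : ((d - 1 : ℕ) : ℝ) = (d : ℝ) - 1 := by rw [Nat.cast_sub (by omega)]; simp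
  have e : 1 - rhoBar d lam = (1 - rho lam) ^ (1 / ((d : ℝ) - 1)) := by rw [rhoBar]; ring
  have hpos : 0 < (1 - rho lam) ^ (1 / ((d : ℝ) - 1)) := Real.rpow_pos_of_pos (by linarith) _
  have hlt : (1 - rho lam) ^ (1 / ((d : ℝ) - 1)) < 1 :=
    Real.rpow_lt_one (by linarith) (by linarith) (one_div_pos.2 (by linarith))
  refine ⟨by linarith, by linarith, ?_⟩
  have hp : (1 - rhoBar d lam) ^ (d - 1) = 1 - rho lam := by
    rw [e, ← Real.rpow_natCast, ← Real.rpow_mul (by linarith), hd1,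
      one_div_mul_cancel (by linarith), Real.rpow_one]
  have e3 : (1 - rho lam) ^ (1 / ((d : ℝ) - 1)) =
      Real.exp (-(lam * rho lam) * (1 / ((d : ℝ) - 1))) := by rw [h2, Real.exp_mul]
  rw [cumRate, hp, e, e3]
  congr 1
  have : (d : ℝ) - 1 ≠ 0 := by linarith
  field_simp
  ring

/-- The form in which the constant arises as the limit of `discreteVariance`, with `1 - rhoBar` in
the role of β. -/
lemma varConst_eq (hd : 2 ≤ d) :
    varConst d lam = (1 - rhoBar d lam) * (1 - (1 - rhoBar d lam)) +
      (1 - rhoBar d lam) ^ 2 * (lam - lam * (1 - rhoBar d lam) ^ (d - 2)) := by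
  rw [varConst, lamStar]
  have : (1 - rhoBar d lam) ^ (d - 1) = (1 - rhoBar d lam) ^ (d - 2) * (1 - rhoBar d lam) := by
    rw [← pow_succ]; congr 1; omega
  rw [this]
  ring

lemma varConst_pos (hd : 2 ≤ d) (hlam : 1 < lam) : 0 < varConst d lam := by
  obtain ⟨h0, h1, -⟩ := rhoBar_spec hd hlam
  rw [varConst_eq hd]
  have hx : (1 - rhoBar d lam) ^ (d - 2) ≤ 1 := pow_le_one₀ (by linarith) (by linarith)
  have h2 : 0 < (1 - rhoBar d lam) * (1 - (1 - rhoBar d lam)) :=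
    mul_pos (by linarith) (by linarith)
  have h3 : 0 ≤ (1 - rhoBar d lam) ^ 2 * (lam - lam * (1 - rhoBar d lam) ^ (d - 2)) :=
    mul_nonneg (sq_nonneg _) (by nlinarith)
  linarith

lemma convexOn_exp_neg_cumRate (hd : 2 ≤ d) (hlam : 0 ≤ lam) :
    ConvexOn ℝ (Set.Icc 0 1) fun s => Real.exp (-cumRate d lam s) := by
  have hd2 : (2 : ℝ) ≤ d := by exact_mod_cast hd
  have hc : 0 ≤ lam / ((d : ℝ) - 1) := div_nonneg hlam (by linarith)
  have h1 : ConvexOn ℝ (Set.Icc (0 : ℝ) 1) fun s => -cumRate d lam s := by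
    have h2 : ConvexOn ℝ (Set.Icc (0 : ℝ) 1) fun s : ℝ => (1 - s) ^ (d - 1) := by
      refine ⟨convex_Icc 0 1, fun x hx y hy a b ha hb hab => ?_⟩
      have := (convexOn_pow (𝕜 := ℝ) (d - 1)).2 (x := 1 - x) (y := 1 - y)
        (by simpa using hx.2) (by simpa using hy.2) ha hb hab
      simp only [smul_eq_mul] at this ⊢
      have e : 1 - (a * x + b * y) = a * (1 - x) + b * (1 - y) := by
        linear_combination -hab
      rw [e]
      exact this
    have h3 := (h2.smul hc).add_const (-(lam / ((d : ℝ) - 1)))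
    refine h3.congr fun s _ => ?_
    simp only [Pi.add_apply, smul_eq_mul, cumRate]
    ring
  refine ⟨convex_Icc 0 1, fun x hx y hy a b ha hb hab => ?_⟩
  exact (Real.exp_le_exp.2 (h1.2 hx hy ha hb hab)).trans
    (convexOn_exp.2 trivial trivial ha hb hab)

/-- A convex function lies below its chord, and the chord over `[0, rhoBar]` is the line `1 - s`. -/
lemma exp_neg_cumRate_le (hd : 2 ≤ d) (hlam : 1 < lam) {s : ℝ} (h0 : 0 ≤ s)
    (h1 : s ≤ rhoBar d lam) : Real.exp (-cumRate d lam s) ≤ 1 - s := by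
  obtain ⟨r0, r1, hr⟩ := rhoBar_spec hd hlam
  have hm0 : (0 : ℝ) ∈ Set.Icc (0 : ℝ) 1 := ⟨le_rfl, zero_le_one⟩
  have hm1 : rhoBar d lam ∈ Set.Icc (0 : ℝ) 1 := ⟨r0.le, r1.le⟩
  have hb : 0 ≤ s / rhoBar d lam := by positivity
  have ha : 0 ≤ 1 - s / rhoBar d lam := sub_nonneg.2 ((div_le_one r0).2 h1)
  have hconv := (convexOn_exp_neg_cumRate hd (by linarith : 0 ≤ lam)).2 hm0 hm1 ha hb (by ring)
  simp only [smul_eq_mul, mul_zero, zero_add] at hconv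
  rw [div_mul_cancel₀ _ r0.ne', hr] at hconv
  have e0 : cumRate d lam 0 = 0 := by simp [cumRate]
  rw [e0, neg_zero, Real.exp_zero] at hconv
  refine hconv.trans_eq ?_
  field_simp
  ring

lemma exp_neg_cumRate_antitone (hd : 2 ≤ d) (hlam : 0 ≤ lam) {s s' : ℝ} (h : s ≤ s')
    (h1 : s' ≤ 1) : Real.exp (-cumRate d lam s') ≤ Real.exp (-cumRate d lam s) := by
  have hd2 : (2 : ℝ) ≤ d := by exact_mod_cast hd
  have hc : 0 ≤ lam / ((d : ℝ) - 1) := div_nonneg hlam (by linarith)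
  have h2 : (1 - s') ^ (d - 1) ≤ (1 - s) ^ (d - 1) :=
    pow_le_pow_left₀ (by linarith) (by linarith) _
  apply Real.exp_le_exp.2
  rw [cumRate, cumRate]
  nlinarith

/-- The time `γ(N)` may exceed `rhoBar · N` slightly; past `rhoBar` monotonicity loses at most `ω`.
-/
lemma exp_neg_cumRate_le' (hd : 2 ≤ d) (hlam : 1 < lam) {s ω : ℝ} (h0 : 0 ≤ s) (hω : 0 ≤ ω)
    (h1 : s ≤ 1) (h2 : s ≤ rhoBar d lam + ω) : Real.exp (-cumRate d lam s) ≤ 1 - s + ω := by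
  rcases le_total s (rhoBar d lam) with h | h
  · linarith [exp_neg_cumRate_le hd hlam h0 h]
  · obtain ⟨r0, r1, hr⟩ := rhoBar_spec hd hlam
    have := exp_neg_cumRate_antitone hd (by linarith : 0 ≤ lam) h h1
    linarith

end Asymptotics

/-! ### Passage to the limit and probability of the good event. -/

section Limits

variable {d : ℕ} {lam : ℝ} {k γ : ℕ → ℕ}

lemma tendsto_natCast_rpow_sub_one {α : ℝ} (hα : α < 1) :
    Tendsto (fun N : ℕ => (N : ℝ) ^ (α - 1)) atTop (𝓝 0) := by
  have := (tendsto_rpow_neg_atTop (show 0 < 1 - α by linarith)).comp tendsto_natCast_atTop_atTop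
  refine this.congr fun N => ?_
  rw [Function.comp, neg_sub]

lemma tendsto_const_div_natCast (c : ℝ) : Tendsto (fun N : ℕ => c / (N : ℝ)) atTop (𝓝 0) :=
  tendsto_const_div_atTop_nhds_zero_nat c

lemma eventually_edgeProb_le_one (hd : 2 ≤ d) :
    ∀ᶠ N : ℕ in atTop, edgeProb d lam N ≤ 1 := by
  filter_upwards [eventually_ge_atTop 1,
    tendsto_natCast_atTop_atTop.eventually_ge_atTop (lam * ((d - 2).factorial : ℝ))] with N h1 h2
  have hN1 : (1 : ℝ) ≤ N := by exact_mod_cast h1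
  rw [edgeProb, div_le_one (by positivity)]
  exact h2.trans (le_self_pow₀ hN1 (by omega))

/-- The conditions on `N` under which all uniform estimates hold. -/
lemma eventually_regular (hd : 2 ≤ d) {x : ℝ} (hx : x < 1)
    (hγ : Tendsto (fun N : ℕ => (γ N : ℝ) / N) atTop (𝓝 x)) :
    ∀ᶠ N : ℕ in atTop, 0 < N ∧ 4 * lam ≤ N ∧ lam * d ≤ N ∧ edgeProb d lam N ≤ 1 ∧ γ N < N := by
  filter_upwards [eventually_gt_atTop 0, eventually_edgeProb_le_one hd,
    tendsto_natCast_atTop_atTop.eventually_ge_atTop (4 * lam),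
    tendsto_natCast_atTop_atTop.eventually_ge_atTop (lam * d),
    hγ.eventually_lt_const hx] with N h1 h2 h3 h4 h5
  refine ⟨h1, h3, h4, h2, ?_⟩
  rw [div_lt_one (by exact_mod_cast h1)] at h5
  exact_mod_cast h5

lemma tendsto_of_abs_sub_le {u v : ℕ → ℝ} {C l : ℝ}
    (h : ∀ᶠ N : ℕ in atTop, |u N - v N| ≤ C / N) (hv : Tendsto v atTop (𝓝 l)) :
    Tendsto u atTop (𝓝 l) := by
  have h0 : Tendsto (fun N => u N - v N) atTop (𝓝 0) :=
    squeeze_zero_norm' (by simpa using h) (tendsto_const_div_natCast C)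
  simpa using h0.add hv

lemma tendsto_alphaSum (hd : 2 ≤ d) (hlam : 0 ≤ lam) {x : ℝ} (hx : x < 1)
    (hγ : Tendsto (fun N : ℕ => (γ N : ℝ) / N) atTop (𝓝 x)) :
    Tendsto (fun N : ℕ => alphaSum d lam N (γ N)) atTop (𝓝 (cumRate d lam x)) := by
  refine tendsto_of_abs_sub_le (C := 2 * lam * d)
    (v := fun N : ℕ => cumRate d lam ((γ N : ℝ) / N)) ?_ ?_
  · filter_upwards [eventually_regular (lam := lam) hd hx hγ] with N hN
    exact abs_alphaSum_sub_cumRate_le hd hlam hN.2.2.2.2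
  · have hc : Continuous (cumRate d lam) := by unfold cumRate; fun_prop
    exact (hc.tendsto x).comp hγ

lemma tendsto_betaCoeff (hd : 2 ≤ d) (hlam : 0 ≤ lam) {x : ℝ} (hx : x < 1)
    (hγ : Tendsto (fun N : ℕ => (γ N : ℝ) / N) atTop (𝓝 x)) :
    Tendsto (fun N : ℕ => betaCoeff d lam N (γ N)) atTop (𝓝 (Real.exp (-cumRate d lam x))) := by
  have hA := tendsto_alphaSum hd hlam hx hγ
  have hU := (Real.continuous_exp.tendsto _).comp hA.neg
  have hE : Tendsto (fun N : ℕ => -alphaSum d lam N (γ N) - 4 * lam ^ 2 / N) atTop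
      (𝓝 (-cumRate d lam x)) := by
    simpa using hA.neg.sub (tendsto_const_div_natCast (4 * lam ^ 2))
  have hL := (Real.continuous_exp.tendsto _).comp hE
  refine tendsto_of_tendsto_of_tendsto_of_le_of_le' hL hU ?_ ?_
  · filter_upwards [eventually_regular (lam := lam) hd hx hγ] with N hN
    refine le_trans (Real.exp_le_exp.2 ?_) (exp_le_betaCoeff hd hlam hN.1 hN.2.1 _)
    have hN' : (0 : ℝ) < N := by exact_mod_cast hN.1
    have hγN : (γ N : ℝ) ≤ N := by exact_mod_cast hN.2.2.2.2.le
    have : 4 * (γ N : ℝ) * (lam / N) ^ 2 ≤ 4 * N * (lam / N) ^ 2 := by gcongr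
    have e : 4 * (N : ℝ) * (lam / N) ^ 2 = 4 * lam ^ 2 / N := by field_simp
    linarith
  · filter_upwards [eventually_regular (lam := lam) hd hx hγ] with N hN
    exact betaCoeff_le_exp hd hlam hN.1 hN.2.1 _

lemma tendsto_mul_alphaCoeff (hd : 2 ≤ d) (hlam : 0 ≤ lam) {x : ℝ} (hx : x < 1)
    (hγ : Tendsto (fun N : ℕ => (γ N : ℝ) / N) atTop (𝓝 x)) :
    Tendsto (fun N : ℕ => N * alphaCoeff d lam N (γ N)) atTop (𝓝 (lam * (1 - x) ^ (d - 2))) := by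
  refine tendsto_of_abs_sub_le (C := lam * (((d - 2 : ℕ) : ℝ) ^ 2 + ((d - 2 : ℕ) : ℝ)))
    (v := fun N : ℕ => lam * (1 - (γ N : ℝ) / N) ^ (d - 2)) ?_ ?_
  · filter_upwards [eventually_regular (lam := lam) hd hx hγ] with N hN
    exact abs_mul_alphaCoeff_sub_le hd hlam hN.2.2.2.2
  · exact ((tendsto_const_nhds.sub hγ).pow _).const_mul _

lemma tendsto_discreteVariance (hd : 2 ≤ d) (hlam : 1 < lam)
    (hγ : Tendsto (fun N : ℕ => (γ N : ℝ) / N) atTop (𝓝 (rhoBar d lam))) :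
    Tendsto (fun N : ℕ => discreteVariance d lam N (γ N)) atTop (𝓝 (varConst d lam)) := by
  obtain ⟨r0, r1, hr⟩ := rhoBar_spec hd hlam
  have hl : 0 ≤ lam := by linarith
  have hβ := tendsto_betaCoeff hd hl r1 hγ
  rw [hr] at hβ
  have h1 : Tendsto (fun N : ℕ => (N : ℝ) * alphaCoeff d lam N 1) atTop (𝓝 lam) := by
    have := tendsto_mul_alphaCoeff (γ := fun _ => 1) hd hl (x := 0) one_pos (by
      simpa using tendsto_const_div_natCast 1)
    simpa using this
  have h2 : Tendsto (fun N : ℕ => (N : ℝ) * alphaCoeff d lam N (γ N + 1)) atTop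
      (𝓝 (lam * (1 - rhoBar d lam) ^ (d - 2))) := by
    refine tendsto_mul_alphaCoeff (γ := fun N => γ N + 1) hd hl r1 ?_
    have := hγ.add (tendsto_const_div_natCast 1)
    rw [add_zero] at this
    refine this.congr fun N => ?_
    push_cast
    ring
  rw [varConst_eq hd]
  exact (hβ.mul (tendsto_const_nhds.sub hβ)).add ((hβ.pow 2).mul (h1.sub h2))

lemma eventually_mul_betaCoeff_le (hd : 2 ≤ d) (hlam : 1 < lam)
    (hγ : Tendsto (fun N : ℕ => (γ N : ℝ) / N) atTop (𝓝 (rhoBar d lam))) {ω : ℝ} (hω : 0 < ω) :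
    ∀ᶠ N : ℕ in atTop, ∀ t ≤ γ N, N * betaCoeff d lam N t ≤ N - t + ω * N := by
  obtain ⟨r0, r1, hr⟩ := rhoBar_spec hd hlam
  have hl : 0 ≤ lam := by linarith
  have hexp : Tendsto (fun N : ℕ => Real.exp (2 * lam * d / N)) atTop (𝓝 1) := by
    have := (Real.continuous_exp.tendsto _).comp (tendsto_const_div_natCast (2 * lam * d))
    rwa [Real.exp_zero] at this
  filter_upwards [eventually_regular (lam := lam) hd r1 hγ,
    hγ.eventually_lt_const (show rhoBar d lam < rhoBar d lam + ω / 2 by linarith),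
    hexp.eventually_lt_const (show (1 : ℝ) < 1 + ω / 2 by linarith)] with N hN h1 h2 t ht
  obtain ⟨hN0, hN4, -, -, hγN⟩ := hN
  have hN' : (0 : ℝ) < N := by exact_mod_cast hN0
  have htγ : (t : ℝ) / N ≤ (γ N : ℝ) / N := by gcongr
  have ht1 : (t : ℝ) / N ≤ 1 := by
    rw [div_le_one hN']
    exact_mod_cast (lt_of_le_of_lt ht hγN).le
  have h3 := exp_neg_cumRate_le' hd hlam (s := (t : ℝ) / N) (ω := ω / 2) (by positivity)
    (by linarith) ht1 (by linarith)
  have h4 := (abs_le.1 (abs_alphaSum_sub_cumRate_le (d := d) (N := N) hd hl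
    (lt_of_le_of_lt ht hγN))).1
  have h5 : betaCoeff d lam N t ≤
      Real.exp (-cumRate d lam ((t : ℝ) / N)) * Real.exp (2 * lam * d / N) := by
    refine (betaCoeff_le_exp hd hl hN0 hN4 t).trans ?_
    rw [← Real.exp_add]
    exact Real.exp_le_exp.2 (by linarith)
  have hs1 : Real.exp (-cumRate d lam ((t : ℝ) / N)) ≤ 1 := by
    have := exp_neg_cumRate_antitone hd hl (show (0 : ℝ) ≤ (t : ℝ) / N by positivity) ht1
    have e0 : cumRate d lam 0 = 0 := by simp [cumRate]
    rwa [e0, neg_zero, Real.exp_zero] at this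
  have hp := Real.exp_pos (-cumRate d lam ((t : ℝ) / N))
  have h6 : betaCoeff d lam N t ≤ 1 - (t : ℝ) / N + ω := by nlinarith
  calc N * betaCoeff d lam N t ≤ N * (1 - (t : ℝ) / N + ω) := by gcongr
    _ = _ := by field_simp

lemma eventually_abs_varianceSum_sub_le (hd : 2 ≤ d) (hlam : 1 < lam)
    (hk : Tendsto (fun N : ℕ => (k N : ℝ) / (N : ℝ)) atTop (𝓝 0))
    (hγ : Tendsto (fun N : ℕ => (γ N : ℝ) / N) atTop (𝓝 (rhoBar d lam))) {κ : ℝ} (hκ : 0 < κ) :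
    ∃ δ : ℝ, 0 < δ ∧ ∀ᶠ N : ℕ in atTop, ∀ G : Set (Finset (Fin N)),
      (∀ t ≤ γ N, |explMart d lam N (k N) t G| ≤ δ * N) →
      |varianceSum d lam N (k N) (γ N) G - N * varConst d lam| ≤ κ * N := by
  obtain ⟨r0, r1, hr⟩ := rhoBar_spec hd hlam
  have hl : 0 < lam := by linarith
  have hB := one_le_betaInvBound hl.le
  set B := betaInvBound lam with hBdef
  set D := lam + 2 * (lam * d) with hD
  have hD0 : 0 < D := by positivity
  -- With this `δ` and the `ω` below, the terms `2δN · D` and `BωN · D` are each `κN / 4`. The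
  -- bounded terms together with `k` take a third quarter, and the convergence of `discreteVariance`
  -- the last.
  refine ⟨κ / (8 * D), by positivity, ?_⟩
  set ω := κ / (4 * (B * D)) with hω
  have hω0 : 0 < ω := by positivity
  have hsmall : Tendsto (fun N : ℕ => (varianceError d lam +
      (2 * (lam ^ 2 * B) + 2 * B + lam) * D) / N + (k N : ℝ) / N * D) atTop (𝓝 0) := by
    simpa using (tendsto_const_div_natCast (varianceError d lam +
      (2 * (lam ^ 2 * B) + 2 * B + lam) * D)).add (hk.mul_const D)
  have hdv := (tendsto_discreteVariance hd hlam hγ).sub_const (varConst d lam)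
  rw [sub_self] at hdv
  have hdv' := hdv.abs
  rw [abs_zero] at hdv'
  filter_upwards [eventually_regular (lam := lam) hd r1 hγ, eventually_mul_betaCoeff_le hd hlam hγ hω0,
    hsmall.eventually_lt_const (show (0 : ℝ) < κ / 4 by linarith),
    hdv'.eventually_lt_const (show (0 : ℝ) < κ / 4 by linarith)] with N hN h1 h2 h3 G hS
  obtain ⟨hN0, hN4, hNd, hp1, hγN⟩ := hN
  have hN' : (0 : ℝ) < N := by exact_mod_cast hN0
  have h4 := abs_varianceSum_sub_le (k := k N) hd hl.le hp1 hN0 hN4 hNd G hγN.le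
    (δ := κ / (8 * D)) (by positivity) hω0.le hS h1
  have e : varianceSum d lam N (k N) (γ N) G - N * varConst d lam =
      (varianceSum d lam N (k N) (γ N) G - N * discreteVariance d lam N (γ N)) +
      N * (discreteVariance d lam N (γ N) - varConst d lam) := by ring
  rw [e]
  refine (abs_add_le _ _).trans ?_
  rw [abs_mul, abs_of_pos hN']
  have h5 : N * |discreteVariance d lam N (γ N) - varConst d lam| ≤ N * (κ / 4) := by
    gcongr
  have h6 : varianceError d lam + (unseenError lam N (k N) (κ / (8 * D)) ω + lam) * D =
      N * ((varianceError d lam + (2 * (lam ^ 2 * B) + 2 * B + lam) * D) / N + (k N : ℝ) / N * D) +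
      N * (κ / 4) + N * (κ / 4) := by
    rw [unseenError, hω, ← hBdef]
    have : B ≠ 0 := by positivity
    field_simp
    ring
  have h7 : N * ((varianceError d lam + (2 * (lam ^ 2 * B) + 2 * B + lam) * D) / N +
      (k N : ℝ) / N * D) ≤ N * (κ / 4) := by gcongr
  rw [← hD, h6] at h4
  linarith

/-- A tilt `τ` fixed independently of `N` gives decay exponential in `N` at each time, and a union
over at most `N` times costs only a linear factor. -/
lemma exists_tail_rate (hd : 2 ≤ d) (hlam : 0 ≤ lam) {x : ℝ} (hx : x < 1)
    (hγ : Tendsto (fun N : ℕ => (γ N : ℝ) / N) atTop (𝓝 x)) {δ : ℝ} (hδ : 0 < δ) :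
    ∃ r : ℝ, 0 < r ∧ ∀ᶠ N : ℕ in atTop,
      (hypergraphLaw d lam N).real {G | ¬ ∀ t ≤ γ N, |explMart d lam N (k N) t G| ≤ δ * N} ≤
        2 * N * Real.exp (-(r * N)) := by
  have hB := one_le_betaInvBound hlam
  have hK := one_le_momentBound (d := d) hlam
  set B := betaInvBound lam with hBdef
  set K := momentBound d lam with hKdef
  -- The first entry makes the tilt admissible in the exponential bound, the second makes the
  -- Gaussian term `2Kτ²B²` at most half of `τδ`.
  set τ := min (1 / (100 * K * B)) (δ / (4 * K * B ^ 2)) with hτ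
  have hτ0 : 0 < τ := lt_min (by positivity) (by positivity)
  refine ⟨τ * δ / 2, by positivity, ?_⟩
  filter_upwards [eventually_regular (lam := lam) hd hx hγ] with N hN
  obtain ⟨hN0, hN4, -, hp1, hγN⟩ := hN
  have hN' : (0 : ℝ) < N := by exact_mod_cast hN0
  have hσ : 100 * K * (τ * B) ≤ 1 := by
    have : τ ≤ 1 / (100 * K * B) := min_le_left _ _
    rw [le_div_iff₀ (by positivity)] at this
    linarith
  have hexp : ∀ t ≤ γ N, (hypergraphLaw d lam N).real
      {G | δ * N ≤ |explMart d lam N (k N) t G|} ≤ 2 * Real.exp (-(τ * δ / 2 * N)) := by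
    intro t ht
    refine (measureReal_linStat_ge_le (k := k N) hd hlam hp1 (t := t) (by omega) hτ0.le hσ
      (s := fun i => 1 / betaCoeff d lam N (i + 1)) (fun i hi => ?_) (δ * N)).trans ?_
    · rw [abs_of_pos (one_div_pos.2 (betaCoeff_pos hd hlam hN0 hN4 _))]
      exact inv_betaCoeff_le hd hlam hN0 hN4 (by omega)
    · refine mul_le_mul_of_nonneg_left (Real.exp_le_exp.2 ?_) zero_le_two
      have h2 : τ ≤ δ / (4 * K * B ^ 2) := min_le_right _ _
      rw [le_div_iff₀ (by positivity)] at h2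
      have h3 : τ * N * (τ * (4 * K * B ^ 2)) ≤ τ * N * δ := by gcongr
      rw [← hKdef]
      nlinarith
  have hsub : {G : Set (Finset (Fin N)) | ¬ ∀ t ≤ γ N, |explMart d lam N (k N) t G| ≤ δ * N} ⊆
      ⋃ t ∈ Finset.range (γ N + 1), {G | δ * N ≤ |explMart d lam N (k N) t G|} := by
    intro G hG
    simp only [Set.mem_ofPred_eq, not_forall, not_le] at hG
    obtain ⟨t, ht, h⟩ := hG
    simp only [Set.mem_iUnion]
    exact ⟨t, Finset.mem_range.2 (by omega), h.le⟩
  refine (measureReal_mono hsub (measure_ne_top _ _)).trans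
    ((measureReal_biUnion_finset_le _ _).trans
      ((Finset.sum_le_sum fun t ht => hexp t (by have := Finset.mem_range.1 ht; omega)).trans ?_))
  rw [Finset.sum_const, Finset.card_range, nsmul_eq_mul]
  have h5 : ((γ N + 1 : ℕ) : ℝ) ≤ N := by exact_mod_cast hγN
  have h6 := Real.exp_pos (-(τ * δ / 2 * N))
  nlinarith

end Limits

/-! ### Identification with the explicit martingale. -/

section MartingaleForm

variable {N k d : ℕ} {lam : ℝ}

lemma explorationMartingale_ae_eq (hd : 2 ≤ d) (hlam : 0 ≤ lam) (h1 : edgeProb d lam N ≤ 1)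
    {t : ℕ} (ht : t ≤ N) :
    explorationMartingale d lam N k t =ᵐ[hypergraphLaw d lam N] explMart d lam N k t := by
  induction t with
  | zero =>
    refine ae_of_all _ fun G => ?_
    simp [explorationMartingale, explMart, linStat]
  | succ t ih =>
    filter_upwards [ih (by omega),
      increment_ae_eq (k := k) hd (edgeProb_nonneg hlam) h1 (t := t) (by omega)] with G hG hG'
    rw [explMart, linStat, Finset.sum_range_succ, ← hG', explorationMartingale,
      Finset.sum_Icc_succ_top (by omega)]
    congr 1

lemma quadStat_eq_varianceSum (c : ℝ) (T : ℕ) (G : Set (Finset (Fin N))) :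
    quadStat d lam N k (fun i => c * (betaCoeff d lam N T / betaCoeff d lam N (i + 1))) T G =
      c ^ 2 / 2 * varianceSum d lam N k T G := by
  rw [quadStat, varianceSum, Finset.mul_sum]
  exact Finset.sum_congr rfl fun i _ => by ring

lemma linStat_eq_explMart (c : ℝ) (T : ℕ) (G : Set (Finset (Fin N))) :
    linStat d lam N k (fun i => c * (betaCoeff d lam N T / betaCoeff d lam N (i + 1))) T G =
      c * (betaCoeff d lam N T * explMart d lam N k T G) := by
  rw [linStat, explMart, linStat, Finset.mul_sum, Finset.mul_sum]
  exact Finset.sum_congr rfl fun i _ => by ring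

end MartingaleForm

/-! ### Logarithmic moment generating functions at the moderate scale. -/

section Final

variable {d : ℕ} {lam α ζ : ℝ} {k γ : ℕ → ℕ}

lemma tendsto_gamma_div (hα' : α < 1)
    (hγ : ∀ᶠ N : ℕ in atTop, |(γ N : ℝ) - (rhoBar d lam * N + ζ * (N : ℝ) ^ α)| ≤ 1) :
    Tendsto (fun N : ℕ => (γ N : ℝ) / N) atTop (𝓝 (rhoBar d lam)) := by
  refine tendsto_of_abs_sub_le (C := 1)
    (v := fun N : ℕ => rhoBar d lam + ζ * (N : ℝ) ^ (α - 1)) ?_ ?_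
  · filter_upwards [hγ, eventually_gt_atTop 0] with N h1 h2
    have hN : (0 : ℝ) < N := by exact_mod_cast h2
    have e : (γ N : ℝ) / N - (rhoBar d lam + ζ * (N : ℝ) ^ (α - 1)) =
        ((γ N : ℝ) - (rhoBar d lam * N + ζ * (N : ℝ) ^ α)) / N := by
      rw [Real.rpow_sub_one hN.ne']
      field_simp
    rw [e, abs_div, abs_of_pos hN]
    gcongr
  · simpa using ((tendsto_natCast_rpow_sub_one hα').const_mul ζ).const_add (rhoBar d lam)

/-- The moment generating function of the martingale at scale `ε`, for a fixed number of vertices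
`N`, up to an error determined by the good event. -/
lemma integral_exp_explMart_bounds {N k T : ℕ} (hd : 2 ≤ d) (hlam : 0 ≤ lam)
    (hN : 0 < N) (hN4 : 4 * lam ≤ N) (hp1 : edgeProb d lam N ≤ 1) (hT : T < N)
    {θ ε c κ κ' κ₁ δ : ℝ} (hε : 0 < ε) (hc : 0 ≤ c) (hκ : 0 ≤ κ) (hκ' : 0 ≤ κ')
    (hκ'2 : κ' ≤ 1 / 2) (hκ₁ : θ ^ 2 / 2 * κ₁ ≤ κ) (ha : 4 ≤ ε ^ 2 * N)
    (hvar : ∀ G : Set (Finset (Fin N)), (∀ t ≤ T, |explMart d lam N k t G| ≤ δ * N) →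
      |varianceSum d lam N k T G - N * c| ≤ κ₁ * N)
    (hlin : 100 * momentBound d lam * (2 * (|θ| * ε * betaInvBound lam)) ≤ 1)
    (hcub : 100 * momentBound d lam * (|θ| * betaInvBound lam) ^ 3 * ε ≤ κ')
    (htail : (hypergraphLaw d lam N).real {G | ¬ ∀ t ≤ T, |explMart d lam N k t G| ≤ δ * N} ≤
      Real.exp (-((8 * momentBound d lam * θ ^ 2 * betaInvBound lam ^ 2 + 2) * ε ^ 2 * N))) :
    Real.exp (ε ^ 2 * N * (c * θ ^ 2 / 2) - κ * (ε ^ 2 * N) - κ' * (ε ^ 2 * N)) / 2 ≤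
      ∫ G, Real.exp (θ * ε * (betaCoeff d lam N T * explMart d lam N k T G))
        ∂(hypergraphLaw d lam N) ∧
    ∫ G, Real.exp (θ * ε * (betaCoeff d lam N T * explMart d lam N k T G))
        ∂(hypergraphLaw d lam N) ≤
      3 * Real.exp (ε ^ 2 * N * (c * θ ^ 2 / 2) + κ * (ε ^ 2 * N) + κ' * (ε ^ 2 * N)) := by
  have hB := one_le_betaInvBound hlam
  have hK := one_le_momentBound (d := d) hlam
  have hN' : (0 : ℝ) < N := by exact_mod_cast hN
  have hsσ : ∀ i < T, |θ * ε * (betaCoeff d lam N T / betaCoeff d lam N (i + 1))| ≤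
      |θ| * ε * betaInvBound lam := by
    intro i hi
    have hb := betaCoeff_pos hd hlam hN hN4 (i + 1)
    have hbγ := betaCoeff_pos hd hlam hN hN4 T
    have hb1 := betaCoeff_le_one hd hlam hN hN4 T
    have hbi := inv_betaCoeff_le hd hlam hN hN4 (t := i + 1) (by omega)
    rw [abs_mul, abs_mul, abs_of_pos hε, abs_of_pos (div_pos hbγ hb)]
    refine mul_le_mul_of_nonneg_left ?_ (by positivity)
    refine le_trans ?_ hbi
    gcongr
  have hQ : ∀ G, quadStat d lam N k
      (fun i => θ * ε * (betaCoeff d lam N T / betaCoeff d lam N (i + 1))) T G =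
      (θ * ε) ^ 2 / 2 * varianceSum d lam N k T G := quadStat_eq_varianceSum _ _
  have hW : ∀ G, θ * ε * (betaCoeff d lam N T * explMart d lam N k T G) = linStat d lam N k
      (fun i => θ * ε * (betaCoeff d lam N T / betaCoeff d lam N (i + 1))) T G :=
    fun G => (linStat_eq_explMart _ _ _).symm
  simp_rw [hW]
  generalize hs : (fun i => θ * ε * (betaCoeff d lam N T / betaCoeff d lam N (i + 1))) = s
    at hQ ⊢
  replace hsσ : ∀ i < T, |s i| ≤ |θ| * ε * betaInvBound lam := by
    rw [← hs]; exact hsσ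
  generalize hKd : momentBound d lam = K at *
  generalize betaInvBound lam = B at *
  have hK0 : 0 < K := by linarith
  have hB0 : 0 < B := by linarith
  have hσ0 : 0 ≤ |θ| * ε * B := by positivity
  have hcubsum : ∑ i ∈ Finset.range T, 100 * K * |s i| ^ 3 ≤ κ' * (ε ^ 2 * N) := by
    have hb : ∑ i ∈ Finset.range T, 100 * K * |s i| ^ 3 ≤
        ∑ i ∈ Finset.range T, 100 * K * (|θ| * ε * B) ^ 3 := by
      refine Finset.sum_le_sum fun i hi => ?_
      have := hsσ i (Finset.mem_range.1 hi)
      gcongr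
    rw [Finset.sum_const, Finset.card_range, nsmul_eq_mul] at hb
    have hγ' : (T : ℝ) ≤ N := by exact_mod_cast hT.le
    calc _ ≤ (T : ℝ) * (100 * K * (|θ| * ε * B) ^ 3) := hb
      _ ≤ N * (100 * K * (|θ| * ε * B) ^ 3) := by gcongr
      _ = (100 * K * (|θ| * B) ^ 3 * ε) * (ε ^ 2 * N) := by ring
      _ ≤ κ' * (ε ^ 2 * N) := by gcongr
  obtain ⟨hl1, hu1⟩ := integral_chain_bounds (k := k) hd hlam hp1 hT.le (s := s)
    (fun i hi => by
      have := mul_le_mul_of_nonneg_left (hsσ i hi) (show 0 ≤ 100 * K by positivity)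
      have h9 : 0 ≤ 100 * K * (|θ| * ε * B) := by positivity
      rw [hKd]
      linarith)
  rw [hKd] at hl1 hu1
  have hL := integral_exp_linStat_le (k := k) (s := fun i => 2 * s i) (t := T) hd hlam hp1
    hT.le (by rw [hKd]; exact hlin) (fun i hi => by
      rw [abs_mul, abs_two]
      exact mul_le_mul_of_nonneg_left (hsσ i hi) zero_le_two)
  simp only [linStat_const_mul] at hL
  -- Here `L = 2K (2|θ|εB)² N` comes from `integral_exp_linStat_le`, and the tail hypothesis is `L +
  -- 2y` with `y = ε²N`. The condition on `y` follows from `κ' ≤ 1 / 2` and `ε²N ≥ 4`.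
  refine half_exp_le_integral_exp_le (μ := hypergraphLaw d lam N)
    (B := {G | ¬ ∀ t ≤ T, |explMart d lam N k t G| ≤ δ * N})
    (L := 8 * K * θ ^ 2 * B ^ 2 * (ε ^ 2 * N)) (y := ε ^ 2 * N)
    (quadStat_nonneg s _) (by positivity) (by positivity) (by positivity) ?_
    ((Real.exp_le_exp.2 (neg_le_neg hcubsum)).trans hl1)
    (hu1.trans (Real.exp_le_exp.2 hcubsum)) ?_ ?_ ?_
  · intro G hG
    have h9 := hvar G (not_not.1 hG)
    have e1 : quadStat d lam N k s T G - ε ^ 2 * N * (c * θ ^ 2 / 2) =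
        θ ^ 2 * ε ^ 2 / 2 * (varianceSum d lam N k T G - N * c) := by
      rw [hQ]; ring
    rw [e1, abs_mul, abs_of_nonneg (by positivity)]
    calc θ ^ 2 * ε ^ 2 / 2 * |varianceSum d lam N k T G - N * c|
        ≤ θ ^ 2 * ε ^ 2 / 2 * (κ₁ * N) := by gcongr
      _ = θ ^ 2 / 2 * κ₁ * (ε ^ 2 * N) := by ring
      _ ≤ κ * (ε ^ 2 * N) := by gcongr
  · refine hL.trans_eq ?_
    rw [hKd, mul_pow, mul_pow, mul_pow, sq_abs]
    congr 1
    ring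
  · refine htail.trans_eq ?_
    congr 1
    ring
  · nlinarith

lemma eventually_natCast_le_exp {r : ℝ} (hr : 0 < r) :
    ∀ᶠ N : ℕ in atTop, 2 * (N : ℝ) ≤ Real.exp (r * N) := by
  have h := (Real.tendsto_pow_mul_exp_neg_atTop_nhds_zero 1).comp
    (tendsto_natCast_atTop_atTop.const_mul_atTop hr :
      Tendsto (fun N : ℕ => r * (N : ℝ)) atTop atTop)
  filter_upwards [h.eventually_lt_const (show 0 < r / 2 by positivity)] with N hN
  simp only [Function.comp, pow_one, Real.exp_neg, ← div_eq_mul_inv] at hN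
  rw [div_lt_iff₀ (Real.exp_pos _)] at hN
  nlinarith

lemma mgf_exploration_eq {N k T : ℕ} (hd : 2 ≤ d) (hlam : 0 ≤ lam) (hN : 0 < N)
    (hp1 : edgeProb d lam N ≤ 1) (hT : T ≤ N) (θ : ℝ) :
    mgf (fun G => betaCoeff d lam N T * explorationMartingale d lam N k T G / (N : ℝ) ^ α)
        (hypergraphLaw d lam N) (θ * (N : ℝ) ^ (2 * α - 1)) =
      ∫ G, Real.exp (θ * (N : ℝ) ^ (α - 1) * (betaCoeff d lam N T * explMart d lam N k T G))
        ∂(hypergraphLaw d lam N) := by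
  have hN' : (0 : ℝ) < N := by exact_mod_cast hN
  have e : (N : ℝ) ^ (α - 1) = (N : ℝ) ^ (2 * α - 1) / (N : ℝ) ^ α := by
    rw [← Real.rpow_sub hN']
    congr 1
    ring
  refine integral_congr_ae ?_
  filter_upwards [explorationMartingale_ae_eq (k := k) hd hlam hp1 hT] with G hG
  rw [hG, e]
  congr 1
  ring

/-- Since `α < 1`, `ε = N^(α-1)` tends to 0, so the cubic error `ε³N` and the speed `ε²N` are small
compared with `ε²N` and `N` respectively; since `α > 1 / 2`, the speed tends to infinity and
swallows constant factors. -/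
lemma quadraticLogMgf_exploration (hd : 2 ≤ d) (hlam : 1 < lam) (hα : 1 / 2 < α) (hα' : α < 1)
    (hk : Tendsto (fun N : ℕ => (k N : ℝ) / (N : ℝ)) atTop (𝓝 0))
    (hγ : Tendsto (fun N : ℕ => (γ N : ℝ) / N) atTop (𝓝 (rhoBar d lam))) :
    QuadraticLogMgf (fun N => hypergraphLaw d lam N)
        (fun N G => betaCoeff d lam N (γ N) *
          explorationMartingale d lam N (k N) (γ N) G / (N : ℝ) ^ α)
        (fun N => (N : ℝ) ^ (2 * α - 1)) (varConst d lam) := by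
  intro θ κ hκ
  have hl : 0 ≤ lam := by linarith
  obtain ⟨r0, r1, -⟩ := rhoBar_spec hd hlam
  have hc := varConst_pos hd hlam
  have hκ'0 : 0 < min (κ / 4) (1 / 2) := lt_min (by positivity) (by norm_num)
  -- The accuracy demanded of the variance sum: multiplied by `θ² / 2` it is at most `κ / 4`. The
  -- summand 1 covers `θ = 0`.
  have hκ₁0 : 0 < κ / (2 * (θ ^ 2 + 1)) := by positivity
  have hκa : θ ^ 2 / 2 * (κ / (2 * (θ ^ 2 + 1))) ≤ κ / 4 := by
    rw [← mul_div_assoc, div_le_iff₀ (by positivity)]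
    nlinarith [sq_nonneg θ]
  obtain ⟨δ, hδ, hvar⟩ := eventually_abs_varianceSum_sub_le hd hlam hk hγ hκ₁0
  obtain ⟨r, hr, htail⟩ := exists_tail_rate (k := k) hd hl r1 hγ hδ
  have hε := tendsto_natCast_rpow_sub_one hα'
  have ha : Tendsto (fun N : ℕ => (N : ℝ) ^ (2 * α - 1)) atTop atTop :=
    (tendsto_rpow_atTop (show 0 < 2 * α - 1 by linarith)).comp tendsto_natCast_atTop_atTop
  have hlin : Tendsto (fun N : ℕ => 100 * momentBound d lam *
      (2 * (|θ| * (N : ℝ) ^ (α - 1) * betaInvBound lam))) atTop (𝓝 0) := by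
    have := hε.const_mul (100 * momentBound d lam * (2 * (|θ| * betaInvBound lam)))
    rw [mul_zero] at this
    exact this.congr fun N => by ring
  have hcub : Tendsto (fun N : ℕ => 100 * momentBound d lam * (|θ| * betaInvBound lam) ^ 3 *
      (N : ℝ) ^ (α - 1)) atTop (𝓝 0) := by
    simpa using hε.const_mul (100 * momentBound d lam * (|θ| * betaInvBound lam) ^ 3)
  have hspeed : Tendsto (fun N : ℕ => (8 * momentBound d lam * θ ^ 2 * betaInvBound lam ^ 2 + 2) *
      ((N : ℝ) ^ (α - 1)) ^ 2) atTop (𝓝 0) := by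
    simpa using (hε.pow 2).const_mul (8 * momentBound d lam * θ ^ 2 * betaInvBound lam ^ 2 + 2)
  filter_upwards [eventually_regular (lam := lam) hd r1 hγ, hvar, htail, eventually_natCast_le_exp (half_pos hr),
    hlin.eventually_lt_const one_pos, hcub.eventually_lt_const hκ'0,
    hspeed.eventually_lt_const (half_pos hr), ha.eventually_ge_atTop 4,
    two_le_exp_eventually ha (show 0 < κ / 4 by positivity)]
    with N hN h1 h2 h3 h4 h5 h6 h7 h8
  obtain ⟨hN0, hN4, -, hp1, hγN⟩ := hN
  have hN' : (0 : ℝ) < N := by exact_mod_cast hN0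
  have haε : (N : ℝ) ^ (2 * α - 1) = ((N : ℝ) ^ (α - 1)) ^ 2 * N := by
    rw [← Real.rpow_natCast, ← Real.rpow_mul hN'.le, ← Real.rpow_add_one hN'.ne']
    congr 1
    push_cast
    ring
  rw [mgf_exploration_eq hd hl hN0 hp1 hγN.le]
  have main := integral_exp_explMart_bounds (k := k N) hd hl hN0 hN4 hp1 hγN (θ := θ)
    (ε := (N : ℝ) ^ (α - 1)) (κ := κ / 4) (Real.rpow_pos_of_pos hN' _) hc.le
    (by positivity) hκ'0.le (min_le_right _ _) hκa (haε ▸ h7) h1 h4.le h5.le (by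
      refine h2.trans ?_
      calc 2 * (N : ℝ) * Real.exp (-(r * N)) ≤ Real.exp (r / 2 * N) * Real.exp (-(r * N)) := by
            gcongr
        _ = Real.exp (-(r / 2 * N)) := by rw [← Real.exp_add]; congr 1; ring
        _ ≤ _ := Real.exp_le_exp.2 (neg_le_neg (mul_le_mul_of_nonneg_right h6.le hN'.le)))
  rw [← haε] at main
  have ha0 : 0 < (N : ℝ) ^ (2 * α - 1) := by linarith
  generalize (N : ℝ) ^ (2 * α - 1) = a at *
  have hκ'4 : min (κ / 4) (1 / 2) * a ≤ κ / 4 * a :=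
    mul_le_mul_of_nonneg_right (min_le_left _ _) ha0.le
  have h44 : 4 ≤ Real.exp (a * (κ / 2)) := by
    have e3 : Real.exp (a * (κ / 2)) = Real.exp (a * (κ / 4)) * Real.exp (a * (κ / 4)) := by
      rw [← Real.exp_add]; congr 1; ring
    rw [e3]
    nlinarith
  constructor
  · refine le_trans ?_ main.1
    rw [le_div_iff₀ two_pos]
    calc Real.exp (a * (varConst d lam * θ ^ 2 / 2 - κ)) * 2
        ≤ Real.exp (a * (varConst d lam * θ ^ 2 / 2 - κ)) * Real.exp (a * (κ / 2)) := by
          gcongr; linarith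
      _ = Real.exp (a * (varConst d lam * θ ^ 2 / 2 - κ / 2)) := by
          rw [← Real.exp_add]; congr 1; ring
      _ ≤ _ := Real.exp_le_exp.2 (by linarith)
  · refine main.2.trans ?_
    calc _ ≤ Real.exp (a * (κ / 2)) * Real.exp (a * (varConst d lam * θ ^ 2 / 2 + κ / 2)) := by
          refine mul_le_mul (by linarith) (Real.exp_le_exp.2 (by linarith))
            (Real.exp_pos _).le (Real.exp_pos _).le
      _ = _ := by rw [← Real.exp_add]; congr 1; ring

end Final

end HypergraphExploration

end

open HypergraphExploration
theorem theorem2 (d : ℕ) (hd : 2 ≤ d) (lam : ℝ) (hlam : 1 < lam)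
    (α : ℝ) (hα : 1 / 2 < α) (hα' : α < 1) (ζ : ℝ)
    (k : ℕ → ℕ) (hk : Tendsto (fun N : ℕ => (k N : ℝ) / (N : ℝ)) atTop (𝓝 0))
    (γ : ℕ → ℕ)
    (hγ : ∀ᶠ N : ℕ in atTop, |(γ N : ℝ) - (rhoBar d lam * N + ζ * (N : ℝ) ^ α)| ≤ 1) :
    0 < varConst d lam ∧
      SatisfiesLDP (fun N => hypergraphLaw d lam N)
        (fun N G => betaCoeff d lam N (γ N) *
          explorationMartingale d lam N (k N) (γ N) G / (N : ℝ) ^ α)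
        (fun N => (N : ℝ) ^ (2 * α - 1))
        (fun x => ENNReal.ofReal (x ^ 2 / (2 * varConst d lam))) := by
  refine ⟨varConst_pos hd hlam, ?_⟩
  exact (quadraticLogMgf_exploration hd hlam hα hα' hk (tendsto_gamma_div hα' hγ)).satisfiesLDP
    (fun _ => measurable_of_finite _) (fun _ _ => Integrable.of_finite)
    ((tendsto_rpow_atTop (show 0 < 2 * α - 1 by linarith)).comp tendsto_natCast_atTop_atTop)
    (varConst_pos hd hlam)
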